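/- Setting. Let $L$ be a finite geometric lattice with minimum $\hat 0$ and maximum $\hat 1$. For $x\le y$ let $d(x,y)$ be the rank of the interval $[x,y]$. A building set is a subset $G\subseteq L\setminus\{\hat 0\}$ such that for every $x\ne\hat 0$, if $x_1,\dots,x_k$ are the maximal elements of $G_{\le x}$, there is a poset isomorphism $\prod_j[\hat 0,x_j]\to[\hat 0,x]$ sending $(\hat 0,\dots,x_j,\dots,\hat 0)$ to $x_j$ for each $j$; we assume $\hat 1\in G$. A partial building set is a subset $H\subseteq G$ that contains all atoms of $L$ and whose set $H^\circ$ of non-atoms is upward closed in $G$. Fix a total order $\prec$ on $H$ such that $p> q$ implies $p\prec q$. A subset $S\subseteq H$ is nested if no antichain of at least two elements of $S$ has its join (in $L$) in $H$. For a finite meet-semilattice $\mathcal P$ and $p\in\mathcal P\setminus\{\hat 0\}$, the combinatorial blowup $\mathrm{Bl}_p(\mathcal P)$ consists of the $x\in\mathcal P$ with $x\not\ge p$, together with elements $(p,x)$ for those $x\not\geq p$ for which $p\vee x$ exists in $\mathcal P$; it is ordered by: $x\le y$, $(p,x)\le(p,y)$ and $x\le(p,y)$ hold iff $x\le y$ in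 $\mathcal P$, and never $(p,x)\le y$. Let $\mathcal L(L,H)=\mathrm{Bl}_{p_m}\cdots\mathrm{Bl}_{p_1}(L)$, where $H^\circ=\{p_1\prec\dots\prec p_m\}$. Its set of atoms is identified with $H$, where $p\in H^\circ$ corresponds to $(p,\hat 0)$. A set $S$ of atoms with an upper bound in $\mathcal L(L,H)$ is independent if the rank of $\bigvee S$ in $\mathcal L(L,H)$ is $|S|$; a circuit is a minimal dependent one among such sets. A broken circuit is a set $S$ such that $\{g\}\cup S$ is a circuit for some $g$ with $g\prec s$ for all $s\in S$, and $\mathrm{nbc}(\mathcal L(L,H))$ is the collection of the sets of atoms that have an upper bound in $\mathcal L(L,H)$ and contain no broken circuit. Let $R(H)=\mathbb Q[e_g,x_g: g\in H]$ be the graded-commutative algebra in which the $e_g$ are odd and the $x_g$ are even. For $S=\{g_1\prec\dots\prec g_s\}\subseteq H$ put $e_S=e_{g_1}\cdots e_{g_s}$ and $\partial e_S=\sum_j(-1)^{j-1}e_{g_1}\cdots\widehat{e_{g_j}}\cdots e_{g_s}$; put $x_T=\prod_{g\in T}x_g$, $x_T^b=\prod_{g\in T}x_g^{b(g)}$ and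 $c_g=\sum_{h\in H,\,h\ge g}x_h$. Let $I(L,H)$ be the ideal of $R(H)$ generated by (i) $e_Sx_T$ for all $S,T\subseteq H$ with $S\cup T$ not nested; (ii) $\partial e_S$ for all nested $S$ that are circuits; (iii) $c_g$ for all atoms $g$ of $L$. Let $\hat B(L,H)=R(H)/I(L,H)$ and, if $\hat 1\in H$, let $B(L,H)=\hat B(L,H)/(e_{\hat 1})$. Order the variables by $x_g<x_h$ and $e_g<e_h$ for $g\prec h$, and $x_g<e_h$ for all $g,h$. Theorem. With respect to the lexicographic order on the monomials of $R(H)$, and also with respect to the graded lexicographic order, the elements (i), (ii) and (iii$'$) $e_Sx_Tc_g^{d}$, for all $S,T\subseteq H$ and $g\in H$ such that $S\cap T=\emptyset$, $S\cup T$ is a nested antichain, $\bigvee(S\cup T)<g$, and $d=d(\bigvee(S\cup T),g)$, form a Gröbner basis of $I(L,H)$. Moreover, the images of the monomials $e_Sx_T^b$ such that $S\cup T$ is nested, $S\in\mathrm{nbc}(\mathcal L(L,H))$, and $0<b(g)<d\big(\bigvee (S\cup T)_{<g},\,g\big)$ for every $g\in T$ form a basis of the $\mathbb Q$-vector space $\hat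 B(L,H)$. If $\hat 1\in H$, the images of those of these monomials with $\hat 1\notin S$ form a basis of $B(L,H)$. -/

import Mathlib

namespace LerayModel

universe u

/-! ### Building sets, partial building sets, nested sets, ranks of intervals -/

section Lattice

variable {L : Type u} [Lattice L] [BoundedOrder L]

/-- `d(x, y)`, the rank of the interval `[x, y]`: the length of its longest chain. -/
noncomputable def intervalRank (x y : L) : ℕ :=
  ((Order.krullDim (Set.Icc x y)).unbotD 0).toNat

/-- The factors of `x`: the maximal elements of `G_{≤ x}`. -/
def factors (G : Set L) (x : L) : Set L :=
  {g | Maximal (fun y => y ∈ G ∧ y ≤ x) g}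

open Classical in
/-- `G ⊆ L \ {⊥}` is a (combinatorial) building set: for every `x ≠ ⊥` with factors
`x₁, …, x_k` there is an isomorphism of posets `∏ [⊥, x_j] → [⊥, x]` that sends the tuple with
`x_j` at place `j` and `⊥` elsewhere to `x_j`. -/
def IsBuildingSet (G : Set L) : Prop :=
  ⊥ ∉ G ∧ ∀ x : L, x ≠ ⊥ →
    ∃ φ : (∀ y : factors G x, Set.Iic (y : L)) ≃o Set.Iic x,
      ∀ y : factors G x, (φ (Function.update ⊥ y ⊤) : L) = y

/-- `H` is a partial building set in `G`: it lies in `G`, contains all atoms, and its set of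
non-atoms is upward closed in `G`. -/
structure IsPartialBuildingSet (G H : Set L) : Prop where
  subset : H ⊆ G
  atoms_subset : {a : L | IsAtom a} ⊆ H
  filter : ∀ p ∈ H, ¬ IsAtom p → ∀ q ∈ G, p ≤ q → q ∈ H ∧ ¬ IsAtom q

/-- `S` is `H`-nested: `S ⊆ H`, and no antichain of at least two elements of `S` has its join
(taken in `L`) in `H`. -/
def IsNested (H S : Set L) : Prop :=
  S ⊆ H ∧ ∀ X : Finset L, (X : Set L) ⊆ S → 2 ≤ X.card →
    IsAntichain (· ≤ ·) (X : Set L) → X.sup id ∉ H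

end Lattice

/-! ### The partial blowup

A partial building set is enumerated as `H = {h 0, h 1, …, h (n-1)}`, where the order of the indices
is the total order `≺` on `H`.

Points of an iterated combinatorial blowup of `L` are written as pairs `(A, x)`: an element `x` of
`L` is `(∅, x)`, and the new point `(p, y)` that is created when the element `p = h i` is blown up
is obtained from `y = (A, x)` by inserting the label `i` into `A`.  With this notation the order of
every blowup (namely: `x ≤ y` and `(p, x) ≤ (p, y)` and `x ≤ (p, y)` iff `x ≤ y`, and never
`(p, x) ≤ y`) is the product order of `Finset (Fin n) × L`. -/

section Blowup

variable {L : Type u} [Lattice L] [BoundedOrder L] {n : ℕ}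

/-- The combinatorial blowup of the poset `P` at its element `p`, where new points get the label
`i`: the elements `x ∈ P` with `x ≱ p`, and a new point `(p, x)` for each of those `x` for which
the join `p ∨ x` exists in `P`. -/
def blowup (P : Set (Finset (Fin n) × L)) (i : Fin n) (p : Finset (Fin n) × L) :
    Set (Finset (Fin n) × L) :=
  {x | x ∈ P ∧ ¬ p ≤ x} ∪
    {z | ∃ x ∈ P, ¬ p ≤ x ∧ (∃ j, IsLeast {u | u ∈ P ∧ p ≤ u ∧ x ≤ u} j) ∧
      z = (insert i x.1, x.2)}

open Classical in
/-- The underlying set of the partial blowup: starting from `L` (as the set of pairs `(∅, x)`),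
blow up the non-atoms among `h 0, h 1, …, h (n-1)`, in this order. -/
noncomputable def partialBlowupSet (h : Fin n → L) : Set (Finset (Fin n) × L) :=
  ((List.finRange n).filter (fun i => ¬ IsAtom (h i))).foldl
    (fun P i => blowup P i (∅, h i)) {z | z.1 = ∅}

/-- The semilattice `𝓛(L, H)`, with the order induced from `Finset (Fin n) × L`. -/
abbrev PartialBlowup (h : Fin n → L) : Type u := ↥(partialBlowupSet h)

open Classical in
/-- The atom of `𝓛(L, H)` that corresponds to the element `h i` of `H`: the element itself if
it is an atom of `L`, and the new point `(h i, ⊥)` otherwise. -/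
noncomputable def vertex (h : Fin n → L) (i : Fin n) : Finset (Fin n) × L :=
  if IsAtom (h i) then (∅, h i) else ({i}, ⊥)

/-- The set of atoms of `𝓛(L, H)` that corresponds to a set `S` of indices. -/
def vertices (h : Fin n → L) (S : Finset (Fin n)) : Set (PartialBlowup h) :=
  {z | ∃ i ∈ S, (z : Finset (Fin n) × L) = vertex h i}

/-- `S` belongs to the atomic complex of `𝓛(L, H)`: it has an upper bound. -/
def IsSimplex (h : Fin n → L) (S : Finset (Fin n)) : Prop :=
  BddAbove (vertices h S)

/-- `S` is an independent set: its join in `𝓛(L, H)` exists and has rank `|S|`. -/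
def IsIndependent (h : Fin n → L) (S : Finset (Fin n)) : Prop :=
  ∃ j : PartialBlowup h, IsLUB (vertices h S) j ∧ Order.height j = (S.card : ℕ∞)

/-- `S` is a circuit (of the matroid of the geometric lattice `[⊥, x]` for an upper bound `x` of
`S` in `𝓛(L, H)`): a minimal dependent set. -/
def IsCircuit (h : Fin n → L) (S : Finset (Fin n)) : Prop :=
  IsSimplex h S ∧ ¬ IsIndependent h S ∧ ∀ T, T ⊂ S → IsIndependent h T

/-- `S` is a broken circuit: `S` together with an element that precedes all of `S` is a circuit. -/
def IsBrokenCircuit (h : Fin n → L) (S : Finset (Fin n)) : Prop :=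
  ∃ g : Fin n, (∀ i ∈ S, g < i) ∧ IsCircuit h (insert g S)

/-- `S ∈ nbc(𝓛(L, H))`: a simplex that contains no broken circuit. -/
def IsNBC (h : Fin n → L) (S : Finset (Fin n)) : Prop :=
  IsSimplex h S ∧ ∀ T, T ⊆ S → ¬ IsBrokenCircuit h T

end Blowup

/-! ### The graded-commutative algebra `R(H) = ℚ[e_g, x_g : g ∈ H]` and its monomials -/

section Algebra

/-- `R(H)`: the exterior algebra on the `e_g` over the polynomial ring `ℚ[x_g : g ∈ H]`.
The variables `x_g` are central and the variables `e_g` anticommute and have square zero. -/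
abbrev R (n : ℕ) : Type :=
  ExteriorAlgebra (MvPolynomial (Fin n) ℚ) (Fin n → MvPolynomial (Fin n) ℚ)

variable {n : ℕ}

/-- The variable `e_{h i}`. -/
noncomputable def eVar (i : Fin n) : R n :=
  ExteriorAlgebra.ι (MvPolynomial (Fin n) ℚ) (Pi.single i 1)

/-- The variable `x_{h i}`. -/
noncomputable def xVar (i : Fin n) : R n :=
  algebraMap (MvPolynomial (Fin n) ℚ) (R n) (MvPolynomial.X i)

/-- `e_S = e_{g₁} ⋯ e_{g_s}` for `S = {g₁ ≺ ⋯ ≺ g_s}`. -/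
noncomputable def eProd (S : Finset (Fin n)) : R n :=
  (S.sort.map eVar).prod

/-- `x^b = ∏ x_g ^ b(g)`. -/
noncomputable def xPow (b : Fin n →₀ ℕ) : R n :=
  algebraMap (MvPolynomial (Fin n) ℚ) (R n) (MvPolynomial.monomial b 1)

/-- `x_T = ∏_{g ∈ T} x_g`. -/
noncomputable def xProd (T : Finset (Fin n)) : R n :=
  algebraMap (MvPolynomial (Fin n) ℚ) (R n) (∏ i ∈ T, MvPolynomial.X i)

/-- `∂ e_S = ∑_j (-1)^{j-1} e_{g₁} ⋯ ê_{g_j} ⋯ e_{g_s}` for `S = {g₁ ≺ ⋯ ≺ g_s}`. -/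
noncomputable def delE (S : Finset (Fin n)) : R n :=
  ∑ i ∈ S, (-1) ^ (S.filter (· < i)).card * eProd (S.erase i)

/-- Exponents `(S, b)` of the monomials `e_S x^b`. -/
abbrev Expo (n : ℕ) : Type := Finset (Fin n) × (Fin n →₀ ℕ)

/-- The monomial `e_S x^b`. -/
noncomputable def mono (m : Expo n) : R n := eProd m.1 * xPow m.2

/-- Divisibility of monomials. -/
def ExpoDvd (m m' : Expo n) : Prop := m.1 ⊆ m'.1 ∧ m.2 ≤ m'.2

/-- The lexicographic order on monomials for
`x_{h 0} < ⋯ < x_{h (n-1)} < e_{h 0} < ⋯ < e_{h (n-1)}`. -/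
def lexLT (m m' : Expo n) : Prop :=
  (∃ i, i ∉ m.1 ∧ i ∈ m'.1 ∧ ∀ j, i < j → (j ∈ m.1 ↔ j ∈ m'.1)) ∨
    (m.1 = m'.1 ∧ ∃ i, m.2 i < m'.2 i ∧ ∀ j, i < j → m.2 j = m'.2 j)

/-- The total degree of a monomial: the number of its variables, with multiplicity. -/
def expoDegree (m : Expo n) : ℕ := m.1.card + ∑ i, m.2 i

/-- The graded lexicographic order for the same order of the variables. -/
def grlexLT (m m' : Expo n) : Prop :=
  expoDegree m < expoDegree m' ∨ (expoDegree m = expoDegree m' ∧ lexLT m m')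

/-- `m` is the initial monomial of `f`: `f` is a nonzero multiple of `m` plus a linear combination
of smaller monomials. -/
def IsInitial (lt : Expo n → Expo n → Prop) (f : R n) (m : Expo n) : Prop :=
  ∃ c : ℚ, c ≠ 0 ∧ f - c • mono m ∈ Submodule.span ℚ (mono '' {m' | lt m' m})

/-- `B` is a Gröbner basis of the ideal `I`: it lies in `I`, and the initial monomial of every
nonzero element of `I` is divisible by the initial monomial of some element of `B`. -/
def IsGroebnerBasis (lt : Expo n → Expo n → Prop) (B : Set (R n)) (I : TwoSidedIdeal (R n)) :
    Prop :=
  (∀ g ∈ B, g ∈ I) ∧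
    ∀ f ∈ I, f ≠ 0 → ∃ m, IsInitial lt f m ∧
      ∃ g ∈ B, ∃ m', IsInitial lt g m' ∧ ExpoDvd m' m

/-- The family `v` is a basis of the vector space `V`. -/
def IsAdditiveBasis {ι V : Type*} [AddCommGroup V] [Module ℚ V] (v : ι → V) : Prop :=
  LinearIndependent ℚ v ∧ Submodule.span ℚ (Set.range v) = ⊤

end Algebra

/-! ### The ideal `I(L, H)`, the algebras `B̂(L, H)` and `B(L, H)`, and the relations -/

section Model

variable {L : Type u} [Lattice L] [BoundedOrder L] {n : ℕ}

/-- The set of elements of `H` with indices in `S` is nested. -/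
def IsNestedIdx (h : Fin n → L) (S : Finset (Fin n)) : Prop :=
  IsNested (Set.range h) (h '' (S : Set (Fin n)))

open Classical in
/-- `c_g`, the sum of the `x_f` with `f ∈ H` and `g ≤ f`. -/
noncomputable def cElt (h : Fin n → L) (g : Fin n) : R n :=
  ∑ f ∈ Finset.univ.filter (fun f => h g ≤ h f), xVar f

/-- (i) `e_S x_T` with `S ∪ T` not nested. -/
def relNotNested (h : Fin n → L) : Set (R n) :=
  {r | ∃ S T : Finset (Fin n), ¬ IsNestedIdx h (S ∪ T) ∧ r = eProd S * xProd T}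

/-- (ii) `∂ e_S` for the nested circuits `S`. -/
def relCircuit (h : Fin n → L) : Set (R n) :=
  {r | ∃ S : Finset (Fin n), IsNestedIdx h S ∧ IsCircuit h S ∧ r = delE S}

/-- (iii) `c_g` for the atoms `g` of `L`. -/
def relLinear (h : Fin n → L) : Set (R n) :=
  {r | ∃ g : Fin n, IsAtom (h g) ∧ r = cElt h g}

/-- (iii') `e_S x_T c_g^d`, where `S` and `T` are disjoint, `S ∪ T` is a nested antichain,
`⋁ (S ∪ T) < g`, and `d = d(⋁ (S ∪ T), g)`. -/
def relPower (h : Fin n → L) : Set (R n) :=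
  {r | ∃ (S T : Finset (Fin n)) (g : Fin n), IsNestedIdx h (S ∪ T) ∧ Disjoint S T ∧
    IsAntichain (· ≤ ·) (h '' ((S ∪ T : Finset (Fin n)) : Set (Fin n))) ∧
    (S ∪ T).sup h < h g ∧
    r = eProd S * xProd T * cElt h g ^ intervalRank ((S ∪ T).sup h) (h g)}

/-- The defining ideal `I(L, H)`. -/
noncomputable def lerayIdeal (h : Fin n → L) : TwoSidedIdeal (R n) :=
  TwoSidedIdeal.span (relNotNested h ∪ relCircuit h ∪ relLinear h)

/-- `B̂(L, H) = R(H) / I(L, H)`. -/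
abbrev BHat (h : Fin n → L) : Type := (lerayIdeal h).ringCon.Quotient

/-- The ideal of `B̂(L, H)` generated by `e_{h t}`. -/
noncomputable def eIdeal (h : Fin n → L) (t : Fin n) : TwoSidedIdeal (BHat h) :=
  TwoSidedIdeal.span {(lerayIdeal h).ringCon.mk' (eVar t)}

/-- `B̂(L, H) / (e_{h t})`; this is `B(L, H)` if `h t` is the maximum of `L`. -/
abbrev B (h : Fin n → L) (t : Fin n) : Type := (eIdeal h t).ringCon.Quotient

open Classical in
/-- The exponents of the basis monomials `e_S x_T^b`: here `T` is the support of `b`, the set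
`S ∪ T` is nested, `S ∈ nbc(𝓛(L, H))`, and `b(g) < d(⋁ (S ∪ T)_{< g}, g)` for `g ∈ T`. -/
def IsStandard (h : Fin n → L) (m : Expo n) : Prop :=
  IsNestedIdx h (m.1 ∪ m.2.support) ∧ IsNBC h m.1 ∧
    ∀ g ∈ m.2.support, 0 < m.2 g ∧
      m.2 g < intervalRank (((m.1 ∪ m.2.support).filter (fun f => h f < h g)).sup h) (h g)

end Model

end LerayModel

/-! The relations lie in the ideal, their initial monomials divide every non-standard monomial, and
the standard monomials are linearly independent modulo the ideal. The first two facts let every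
polynomial be reduced to standard monomials; with the third they give both the Gröbner basis
(`isGroebnerBasis_of_linearIndependent`) and the basis of the quotient. The relations are
homogeneous, so only comparisons within one degree matter (`RefinesLex`), and both monomial orders
are treated at once.

The building set enters only through `IsBlowupOrder`. A point of the blowup is a pair `(A, x)`, and
these pairs form an explicit lower set of a product (`mem_partialBlowupSet`). Hence simplices are
nested sets, the rank of `(A, x)` is `|A|` plus the rank of `x`, and circuits consist of atoms of
`L`. That the power relations lie in the ideal is an induction on the rank
(`prod_mul_cPoly_pow_mem`).

Independence is proved in two stages. For the odd variables, fix an nbc set `S` and let `D` be the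
polynomial ring modulo `relIdeal h n S`, the relations that hold next to `e_S`. The closures of the
final segments of `S` form a flag. Sending `e_g` to the basis vector of the step at which `g`
enters, or to 0 if it never does, defines a map to an exterior algebra over `D` that kills the ideal
(`exteriorHom_flagVec_eq_zero`). The top coefficient is 1 on `e_S` and 0 on every other `e_{S'}`
whose sum of indices is not larger. So in a linear relation between standard monomials, the
coefficient of an `e_S` with maximal sum of indices is a polynomial in `relIdeal h n S`.

For the even variables, `eq_zero_of_mem_relIdeal` undoes the blowups one at a time, following the
blowup formula for Chow rings. With `J` and `K` the relations next to `S` and next to `S ∪ {k}`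
before the blowup at `k`, a substitution turns the relations after it into elements of `J + yK +
(P)`, where `y` is the image of `x_k` and `P` is monic in `y` of degree `d(⋁ S_{<k}, k)`. Division
by `P` then passes independence from stage `k` to stage `k + 1`.

For `B(L, H)`, multiplication by the variable of the maximum kills the ideal that it generates and
maps the remaining standard monomials injectively to standard monomials. -/

namespace LerayModel

universe u

set_option linter.unusedSectionVars false

/-! ### Ranks of intervals in a finite semimodular lattice -/

section Rank

variable {L : Type u} [Lattice L] [BoundedOrder L] [Finite L]

/-- The length of the longest chain from `x` upwards. -/
noncomputable def corank (x : L) : ℕ := (Order.coheight x).toNat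

lemma coe_corank (x : L) : (corank x : ℕ∞) = Order.coheight x := by
  refine ENat.natCast_toNat fun h => ?_
  have := Fintype.ofFinite L
  obtain ⟨p, -, hp⟩ := Order.coheight_eq_top_iff.1 h (Fintype.card L)
  exact (p.length_lt_card).ne hp

lemma corank_lt {x y : L} (hxy : x < y) : corank y < corank x := by
  have h := Order.coheight_add_one_le hxy
  rw [← coe_corank, ← coe_corank] at h
  exact_mod_cast h

lemma corank_le {x y : L} (hxy : x ≤ y) : corank y ≤ corank x := by
  rcases hxy.eq_or_lt with rfl | h
  · exact le_rfl
  · exact (corank_lt h).le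

lemma exists_covBy_le {x y : L} (hxy : x < y) : ∃ u, x ⋖ u ∧ u ≤ y :=
  exists_covBy_le_of_lt hxy

/-- Jordan–Dedekind: an element above `x` lies above some cover `w` of `x`. If `w ≠ u`, then `u ⊔ w`
covers both by semimodularity, so by induction `w` and `u` have the same corank. -/
lemma corank_covBy [IsUpperModularLattice L] {x u : L} (hxu : x ⋖ u) :
    corank x = corank u + 1 := by
  induction x using WellFoundedGT.induction generalizing u with
  | ind x ih =>
    refine le_antisymm ?_ (corank_lt hxu.lt)
    have : Order.coheight x ≤ ((corank u + 1 : ℕ) : ℕ∞) := by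
      rw [Order.coheight_le_coe_iff]
      intro v hv
      rw [← coe_corank]
      norm_cast
      obtain ⟨w, hxw, hwv⟩ := exists_covBy_le hv
      refine (corank_le hwv).trans_lt (Nat.lt_succ_of_le ?_)
      rcases eq_or_ne u w with rfl | hne
      · exact le_rfl
      have hinf : u ⊓ w = x := by
        by_contra hx
        have h1 : x < u ⊓ w := lt_of_le_of_ne (le_inf hxu.le hxw.le)
          (fun h => hx h.symm)
        have h2 : u ⊓ w = u := by
          by_contra h3
          exact hxu.2 h1 (lt_of_le_of_ne inf_le_left h3)
        have h4 : u ⊓ w = w := by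
          by_contra h3
          exact hxw.2 h1 (lt_of_le_of_ne inf_le_right h3)
        exact hne (h2.symm.trans h4)
      have c1 : w ⋖ u ⊔ w := covBy_sup_of_inf_covBy_left (hinf.symm ▸ hxu)
      have c2 : u ⋖ u ⊔ w := covBy_sup_of_inf_covBy_right (hinf.symm ▸ hxw)
      rw [ih w hxw.lt c1, ih u hxu.lt c2]
    rw [← coe_corank] at this
    exact_mod_cast this

lemma length_add_corank_last_le (p : LTSeries L) :
    p.length + corank p.last ≤ corank p.head := by
  induction p using RelSeries.inductionOn with
  | singleton x => simp
  | cons p x hx ih =>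
    simp only [RelSeries.cons_length, RelSeries.last_cons, RelSeries.head_cons]
    have := corank_lt (show x < p.head from hx)
    omega

lemma exists_series [IsUpperModularLattice L] {x y : L} (hxy : x ≤ y) :
    ∃ p : LTSeries L, p.head = x ∧ p.last = y ∧ p.length + corank y = corank x := by
  induction x using WellFoundedGT.induction with
  | ind x ih =>
    rcases hxy.eq_or_lt with rfl | hlt
    · exact ⟨RelSeries.singleton _ x, rfl, rfl, by simp⟩
    obtain ⟨u, hxu, huy⟩ := exists_covBy_le hlt
    obtain ⟨p, h1, h2, h3⟩ := ih u hxu.lt huy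
    refine ⟨p.cons x (by rw [h1]; exact hxu.lt), by simp, by simpa using h2, ?_⟩
    rw [corank_covBy hxu, RelSeries.cons_length]
    omega

lemma intervalRank_eq [IsUpperModularLattice L] {x y : L} (hxy : x ≤ y) :
    intervalRank x y = corank x - corank y := by
  have hne : Nonempty (Set.Icc x y) := ⟨⟨x, le_rfl, hxy⟩⟩
  have : Order.krullDim (Set.Icc x y) = ((corank x - corank y : ℕ) : WithBot ℕ∞) := by
    apply le_antisymm
    · refine iSup_le fun p => ?_
      have h := length_add_corank_last_le (p.map Subtype.val (fun _ _ h => h))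
      have h1 := corank_le (p.last.2.2 : (p.last : L) ≤ y)
      have h2 := corank_le (p.head.2.1 : x ≤ (p.head : L))
      have h3 : (p.map Subtype.val (fun _ _ h => h) : LTSeries L).last = p.last := by
        exact LTSeries.last_map ..
      have h4 : (p.map Subtype.val (fun _ _ h => h) : LTSeries L).head = p.head := by
        exact LTSeries.head_map ..
      have h5 : (p.map Subtype.val (fun _ _ h => h) : LTSeries L).length = p.length := rfl
      rw [h3, h4, h5] at h
      have : p.length ≤ corank x - corank y := by omega
      exact_mod_cast this
    · obtain ⟨p, h1, h2, h3⟩ := exists_series hxy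
      let q : LTSeries (Set.Icc x y) :=
        { length := p.length
          toFun := fun i => ⟨p i, by
            rw [← h1]; exact LTSeries.head_le p i, by
            rw [← h2]; exact p.monotone (Fin.le_last i)⟩
          step := fun i => p.step i }
      have hq := Order.LTSeries.length_le_krullDim q
      have : corank x - corank y = p.length := by omega
      rw [this]
      exact hq
  rw [intervalRank, this]
  rfl

variable [IsUpperModularLattice L]

lemma covBy_sup_atom {x a : L} (ha : IsAtom a) (h : ¬ a ≤ x) : x ⋖ x ⊔ a := by
  rw [sup_comm]
  apply covBy_sup_of_inf_covBy_left
  have : a ⊓ x = ⊥ := by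
    rcases ha.le_iff.1 (inf_le_left : a ⊓ x ≤ a) with h' | h'
    · exact h'
    · exact absurd (inf_eq_left.1 h') h
  rw [this]
  exact ha.bot_covBy

lemma corank_sup_atom {x a : L} (ha : IsAtom a) (h : ¬ a ≤ x) :
    corank x = corank (x ⊔ a) + 1 := corank_covBy (covBy_sup_atom ha h)

lemma corank_le_sup_atom (x : L) {a : L} (ha : IsAtom a) :
    corank x ≤ corank (x ⊔ a) + 1 := by
  by_cases h : a ≤ x
  · rw [sup_eq_left.2 h]; omega
  · exact (corank_sup_atom ha h).le

lemma intervalRank_self (x : L) : intervalRank x x = 0 := by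
  rw [intervalRank_eq le_rfl]; omega

lemma intervalRank_pos {x y : L} (hxy : x < y) : 0 < intervalRank x y := by
  rw [intervalRank_eq hxy.le]
  have := corank_lt hxy
  omega

lemma intervalRank_bot_atom {a : L} (ha : IsAtom a) : intervalRank ⊥ a = 1 := by
  rw [intervalRank_eq bot_le, corank_covBy ha.bot_covBy]
  omega

lemma intervalRank_sup_atom {x y a : L} (ha : IsAtom a) (hay : a ≤ y) (hxy : x ≤ y)
    (h : ¬ a ≤ x) : intervalRank x y = intervalRank (x ⊔ a) y + 1 := by
  rw [intervalRank_eq hxy, intervalRank_eq (sup_le hxy hay), corank_sup_atom ha h]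
  have := corank_le (sup_le hxy hay)
  omega

lemma exists_atom_not_le [IsAtomistic L] {x y : L} (h : ¬ y ≤ x) :
    ∃ a, IsAtom a ∧ a ≤ y ∧ ¬ a ≤ x := by
  by_contra! hc
  exact h (le_iff_atom_le_imp.2 fun a ha hay => hc a ha hay)

/-- Climb from `x` to `y` by atoms. Each atom lowers the remaining rank by exactly one, and after
joining with `z` by at most one. -/
lemma intervalRank_sup_le [IsAtomistic L] {x y : L} (z : L) (hxy : x ≤ y) :
    intervalRank (x ⊔ z) (y ⊔ z) ≤ intervalRank x y := by
  induction x using WellFoundedGT.induction with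
  | ind x ih =>
    rcases hxy.eq_or_lt with rfl | hlt
    · rw [intervalRank_self]; exact Nat.zero_le _
    obtain ⟨a, ha, hay, hax⟩ := exists_atom_not_le hlt.not_ge
    have h1 := ih (x ⊔ a) (covBy_sup_atom ha hax).lt (sup_le hxy hay)
    rw [intervalRank_sup_atom ha hay hxy hax]
    have h2 : x ⊔ a ⊔ z = x ⊔ z ⊔ a := by ac_rfl
    rw [h2] at h1
    have hle : x ⊔ z ≤ y ⊔ z := sup_le_sup_right hxy z
    have hle' : x ⊔ z ⊔ a ≤ y ⊔ z := sup_le hle (hay.trans le_sup_left)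
    rw [intervalRank_eq hle'] at h1
    rw [intervalRank_eq hle]
    have := corank_le_sup_atom (x ⊔ z) ha
    omega

variable {ι : Type*} {h : ι → L}

lemma intervalRank_le_card {U : Finset ι} (hU : ∀ i ∈ U, IsAtom (h i)) {y p : L}
    (hp : y ⊔ U.sup h = p) : intervalRank y p ≤ U.card := by
  classical
  subst hp
  induction U using Finset.induction_on with
  | empty => simp [intervalRank_self]
  | insert a U haU ih =>
    have h1 := ih fun i hi => hU i (Finset.mem_insert_of_mem hi)
    rw [Finset.card_insert_of_notMem haU, Finset.sup_insert]
    rw [intervalRank_eq le_sup_left] at h1 ⊢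
    have h2 := corank_le_sup_atom (y ⊔ U.sup h) (hU a (Finset.mem_insert_self a U))
    have h3 : y ⊔ (h a ⊔ U.sup h) = y ⊔ U.sup h ⊔ h a := by ac_rfl
    rw [h3]
    omega

/-- A basis is extracted greedily: each chosen atom is not below the current join, hence raises the
rank by exactly one. -/
lemma exists_subset_card_eq_intervalRank {T : Finset ι} (hT : ∀ i ∈ T, IsAtom (h i)) {y p : L}
    (hp : y ⊔ T.sup h = p) :
    ∃ U ⊆ T, U.card = intervalRank y p ∧ y ⊔ U.sup h = p := by
  classical
  induction T using Finset.strongInduction generalizing y with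
  | H T ih =>
    by_cases hy : y = p
    · exact ⟨∅, by simp, by simp [hy, intervalRank_self], by simpa using hy⟩
    have hyp : y ≤ p := hp ▸ le_sup_left
    obtain ⟨a, haT, hay⟩ : ∃ a ∈ T, ¬ h a ≤ y := by
      by_contra! hc
      exact hy (by rw [← hp]; exact (sup_eq_left.2 (Finset.sup_le hc)).symm)
    have hap : h a ≤ p := hp ▸ le_sup_of_le_right (Finset.le_sup haT)
    obtain ⟨U, hUT, hc, hU⟩ := ih (T.erase a) (Finset.erase_ssubset haT)
      (fun i hi => hT i (Finset.mem_of_mem_erase hi)) (y := y ⊔ h a) (by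
        rw [← hp]
        nth_rw 2 [← Finset.insert_erase haT]
        rw [Finset.sup_insert, sup_assoc])
    refine ⟨insert a U, ?_, ?_, ?_⟩
    · exact Finset.insert_subset haT (hUT.trans (Finset.erase_subset _ _))
    · rw [Finset.card_insert_of_notMem fun hc => by simpa using hUT hc, hc,
        intervalRank_sup_atom (hT a haT) hap hyp hay]
    · rw [Finset.sup_insert, ← sup_assoc, hU]

end Rank

end LerayModel

namespace LerayModel

universe u

set_option linter.unusedSectionVars false

/-! ### Factors in a building set -/

section Building

variable {L : Type u} [Lattice L] [BoundedOrder L] [Finite L] {G : Set L}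

lemma exists_factor_ge {p x : L} (hp : p ∈ G) (hpx : p ≤ x) : ∃ f ∈ factors G x, p ≤ f := by
  obtain ⟨f, hpf, hf⟩ := Set.Finite.exists_le_maximal (s := {y | y ∈ G ∧ y ≤ x})
    (Set.toFinite _) ⟨hp, hpx⟩
  exact ⟨f, hf, hpf⟩

/-- In the product decomposition, an element below two different factors is supported in two
different coordinates, so all its coordinates vanish. -/
lemma IsBuildingSet.inf_factors_eq_bot (hG : IsBuildingSet G) {x f f' : L}
    (hf : f ∈ factors G x) (hf' : f' ∈ factors G x) (hne : f ≠ f') : f ⊓ f' = ⊥ := by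
  classical
  have hx : x ≠ ⊥ := by
    rintro rfl
    exact hG.1 ((le_bot_iff.1 hf.1.2) ▸ hf.1.1)
  obtain ⟨φ, hφ⟩ := hG.2 x hx
  have key : ∀ g : factors G x, ∀ z : Set.Iic x, (z : L) ≤ g →
      φ.symm z ≤ Function.update ⊥ g ⊤ := by
    intro g z hz
    rw [OrderIso.symm_apply_le]
    change (z : L) ≤ _
    convert hz using 1
    convert hφ g
  have hle : f ⊓ f' ≤ x := inf_le_left.trans hf.1.2
  have h1 := key ⟨f, hf⟩ ⟨f ⊓ f', hle⟩ inf_le_left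
  have h2 := key ⟨f', hf'⟩ ⟨f ⊓ f', hle⟩ inf_le_right
  have h3 : φ.symm ⟨f ⊓ f', hle⟩ = ⊥ := by
    rw [← le_bot_iff]
    intro g
    by_cases hg : g = ⟨f, hf⟩
    · have := h2 g
      rwa [Function.update_of_ne (by rw [hg]; simpa using hne)] at this
    · have := h1 g
      rwa [Function.update_of_ne hg] at this
  have h4 : (⟨f ⊓ f', hle⟩ : Set.Iic x) = ⊥ := by
    rw [← φ.apply_symm_apply ⟨f ⊓ f', hle⟩, h3, map_bot]
  exact congrArg Subtype.val h4

-- Each `h i` lies below a single factor, so only those below `f` contribute to the coordinate at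
-- `f`, and they have to fill it.
open Classical in
lemma IsBuildingSet.sup_filter_le_factor (hG : IsBuildingSet G) {ι : Type*} {h : ι → L}
    {Y : Finset ι} (hY : ∀ i ∈ Y, h i ∈ G) {f : L} (hf : f ∈ factors G (Y.sup h)) :
    (Y.filter (fun i => h i ≤ f)).sup h = f := by
  set x := Y.sup h with hx'
  have hx : x ≠ ⊥ := by
    intro hx
    rw [hx] at hf
    exact hG.1 ((le_bot_iff.1 hf.1.2) ▸ hf.1.1)
  obtain ⟨φ, hφ⟩ := hG.2 x hx
  have key : ∀ g : factors G x, ∀ z : Set.Iic x, (z : L) ≤ g →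
      φ.symm z ≤ Function.update ⊥ g ⊤ := by
    intro g z hz
    rw [OrderIso.symm_apply_le]
    change (z : L) ≤ _
    convert hz using 1
    convert hφ g
  set yf := (Y.filter (fun i => h i ≤ f)).sup h with hyf
  have hyff : yf ≤ f := Finset.sup_le fun i hi => (Finset.mem_filter.1 hi).2
  refine le_antisymm hyff ?_
  let F : factors G x := ⟨f, hf⟩
  let z : Set.Iic x := ⟨yf, hyff.trans hf.1.2⟩
  -- The largest tuple whose coordinate at `f` is that of `yf`. It dominates every `h i`, hence
  -- equals the top tuple.
  let v : ∀ y : factors G x, Set.Iic (y : L) := Function.update ⊤ F (φ.symm z F)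
  have hv : ⊤ ≤ φ v := by
    change Y.sup h ≤ (φ v : L)
    refine Finset.sup_le fun i hi => ?_
    have hix : h i ≤ x := Finset.le_sup hi
    obtain ⟨f', hf', hif'⟩ := exists_factor_ge (hY i hi) hix
    change (⟨h i, hix⟩ : Set.Iic x) ≤ φ v
    rw [← OrderIso.symm_apply_le]
    by_cases hff : f' = f
    · subst hff
      have h1 : (⟨h i, hix⟩ : Set.Iic x) ≤ z :=
        Finset.le_sup (f := h) (Finset.mem_filter.2 ⟨hi, hif'⟩)
      refine (φ.symm.monotone h1).trans fun g => ?_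
      by_cases hg : g = F
      · subst hg; simp [v]
      · simp only [v]; rw [Function.update_of_ne hg]; exact le_top
    · refine (key ⟨f', hf'⟩ _ hif').trans fun g => ?_
      by_cases hg : g = F
      · subst hg
        rw [Function.update_of_ne (by simpa [F] using Ne.symm hff)]
        exact bot_le
      · simp only [v]; rw [Function.update_of_ne hg]; exact le_top
  have hv' : v = ⊤ := by
    have h1 : φ v = ⊤ := top_le_iff.1 hv
    rw [← φ.symm_apply_apply v, h1, map_top]
  have ht : φ.symm z F = ⊤ := by
    have := congrFun hv' F
    simpa [v] using this
  have h2 : Function.update ⊥ F ⊤ ≤ φ.symm z := by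
    intro g
    by_cases hg : g = F
    · subst hg; rw [Function.update_self, ht]
    · rw [Function.update_of_ne hg]; exact bot_le
  rw [OrderIso.le_symm_apply] at h2
  have h3 : ((φ (Function.update ⊥ F ⊤) : Set.Iic x) : L) ≤ yf := h2
  refine le_trans (le_of_eq ?_) h3
  exact (hφ F).symm.trans (by congr!)

/-- Both elements lie below factors of `p ⊔ q`. Distinct factors meet in `⊥`, so it is the same
factor, which is then `p ⊔ q` itself. -/
lemma IsBuildingSet.sup_mem (hG : IsBuildingSet G) {p q : L} (hp : p ∈ G) (hq : q ∈ G)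
    (hpq : p ⊓ q ≠ ⊥) : p ⊔ q ∈ G := by
  classical
  obtain ⟨f, hf, hpf⟩ := exists_factor_ge hp (le_sup_left : p ≤ p ⊔ q)
  obtain ⟨f', hf', hqf⟩ := exists_factor_ge hq (le_sup_right : q ≤ p ⊔ q)
  by_cases hne : f = f'
  · subst hne
    have : f = p ⊔ q := le_antisymm hf.1.2 (sup_le hpf hqf)
    exact this ▸ hf.1.1
  · exact absurd (le_bot_iff.1 ((inf_le_inf hpf hqf).trans
      (hG.inf_factors_eq_bot hf hf' hne).le)) hpq

end Building

/-- The combinatorial properties of an enumerated partial building set that are used below. -/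
structure IsBlowupOrder {L : Type u} [Lattice L] [BoundedOrder L] {n : ℕ} (h : Fin n → L) :
    Prop where
  inj : Function.Injective h
  ord : ∀ i j, h j ≤ h i → i ≤ j
  ne_bot : ∀ i, h i ≠ ⊥
  exists_eq_atom : ∀ a, IsAtom a → ∃ i, h i = a
  exists_eq_sup : ∀ i j, ¬ IsAtom (h i) → h i ⊓ h j ≠ ⊥ → ∃ k, h k = h i ⊔ h j
  exists_factor : ∀ (Y : Finset (Fin n)) (i : Fin n), ¬ IsAtom (h i) → h i ≤ Y.sup h →
    ∃ f, h i ≤ h f ∧ ∃ Z ⊆ Y, Z.sup h = h f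

/-! ### Nested sets as compatible index sets -/

section Nested

variable {L : Type u} [Lattice L] [BoundedOrder L] {n : ℕ} {h : Fin n → L}

lemma IsPartialBuildingSet.isBlowupOrder [Finite L] {G : Set L} (hG : IsBuildingSet G)
    (h_inj : Function.Injective h) (hH : IsPartialBuildingSet G (Set.range h))
    (h_ord : ∀ i j : Fin n, h j ≤ h i → i ≤ j) : IsBlowupOrder h where
  inj := h_inj
  ord := h_ord
  ne_bot i hi := hG.1 (hi ▸ hH.subset ⟨i, rfl⟩)
  exists_eq_atom a ha := hH.atoms_subset ha
  exists_eq_sup i j hi hij :=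
    (hH.filter _ ⟨i, rfl⟩ hi _ (hG.sup_mem (hH.subset ⟨i, rfl⟩) (hH.subset ⟨j, rfl⟩) hij)
      le_sup_left).1
  exists_factor Y i hi hiY := by
    classical
    obtain ⟨f, hf, hif⟩ := exists_factor_ge (hH.subset ⟨i, rfl⟩) hiY
    obtain ⟨k, rfl⟩ := (hH.filter _ ⟨i, rfl⟩ hi _ hf.1.1 hif).1
    exact ⟨k, hif, _, Finset.filter_subset _ _,
      hG.sup_filter_le_factor (fun j _ => hH.subset ⟨j, rfl⟩) hf⟩

/-- No element with index less than `k` is the join of elements of `S` different from it. -/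
def Compatible (h : Fin n → L) (k : ℕ) (S : Finset (Fin n)) : Prop :=
  ∀ Y ⊆ S, ∀ i, ¬ IsAtom (h i) → (i : ℕ) < k → Y.sup h = h i → i ∈ Y

lemma Compatible.mono {k : ℕ} {S T : Finset (Fin n)} (hT : Compatible h k T) (hST : S ⊆ T) :
    Compatible h k S :=
  fun Y hY => hT Y (hY.trans hST)

lemma Compatible.mono_left {k l : ℕ} {S : Finset (Fin n)} (hS : Compatible h l S) (hkl : k ≤ l) :
    Compatible h k S :=
  fun Y hY i hi hik => hS Y hY i hi (hik.trans_le hkl)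

namespace IsBlowupOrder

variable (hh : IsBlowupOrder h)
include hh

lemma lt_of_lt {i j : Fin n} (hij : h j < h i) : i < j :=
  lt_of_le_of_ne (hh.ord i j hij.le) fun e => hij.ne (e ▸ rfl)

lemma eq_of_atom {i j : Fin n} (hj : IsAtom (h j)) (hij : h i ≤ h j) : i = j :=
  hh.inj ((hj.le_iff.1 hij).resolve_left (hh.ne_bot i))

lemma not_isAtom_of_le {i j : Fin n} (hi : ¬ IsAtom (h i)) (hij : h i ≤ h j) :
    ¬ IsAtom (h j) := fun hj => hi (hh.eq_of_atom hj hij ▸ hj)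

/-- Every antichain of at least two elements with join in `H` has a non-atom as its join. -/
lemma isNestedIdx_iff (S : Finset (Fin n)) : IsNestedIdx h S ↔ Compatible h n S := by
  classical
  constructor
  · rintro ⟨-, hS⟩ Y hY i hi - hYi
    set W := Y.image h
    -- The maximal elements form an antichain with the same join, so nestedness leaves at most one
    -- of them.
    set X := W.filter (fun x => ∀ y ∈ W, x ≤ y → x = y)
    have hXW : X ⊆ W := Finset.filter_subset _ _
    have hsup : X.sup id = h i := by
      rw [← hYi]
      apply le_antisymm
      · refine Finset.sup_le fun x hx => ?_
        obtain ⟨y, hy, rfl⟩ := Finset.mem_image.1 (hXW hx)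
        exact Finset.le_sup hy
      · refine Finset.sup_le fun y hy => ?_
        obtain ⟨m, hym, hm⟩ := W.exists_le_maximal (Finset.mem_image_of_mem h hy)
        refine hym.trans (Finset.le_sup (f := id) (Finset.mem_filter.2 ⟨hm.1, fun z hz hmz => ?_⟩))
        exact le_antisymm hmz (hm.2 hz hmz)
    have hanti : IsAntichain (· ≤ ·) (X : Set L) := by
      intro x hx y hy hne hxy
      exact hne ((Finset.mem_filter.1 hx).2 y (hXW hy) hxy)
    have hXS : (X : Set L) ⊆ h '' (S : Set (Fin n)) := by
      intro x hx
      obtain ⟨y, hy, rfl⟩ := Finset.mem_image.1 (hXW hx)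
      exact ⟨y, hY hy, rfl⟩
    have hcard : ¬ 2 ≤ X.card := fun h2 => hS X hXS h2 hanti (hsup ▸ ⟨i, rfl⟩)
    have hcard' : X.card = 0 ∨ X.card = 1 := by omega
    rcases hcard' with h0 | h1
    · rw [Finset.card_eq_zero.1 h0] at hsup
      exact absurd hsup.symm (hh.ne_bot i)
    · obtain ⟨x, hx⟩ := Finset.card_eq_one.1 h1
      rw [hx, Finset.sup_singleton] at hsup
      obtain ⟨y, hy, hyx⟩ := Finset.mem_image.1 (hXW (hx ▸ Finset.mem_singleton_self x))
      rwa [← hh.inj (hyx.trans hsup)]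
  · refine fun hS => ⟨?_, fun X hX h2 hanti ⟨i, hi⟩ => ?_⟩
    · rintro _ ⟨i, -, rfl⟩; exact ⟨i, rfl⟩
    obtain ⟨x, hx, y, hy, hne⟩ := Finset.one_lt_card.1 h2
    have hle : ∀ z ∈ X, z ≤ h i := fun z hz => hi ▸ Finset.le_sup (f := id) hz
    suffices hiX : h i ∈ X by
      have h1 : ∀ z ∈ X, z = h i := fun z hz => by
        by_contra hz'
        exact hanti hz hiX hz' (hle z hz)
      exact hne ((h1 x hx).trans (h1 y hy).symm)
    by_cases hat : IsAtom (h i)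
    · obtain ⟨j, -, hj⟩ := hX hx
      rw [← hh.eq_of_atom hat (hj ▸ hle x hx), hj]
      exact hx
    · have hY := hS (S.filter (fun j => h j ∈ X)) (Finset.filter_subset _ _) i hat i.2 (by
        rw [hi]
        apply le_antisymm
        · exact Finset.sup_le fun j hj => Finset.le_sup (f := id) (Finset.mem_filter.1 hj).2
        · refine Finset.sup_le fun z hz => ?_
          obtain ⟨j, hjS, rfl⟩ := hX hz
          exact Finset.le_sup (f := h) (Finset.mem_filter.2 ⟨hjS, hz⟩))
      exact (Finset.mem_filter.1 hY).2

end IsBlowupOrder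

end Nested

/-! ### Points and simplices of the partial blowup -/

section Faces

variable {L : Type u} [Lattice L] [BoundedOrder L] {n : ℕ}

open Classical in
/-- The indices in `S` of atoms. -/
noncomputable def atomPart (h : Fin n → L) (S : Finset (Fin n)) : Finset (Fin n) :=
  S.filter (fun i => IsAtom (h i))

open Classical in
/-- The indices in `S` of non-atoms. -/
noncomputable def nonAtomPart (h : Fin n → L) (S : Finset (Fin n)) : Finset (Fin n) :=
  S.filter (fun i => ¬ IsAtom (h i))

variable {h : Fin n → L} {S : Finset (Fin n)}

lemma mem_atomPart {i : Fin n} : i ∈ atomPart h S ↔ i ∈ S ∧ IsAtom (h i) := by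
  simp [atomPart]

lemma mem_nonAtomPart {i : Fin n} : i ∈ nonAtomPart h S ↔ i ∈ S ∧ ¬ IsAtom (h i) := by
  simp [nonAtomPart]

lemma card_nonAtomPart_add (S : Finset (Fin n)) :
    (nonAtomPart h S).card + (atomPart h S).card = S.card := by
  classical
  rw [add_comm]; exact Finset.card_filter_add_card_filter_not _

/-- A label `j` in `A` stands for a join with `h j` that had to exist before the blowup at `j`. So
when `i` was blown up, the elements with later labels counted as joined to `x`, and the result must
not be above `h i`. -/
lemma mem_foldl_blowup {l : List (Fin n)} (hl : l.Pairwise (· < ·))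
    (z : Finset (Fin n) × L) :
    z ∈ l.foldl (fun P i => blowup P i (∅, h i)) {z | z.1 = ∅} ↔
      (∀ j ∈ z.1, j ∈ l) ∧ ∀ i ∈ l, ¬ h i ≤ z.2 ⊔ (z.1.filter (i < ·)).sup h := by
  induction l using List.reverseRecOn generalizing z with
  | nil => simp [Finset.eq_empty_iff_forall_notMem]
  | append_singleton l k ih =>
    obtain ⟨hl1, -, hlk⟩ := List.pairwise_append.1 hl
    replace ih := ih hl1
    simp only [List.mem_singleton, forall_eq] at hlk
    rw [List.foldl_append, List.foldl_cons, List.foldl_nil]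
    set P := l.foldl (fun P i => blowup P i (∅, h i)) {z | z.1 = ∅} with hP
    -- As `P` is a lower set of the product, a join of two elements exists in `P` exactly when their
    -- join in the product belongs to `P`.
    have hlower : ∀ z ∈ P, ∀ y, y ≤ z → y ∈ P := by
      intro z hz y hy
      rw [ih] at hz ⊢
      refine ⟨fun j hj => hz.1 j (hy.1 hj), fun i hi hle => hz.2 i hi (hle.trans ?_)⟩
      exact sup_le_sup hy.2 (Finset.sup_mono (Finset.filter_subset_filter _ hy.1))
    have hk : ∀ A : Finset (Fin n), (∀ j ∈ A, j ∈ l ++ [k]) → A.filter (k < ·) = ∅ := by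
      intro A hA
      refine Finset.filter_eq_empty_iff.2 fun j hj => ?_
      have := hA j hj
      rw [List.mem_append, List.mem_singleton] at this
      rcases this with h1 | rfl
      · exact (hlk j h1).le.not_gt
      · exact lt_irrefl _
    constructor
    · rintro (⟨hz, hkz⟩ | ⟨⟨A, x⟩, hx, hkx, ⟨j, ⟨hjP, hj1, hj2⟩, -⟩, rfl⟩)
      · have hz' := (ih z).1 hz
        refine ⟨fun j hj => List.mem_append_left _ (hz'.1 j hj), fun i hi hle => ?_⟩
        rw [List.mem_append, List.mem_singleton] at hi
        rcases hi with hi | rfl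
        · exact hz'.2 i hi hle
        · rw [hk _ fun j hj => List.mem_append_left _ (hz'.1 j hj), Finset.sup_empty,
            sup_bot_eq] at hle
          exact hkz ⟨by simp, hle⟩
      · have hAx := (ih (A, x ⊔ h k)).1 (hlower j hjP _ ⟨hj2.1, sup_le hj2.2 hj1.2⟩)
        have hA : ∀ j ∈ insert k A, j ∈ l ++ [k] := by
          intro j hj
          rcases Finset.mem_insert.1 hj with rfl | hj
          · simp
          · exact List.mem_append_left _ (hAx.1 j hj)
        refine ⟨hA, fun i hi hle => ?_⟩
        rw [List.mem_append, List.mem_singleton] at hi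
        rcases hi with hi | rfl
        · refine hAx.2 i hi (hle.trans (le_of_eq ?_))
          dsimp only
          rw [Finset.filter_insert, if_pos (hlk i hi), Finset.sup_insert, sup_assoc]
        · rw [hk _ hA, Finset.sup_empty, sup_bot_eq] at hle
          exact hkx ⟨by simp, hle⟩
    · rintro ⟨h1, h2⟩
      have hkz : ¬ h k ≤ z.2 := by
        have := h2 k (by simp)
        rwa [hk _ h1, Finset.sup_empty, sup_bot_eq] at this
      by_cases hkA : k ∈ z.1
      · right
        -- The join with the centre: the label `k` is traded for a join with `h k`.
        have hmem : (z.1.erase k, z.2 ⊔ h k) ∈ P := by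
          rw [ih]
          refine ⟨fun j hj => ?_, fun i hi hle => h2 i (List.mem_append_left _ hi) ?_⟩
          · have := h1 j (Finset.mem_of_mem_erase hj)
            rw [List.mem_append, List.mem_singleton] at this
            exact this.resolve_right (Finset.ne_of_mem_erase hj)
          · refine hle.trans (sup_le (sup_le le_sup_left ?_) ?_)
            · exact le_sup_of_le_right
                (Finset.le_sup (f := h) (Finset.mem_filter.2 ⟨hkA, hlk i hi⟩))
            · exact le_sup_of_le_right
                (Finset.sup_mono (Finset.filter_subset_filter _ (Finset.erase_subset _ _)))
        refine ⟨(z.1.erase k, z.2), hlower _ hmem _ ⟨le_rfl, le_sup_left⟩, fun hle => hkz hle.2,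
          ⟨_, ⟨hmem, ⟨by simp, le_sup_right⟩, ⟨le_rfl, le_sup_left⟩⟩, ?_⟩, ?_⟩
        · rintro u ⟨-, hu1, hu2⟩
          exact ⟨hu2.1, sup_le hu2.2 hu1.2⟩
        · simp [Finset.insert_erase hkA]
      · left
        refine ⟨(ih z).2 ⟨fun j hj => ?_, fun i hi => h2 i (List.mem_append_left _ hi)⟩,
          fun hle => hkz hle.2⟩
        have := h1 j hj
        rw [List.mem_append, List.mem_singleton] at this
        exact this.resolve_right (by rintro rfl; exact hkA hj)

lemma mem_partialBlowupSet {z : Finset (Fin n) × L} :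
    z ∈ partialBlowupSet h ↔ (∀ j ∈ z.1, ¬ IsAtom (h j)) ∧
      ∀ i, ¬ IsAtom (h i) → ¬ h i ≤ z.2 ⊔ (z.1.filter (i < ·)).sup h := by
  rw [partialBlowupSet, mem_foldl_blowup]
  · simp
  · exact (List.pairwise_lt_finRange n).filter _

lemma partialBlowupSet_lower {y z : Finset (Fin n) × L} (hz : z ∈ partialBlowupSet h)
    (hyz : y ≤ z) : y ∈ partialBlowupSet h := by
  rw [mem_partialBlowupSet] at hz ⊢
  refine ⟨fun j hj => hz.1 j (hyz.1 hj), fun i hi hle => hz.2 i hi (hle.trans ?_)⟩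
  exact sup_le_sup hyz.2 (Finset.sup_mono (Finset.filter_subset_filter _ hyz.1))

/-- The join in `𝓛(L, H)` of the atoms with indices in `S`, if it exists. -/
noncomputable def faceJoin (h : Fin n → L) (S : Finset (Fin n)) : Finset (Fin n) × L :=
  (nonAtomPart h S, (atomPart h S).sup h)

/-- If `h i` is the join of a subset of `S` without `i`, its non-atoms have indices above `i`, which
violates the condition on points at `i`. Conversely, if the condition fails at `i`, a factor `f`
above `h i` is a join of elements of `S` that are atoms or have index above `i`. Compatibility puts
`f` among them, but `f` is a non-atom of index at most `i`. -/
lemma faceJoin_mem_iff (hh : IsBlowupOrder h) :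
    faceJoin h S ∈ partialBlowupSet h ↔ Compatible h n S := by
  classical
  rw [mem_partialBlowupSet]
  constructor
  · rintro ⟨-, h2⟩ Y hY i hi - hYi
    by_contra hiY
    refine h2 i hi ?_
    rw [← hYi]
    refine Finset.sup_le fun j hj => ?_
    by_cases hat : IsAtom (h j)
    · exact le_sup_of_le_left (Finset.le_sup (f := h) (mem_atomPart.2 ⟨hY hj, hat⟩))
    · refine le_sup_of_le_right (Finset.le_sup (f := h) (Finset.mem_filter.2
        ⟨mem_nonAtomPart.2 ⟨hY hj, hat⟩, ?_⟩))
      exact lt_of_le_of_ne (hh.ord i j (hYi ▸ Finset.le_sup hj)) (by rintro rfl; exact hiY hj)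
  · refine fun hS => ⟨fun j hj => (mem_nonAtomPart.1 hj).2, fun i hi hle => ?_⟩
    dsimp only [faceJoin] at hle
    rw [← Finset.sup_union] at hle
    obtain ⟨f, hif, Z, hZ, hZf⟩ := hh.exists_factor _ i hi hle
    have hf := hh.not_isAtom_of_le hi hif
    have hZS : Z ⊆ S := hZ.trans (Finset.union_subset (Finset.filter_subset _ _)
      ((Finset.filter_subset _ _).trans (Finset.filter_subset _ _)))
    have hfZ := hZ (hS Z hZS f hf f.2 hZf)
    rw [Finset.mem_union, mem_atomPart, Finset.mem_filter] at hfZ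
    rcases hfZ with h1 | h1
    · exact hf h1.2
    · exact absurd (hh.ord f i hif) h1.2.not_ge

lemma vertex_eq_faceJoin (i : Fin n) : vertex h i = faceJoin h {i} := by
  classical
  unfold vertex faceJoin nonAtomPart atomPart
  by_cases hi : IsAtom (h i)
  · rw [Finset.filter_singleton, Finset.filter_singleton]; simp [hi]
  · rw [Finset.filter_singleton, Finset.filter_singleton]; simp [hi]

lemma compatible_singleton (hh : IsBlowupOrder h) (k : ℕ) (i : Fin n) : Compatible h k {i} := by
  intro Y hY j _ _ hYj
  rcases Finset.subset_singleton_iff.1 hY with rfl | rfl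
  · exact absurd hYj.symm (hh.ne_bot j)
  · rw [Finset.sup_singleton] at hYj
    rw [hh.inj hYj]; simp

lemma vertex_mem (hh : IsBlowupOrder h) (i : Fin n) : vertex h i ∈ partialBlowupSet h := by
  rw [vertex_eq_faceJoin, faceJoin_mem_iff hh]
  exact compatible_singleton hh n i

lemma vertex_le_iff {i : Fin n} {w : Finset (Fin n) × L} :
    vertex h i ≤ w ↔ (IsAtom (h i) → h i ≤ w.2) ∧ (¬ IsAtom (h i) → i ∈ w.1) := by
  unfold vertex
  by_cases hi : IsAtom (h i) <;> simp [hi, Prod.le_def]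

lemma mem_upperBounds_vertices (hh : IsBlowupOrder h) {w : PartialBlowup h} :
    w ∈ upperBounds (vertices h S) ↔ faceJoin h S ≤ w.1 := by
  have : w ∈ upperBounds (vertices h S) ↔ ∀ i ∈ S, vertex h i ≤ w.1 := by
    constructor
    · intro hw i hi
      exact hw (a := ⟨vertex h i, vertex_mem hh i⟩) ⟨i, hi, rfl⟩
    · rintro hw ⟨z, hz⟩ ⟨i, hi, rfl⟩
      exact hw i hi
  rw [this]
  constructor
  · intro hw
    refine ⟨fun i hi => ?_, Finset.sup_le fun i hi => ?_⟩
    · replace hi := mem_nonAtomPart.1 hi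
      exact (vertex_le_iff.1 (hw i hi.1)).2 hi.2
    · rw [mem_atomPart] at hi
      exact (vertex_le_iff.1 (hw i hi.1)).1 hi.2
  · intro hw i hi
    rw [vertex_le_iff]
    exact ⟨fun hat => (Finset.le_sup (f := h) (mem_atomPart.2 ⟨hi, hat⟩)).trans hw.2,
      fun hat => hw.1 (mem_nonAtomPart.2 ⟨hi, hat⟩)⟩

lemma isSimplex_iff (hh : IsBlowupOrder h) : IsSimplex h S ↔ Compatible h n S := by
  rw [← faceJoin_mem_iff hh]
  constructor
  · rintro ⟨w, hw⟩
    exact partialBlowupSet_lower w.2 ((mem_upperBounds_vertices hh).1 hw)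
  · intro hS
    exact ⟨⟨_, hS⟩, (mem_upperBounds_vertices hh).2 le_rfl⟩

lemma isLUB_vertices_iff (hh : IsBlowupOrder h) {j : PartialBlowup h} :
    IsLUB (vertices h S) j ↔ j.1 = faceJoin h S := by
  constructor
  · intro hj
    have h1 := (mem_upperBounds_vertices hh).1 hj.1
    have h2 : j ≤ (⟨_, partialBlowupSet_lower j.2 h1⟩ : PartialBlowup h) :=
      hj.2 ((mem_upperBounds_vertices hh).2 le_rfl)
    exact le_antisymm h2 h1
  · intro hj
    refine ⟨(mem_upperBounds_vertices hh).2 hj.ge, fun w hw => ?_⟩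
    have := (mem_upperBounds_vertices hh).1 hw
    rw [← hj] at this
    exact this

end Faces

/-! ### Ranks, circuits and nbc sets in the partial blowup -/

section Independence

variable {L : Type u} [Lattice L] [BoundedOrder L] [Finite L] [IsUpperModularLattice L] {n : ℕ}
  {h : Fin n → L} {S : Finset (Fin n)}

lemma intervalRank_bot_lt {x y : L} (hxy : x < y) : intervalRank ⊥ x < intervalRank ⊥ y := by
  rw [intervalRank_eq bot_le, intervalRank_eq bot_le]
  have := corank_lt hxy
  have := corank_le (bot_le : ⊥ ≤ x)
  omega

lemma intervalRank_bot_le {x y : L} (hxy : x ≤ y) : intervalRank ⊥ x ≤ intervalRank ⊥ y := by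
  rcases hxy.eq_or_lt with rfl | h
  · exact le_rfl
  · exact (intervalRank_bot_lt h).le

/-- The points form a lower set in a product of a Boolean lattice and `L`, so heights are those of
the product. -/
lemma height_partialBlowup (w : PartialBlowup h) :
    Order.height w = ((w.1.1.card + intervalRank ⊥ w.1.2 : ℕ) : ℕ∞) := by
  classical
  have : WellFoundedLT (PartialBlowup h) := Finite.to_wellFoundedLT
  induction w using WellFoundedLT.induction with
  | ind w ih =>
    have hlt : ∀ y < w, y.1.1.card + intervalRank ⊥ y.1.2 < w.1.1.card + intervalRank ⊥ w.1.2 := by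
      intro y hy
      have hy' : y.1 < w.1 := hy
      rcases Prod.lt_iff.1 hy' with ⟨h1, h2⟩ | ⟨h1, h2⟩
      · exact add_lt_add_of_lt_of_le (Finset.card_lt_card h1) (intervalRank_bot_le h2)
      · exact add_lt_add_of_le_of_lt (Finset.card_le_card h1) (intervalRank_bot_lt h2)
    apply le_antisymm
    · rw [Order.height_le_coe_iff]
      intro y hy
      rw [ih y hy]
      exact_mod_cast hlt y hy
    · suffices H : w.1.1.card + intervalRank ⊥ w.1.2 = 0 ∨
          ∃ y < w, w.1.1.card + intervalRank ⊥ w.1.2 ≤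
            y.1.1.card + intervalRank ⊥ y.1.2 + 1 by
        rcases H with H | ⟨y, hy, H⟩
        · rw [H]; simp
        · refine le_trans ?_ (Order.height_add_one_le hy)
          rw [ih y hy]
          exact_mod_cast H
      rcases w.1.1.eq_empty_or_nonempty with h0 | ⟨i, hi⟩
      · rcases eq_or_ne w.1.2 ⊥ with h1 | h1
        · left; rw [h0, h1, intervalRank_self]; rfl
        · right
          obtain ⟨x, -, hx⟩ := exists_le_covBy_of_lt (bot_lt_iff_ne_bot.2 h1)
          have hlt' : (w.1.1, x) < w.1 := Prod.lt_iff.2 (Or.inr ⟨le_rfl, hx.lt⟩)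
          refine ⟨⟨_, partialBlowupSet_lower w.2 hlt'.le⟩, hlt', ?_⟩
          dsimp only
          rw [intervalRank_eq bot_le, intervalRank_eq bot_le, corank_covBy hx]
          omega
      · right
        have hlt' : (w.1.1.erase i, w.1.2) < w.1 :=
          Prod.lt_iff.2 (Or.inl ⟨Finset.erase_ssubset hi, le_rfl⟩)
        refine ⟨⟨_, partialBlowupSet_lower w.2 hlt'.le⟩, hlt', ?_⟩
        dsimp only
        have := Finset.card_erase_add_one hi
        omega

lemma isIndependent_iff (hh : IsBlowupOrder h) : IsIndependent h S ↔
    Compatible h n S ∧ intervalRank ⊥ ((atomPart h S).sup h) = (atomPart h S).card := by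
  have hc := card_nonAtomPart_add (h := h) S
  have aux : ∀ j : PartialBlowup h, j.1 = faceJoin h S → (Order.height j = (S.card : ℕ∞) ↔
      intervalRank ⊥ ((atomPart h S).sup h) = (atomPart h S).card) := by
    intro j hj
    rw [height_partialBlowup, hj, Nat.cast_inj, ← hc]
    exact add_right_inj _
  constructor
  · rintro ⟨j, hj, hj'⟩
    rw [isLUB_vertices_iff hh] at hj
    exact ⟨(faceJoin_mem_iff hh).1 (hj ▸ j.2), (aux j hj).1 hj'⟩
  · rintro ⟨h1, h2⟩
    exact ⟨⟨_, (faceJoin_mem_iff hh).2 h1⟩, (isLUB_vertices_iff hh).2 rfl, (aux _ rfl).2 h2⟩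

lemma intervalRank_atomPart_le (S : Finset (Fin n)) :
    intervalRank ⊥ ((atomPart h S).sup h) ≤ (atomPart h S).card :=
  intervalRank_le_card (h := h) (fun i hi => (mem_atomPart.1 hi).2) (by simp)

/-- The indices below the join of the atoms of `𝓛(L, H)` with indices in `U`. -/
def InClosure (h : Fin n → L) (U : Finset (Fin n)) (g : Fin n) : Prop :=
  (IsAtom (h g) → h g ≤ (atomPart h U).sup h) ∧ (¬ IsAtom (h g) → g ∈ U)

lemma InClosure.mono {U V : Finset (Fin n)} {g : Fin n} (hg : InClosure h U g) (hUV : U ⊆ V) :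
    InClosure h V g := by
  classical
  exact ⟨fun ha => (hg.1 ha).trans (Finset.sup_mono (Finset.filter_subset_filter _ hUV)),
    fun ha => hUV (hg.2 ha)⟩

lemma inClosure_of_mem {U : Finset (Fin n)} {g : Fin n} (hg : g ∈ U) : InClosure h U g :=
  ⟨fun ha => Finset.le_sup (f := h) (mem_atomPart.2 ⟨hg, ha⟩), fun _ => hg⟩

lemma not_inClosure_empty (g : Fin n) : ¬ InClosure h ∅ g := by
  intro hg
  by_cases ha : IsAtom (h g)
  · have := hg.1 ha
    simp only [atomPart, Finset.filter_empty, Finset.sup_empty, le_bot_iff] at this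
    exact ha.1 this
  · simpa using hg.2 ha

/-- Elements below the join of a part of a nested set may be added. -/
lemma Compatible.union_of_inClosure (hh : IsBlowupOrder h) {S T V : Finset (Fin n)}
    (hST : Compatible h n (S ∪ T)) (hV : ∀ g ∈ V, InClosure h S g) :
    Compatible h n (S ∪ T ∪ V) := by
  classical
  rw [← faceJoin_mem_iff hh] at hST ⊢
  refine partialBlowupSet_lower hST ⟨fun i hi => ?_, Finset.sup_le fun i hi => ?_⟩
  · obtain ⟨hi, ha⟩ := mem_nonAtomPart.1 hi
    rcases Finset.mem_union.1 hi with hi | hi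
    · exact mem_nonAtomPart.2 ⟨hi, ha⟩
    · exact mem_nonAtomPart.2 ⟨Finset.mem_union_left _ ((hV i hi).2 ha), ha⟩
  · rw [mem_atomPart, Finset.mem_union] at hi
    rcases hi with ⟨hi | hi, ha⟩
    · exact Finset.le_sup (f := h) (mem_atomPart.2 ⟨hi, ha⟩)
    · exact ((hV i hi).1 ha).trans
        (Finset.sup_mono (Finset.filter_subset_filter _ Finset.subset_union_left))

/-- Independence depends only on compatibility and the atom part; removing a non-atom from a simplex
changes neither the atom part nor its dependence. -/
lemma IsCircuit.isAtom (hh : IsBlowupOrder h) {C : Finset (Fin n)} (hC : IsCircuit h C)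
    {c : Fin n} (hc : c ∈ C) : IsAtom (h c) := by
  by_contra ha
  have h1 := (isIndependent_iff hh).1 (hC.2.2 _ (Finset.erase_ssubset hc))
  have h2 : atomPart h (C.erase c) = atomPart h C := by
    ext i
    simp only [mem_atomPart, Finset.mem_erase]
    constructor
    · rintro ⟨⟨-, h3⟩, h4⟩; exact ⟨h3, h4⟩
    · rintro ⟨h3, h4⟩; exact ⟨⟨by rintro rfl; exact ha h4, h3⟩, h4⟩
  rw [h2] at h1
  exact hC.2.1 ((isIndependent_iff hh).2 ⟨(isSimplex_iff hh).1 hC.1, h1.2⟩)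

lemma IsCircuit.atomPart_eq (hh : IsBlowupOrder h) {C T : Finset (Fin n)} (hC : IsCircuit h C)
    (hT : T ⊆ C) : atomPart h T = T := by
  ext i
  rw [mem_atomPart]
  exact ⟨fun hi => hi.1, fun hi => ⟨hi, hC.isAtom hh (hT hi)⟩⟩

lemma IsCircuit.inClosure_erase (hh : IsBlowupOrder h) {C : Finset (Fin n)} (hC : IsCircuit h C)
    {c : Fin n} (hc : c ∈ C) : InClosure h (C.erase c) c := by
  refine ⟨fun _ => ?_, fun ha => absurd (hC.isAtom hh hc) ha⟩
  have h1 := ((isIndependent_iff hh).1 (hC.2.2 _ (Finset.erase_ssubset hc))).2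
  have h2 : intervalRank ⊥ ((atomPart h C).sup h) ≠ (atomPart h C).card := fun h2 =>
    hC.2.1 ((isIndependent_iff hh).2 ⟨(isSimplex_iff hh).1 hC.1, h2⟩)
  have h3 := intervalRank_atomPart_le (h := h) C
  rw [hC.atomPart_eq hh (Finset.erase_subset _ _)] at h1 ⊢
  rw [hC.atomPart_eq hh subset_rfl] at h2 h3
  have h4 := Finset.card_erase_add_one hc
  have hle : (C.erase c).sup h ≤ C.sup h := Finset.sup_mono (Finset.erase_subset _ _)
  by_contra hn
  have hlt : (C.erase c).sup h < C.sup h :=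
    lt_of_le_of_ne hle fun e => hn (e ▸ Finset.le_sup hc)
  have := intervalRank_bot_lt hlt
  omega

/-- A circuit does not have exactly one element outside of a closed set. -/
lemma IsCircuit.exists_ne_not_inClosure (hh : IsBlowupOrder h) {C U : Finset (Fin n)}
    (hC : IsCircuit h C) {c : Fin n} (hc : c ∈ C) (hcU : ¬ InClosure h U c) :
    ∃ b ∈ C, b ≠ c ∧ ¬ InClosure h U b := by
  by_contra! hb
  refine hcU ⟨fun hca => ((hC.inClosure_erase hh hc).1 hca).trans ?_,
    fun ha => absurd (hC.isAtom hh hc) ha⟩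
  rw [hC.atomPart_eq hh (Finset.erase_subset _ _)]
  refine Finset.sup_le fun b hb' => ?_
  rw [Finset.mem_erase] at hb'
  exact (hb b hb'.2 hb'.1).1 (hC.isAtom hh hb'.2)

/-- If `g` were in the closure, `g` and the atoms of `U` would form a dependent simplex. A circuit
in it, without its least element, would be a broken circuit in `S`. -/
lemma IsNBC.not_inClosure (hh : IsBlowupOrder h) {S U : Finset (Fin n)} (hS : IsNBC h S)
    (hU : U ⊆ S) {g : Fin n} (hg : ∀ u ∈ U, g < u) : ¬ InClosure h U g := by
  classical
  intro hgU
  by_cases ha : IsAtom (h g)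
  swap
  · exact lt_irrefl _ (hg g (hgU.2 ha))
  set V := insert g (atomPart h U) with hV
  have hgU' : g ∉ atomPart h U := fun h' => lt_irrefl _ (hg g (mem_atomPart.1 h').1)
  have hUc : Compatible h n (U ∪ ∅) := by
    simpa using ((isSimplex_iff hh).1 hS.1).mono hU
  have hVc : Compatible h n V := by
    refine (hUc.union_of_inClosure hh (V := {g}) (by simpa using hgU)).mono ?_
    refine Finset.insert_subset (by simp) fun i hi => ?_
    simp [(mem_atomPart.1 hi).1]
  have hVat : atomPart h V = V := by
    ext i
    rw [mem_atomPart]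
    refine ⟨fun hi => hi.1, fun hi => ⟨hi, ?_⟩⟩
    rcases Finset.mem_insert.1 hi with rfl | hi
    · exact ha
    · exact (mem_atomPart.1 hi).2
  have hVdep : ¬ IsIndependent h V := by
    intro hind
    have h1 := ((isIndependent_iff hh).1 hind).2
    rw [hVat, hV, Finset.sup_insert, sup_eq_right.2 (hgU.1 ha),
      Finset.card_insert_of_notMem hgU'] at h1
    have h2 := intervalRank_atomPart_le (h := h) U
    omega
  obtain ⟨C, hCV, hC⟩ := Set.Finite.exists_le_minimal (s := {T | T ⊆ V ∧ ¬ IsIndependent h T})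
    (Set.toFinite _) ⟨subset_rfl, hVdep⟩
  have hCcirc : IsCircuit h C := by
    refine ⟨(isSimplex_iff hh).2 (hVc.mono hCV), hC.1.2, fun T hT => ?_⟩
    by_contra hTd
    exact hT.2 (hC.2 ⟨hT.1.trans hCV, hTd⟩ hT.1)
  have hCne : C.Nonempty := by
    rw [Finset.nonempty_iff_ne_empty]
    rintro rfl
    apply hC.1.2
    rw [isIndependent_iff hh]
    refine ⟨hVc.mono hCV, ?_⟩
    simp [atomPart, intervalRank_self]
  -- If `g` lies in the circuit, it is this minimum, so what remains lies in `U`.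
  set m := C.min' hCne with hm
  have hmC : m ∈ C := Finset.min'_mem _ _
  refine hS.2 (C.erase m) (fun i hi => ?_) ⟨m, fun i hi => ?_, ?_⟩
  · have hi' := Finset.mem_erase.1 hi
    rcases Finset.mem_insert.1 (hCV hi'.2) with rfl | h1
    · exfalso
      have h2 : m ≤ i := Finset.min'_le _ _ hi'.2
      have h3 : i ≤ m := by
        rcases Finset.mem_insert.1 (hCV hmC) with h4 | h4
        · exact h4.ge
        · exact (hg _ (mem_atomPart.1 h4).1).le
      exact hi'.1 (le_antisymm h3 h2)
    · exact hU (mem_atomPart.1 h1).1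
  · have hi' := Finset.mem_erase.1 hi
    exact lt_of_le_of_ne (Finset.min'_le _ _ hi'.2) (Ne.symm hi'.1)
  · rwa [Finset.insert_erase hmC]

lemma exists_isBrokenCircuit_of_not_isNBC (hh : IsBlowupOrder h) {S : Finset (Fin n)}
    (hS : Compatible h n S) (hn : ¬ IsNBC h S) : ∃ T ⊆ S, IsBrokenCircuit h T := by
  by_contra! hc
  exact hn ⟨(isSimplex_iff hh).2 hS, fun T hT => hc T hT⟩

end Independence

end LerayModel

namespace LerayModel

universe u

set_option linter.unusedSectionVars false

open MvPolynomial

/-! ### Commutative relations next to `e_S`, and the power relations -/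

section RelIdeal

variable {L : Type u} [Lattice L] [BoundedOrder L] {n : ℕ}

open Classical in
/-- `c_g` as a polynomial. -/
noncomputable def cPoly (h : Fin n → L) (g : Fin n) : MvPolynomial (Fin n) ℚ :=
  ∑ f ∈ Finset.univ.filter (fun f => h g ≤ h f), X f

/-- The relations in the variables `x` that hold next to `e_S`, for the partial building set that
consists of the atoms and the elements with index less than `k`; the variables of the other elements
are relations, too. -/
noncomputable def relIdeal (h : Fin n → L) (k : ℕ) (S : Finset (Fin n)) :
    Ideal (MvPolynomial (Fin n) ℚ) :=
  Ideal.span ({p | ∃ i : Fin n, ¬ IsAtom (h i) ∧ k ≤ i ∧ p = X i} ∪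
    {p | ∃ T : Finset (Fin n), ¬ Compatible h k (S ∪ T) ∧ p = ∏ i ∈ T, X i} ∪
    {p | ∃ a, IsAtom (h a) ∧ p = cPoly h a})

variable {h : Fin n → L} {k : ℕ} {S : Finset (Fin n)}

lemma X_mem_relIdeal {i : Fin n} (hi : ¬ IsAtom (h i)) (hki : k ≤ i) : X i ∈ relIdeal h k S :=
  Ideal.subset_span (Or.inl (Or.inl ⟨i, hi, hki, rfl⟩))

lemma prod_mem_relIdeal {T : Finset (Fin n)} (hT : ¬ Compatible h k (S ∪ T)) :
    ∏ i ∈ T, X i ∈ relIdeal h k S :=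
  Ideal.subset_span (Or.inl (Or.inr ⟨T, hT, rfl⟩))

lemma cPoly_mem_relIdeal {a : Fin n} (ha : IsAtom (h a)) : cPoly h a ∈ relIdeal h k S :=
  Ideal.subset_span (Or.inr ⟨a, ha, rfl⟩)

lemma relIdeal_le {I : Ideal (MvPolynomial (Fin n) ℚ)}
    (h1 : ∀ i : Fin n, ¬ IsAtom (h i) → k ≤ i → X i ∈ I)
    (h2 : ∀ T : Finset (Fin n), ¬ Compatible h k (S ∪ T) → ∏ i ∈ T, X i ∈ I)
    (h3 : ∀ a, IsAtom (h a) → cPoly h a ∈ I) : relIdeal h k S ≤ I := by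
  refine Ideal.span_le.2 ?_
  rintro _ ((⟨i, hi, hk, rfl⟩ | ⟨T, hT, rfl⟩) | ⟨a, ha, rfl⟩)
  exacts [h1 i hi hk, h2 T hT, h3 a ha]

lemma relIdeal_mono {S' : Finset (Fin n)} (hS : S ⊆ S') : relIdeal h k S ≤ relIdeal h k S' :=
  relIdeal_le (fun _ hi hk => X_mem_relIdeal hi hk)
    (fun _ hT => prod_mem_relIdeal fun hT' =>
      hT (hT'.mono (Finset.union_subset_union_left hS)))
    (fun _ ha => cPoly_mem_relIdeal ha)

open Classical in
lemma cPoly_sub {a g : Fin n} (hag : h a ≤ h g) : cPoly h a - cPoly h g =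
    ∑ f ∈ Finset.univ.filter (fun f => h a ≤ h f ∧ ¬ h g ≤ h f), X f := by
  rw [sub_eq_iff_eq_add, cPoly, cPoly, ← Finset.sum_union]
  · congr 1
    ext f
    simp only [Finset.mem_filter, Finset.mem_univ, true_and, Finset.mem_union]
    constructor
    · intro hf
      by_cases hg : h g ≤ h f
      · exact Or.inr hg
      · exact Or.inl ⟨hf, hg⟩
    · rintro (hf | hf)
      · exact hf.1
      · exact hag.trans hf
  · rw [Finset.disjoint_left]
    intro f hf hf'
    exact (Finset.mem_filter.1 hf).2.2 (Finset.mem_filter.1 hf').2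

lemma not_compatible_of_sup_eq {Y T : Finset (Fin n)} {i : Fin n} (hY : Y ⊆ T)
    (hi : ¬ IsAtom (h i)) (hik : (i : ℕ) < k) (hYi : Y.sup h = h i) (hiY : i ∉ Y) :
    ¬ Compatible h k T :=
  fun hT => hiY (hT Y hY i hi hik hYi)

/-- The join of the two elements belongs to `H` because their meet is not `⊥`; being different from
both, it makes the pair incompatible. -/
lemma X_mul_X_mem_relIdeal (hh : IsBlowupOrder h) {f j : Fin n} (hj : ¬ IsAtom (h j))
    (hfj : h f ⊓ h j ≠ ⊥) (h1 : ¬ h j ≤ h f) (h2 : ¬ h f ≤ h j) :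
    X f * X j ∈ relIdeal h n S := by
  classical
  have hne : f ≠ j := by rintro rfl; exact h1 le_rfl
  obtain ⟨l, hl⟩ := hh.exists_eq_sup j f hj (by rwa [inf_comm])
  have : ∏ i ∈ ({f, j} : Finset (Fin n)), X i ∈ relIdeal h n S := by
    refine prod_mem_relIdeal (not_compatible_of_sup_eq (Y := {f, j}) (i := l)
      Finset.subset_union_right (hh.not_isAtom_of_le hj (hl ▸ le_sup_left)) l.2 ?_ ?_)
    · rw [Finset.sup_insert, Finset.sup_singleton, hl, sup_comm]
    · rw [Finset.mem_insert, Finset.mem_singleton]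
      rintro (rfl | rfl)
      · exact h1 (hl ▸ le_sup_left)
      · exact h2 (hl ▸ le_sup_right)
  rwa [Finset.prod_pair hne] at this

/-- Choose an atom `a ≤ g` not below the join of `S ∪ T`, and replace one factor `c_g` by `c_a`
minus the `x_f` with `f ≥ a`, `f ≱ g`. Next to a surviving `x_f`, the element `c_g` becomes `c_{f ∨
g}`, and semimodularity lowers the rank. It may drop by more than one, hence the bound instead of an
equality. -/
lemma prod_mul_cPoly_pow_mem [Finite L] [IsUpperModularLattice L] [IsAtomistic L]
    (hh : IsBlowupOrder h) (d : ℕ) : ∀ (T : Finset (Fin n)) (g : Fin n),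
    (S ∪ T).sup h < h g → intervalRank ((S ∪ T).sup h) (h g) ≤ d →
    (∏ i ∈ T, X i) * cPoly h g ^ d ∈ relIdeal h n S := by
  classical
  induction d with
  | zero =>
    intro T g hg hd
    have := intervalRank_pos hg
    omega
  | succ d ih =>
    intro T g hg hd
    obtain ⟨a', ha', hag, haS⟩ := exists_atom_not_le hg.not_ge
    obtain ⟨a, rfl⟩ := hh.exists_eq_atom a' ha'
    set J := relIdeal h n S
    have hexp : (∏ i ∈ T, X i) * cPoly h g ^ (d + 1) =
        (∏ i ∈ T, X i) * cPoly h g ^ d * cPoly h a -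
          ∑ f ∈ Finset.univ.filter (fun f => h a ≤ h f ∧ ¬ h g ≤ h f),
            (∏ i ∈ T, X i) * X f * cPoly h g ^ d := by
      rw [← Finset.sum_mul, ← Finset.mul_sum, ← cPoly_sub hag]
      ring
    rw [hexp]
    refine J.sub_mem (J.mul_mem_left _ (cPoly_mem_relIdeal ha')) (J.sum_mem fun f hf => ?_)
    obtain ⟨haf, hgf⟩ := (Finset.mem_filter.1 hf).2
    have hgat : ¬ IsAtom (h g) := fun hga => hgf (hh.eq_of_atom hga hag ▸ haf)
    have hfT : f ∉ T := fun hf' =>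
      haS (haf.trans (Finset.le_sup (f := h) (Finset.mem_union_right _ hf')))
    have hprod : (∏ i ∈ T, X i) * X f = (∏ i ∈ insert f T, X i : MvPolynomial (Fin n) ℚ) := by
      rw [Finset.prod_insert hfT, mul_comm]
    by_cases hcomp : Compatible h n (S ∪ insert f T)
    swap
    · rw [hprod]
      exact J.mul_mem_right _ (prod_mem_relIdeal hcomp)
    have hinf : h g ⊓ h f ≠ ⊥ := fun h0 => ha'.1 (le_bot_iff.1 (h0 ▸ le_inf hag haf))
    obtain ⟨k, hk⟩ := hh.exists_eq_sup g f hgat hinf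
    have hgk : h g ≤ h k := hk ▸ le_sup_left
    have hfk : h f ≤ h k := hk ▸ le_sup_right
    have hkat := hh.not_isAtom_of_le hgat hgk
    -- An element above `g` but not above `f ∨ g` is incomparable to `f` and meets it above `a`, so
    -- the product of the two variables is a relation.
    have hX : X f * (cPoly h g - cPoly h k) ∈ J := by
      rw [cPoly_sub hgk, Finset.mul_sum]
      refine J.sum_mem fun j hj => ?_
      obtain ⟨hgj, hkj⟩ := (Finset.mem_filter.1 hj).2
      refine X_mul_X_mem_relIdeal hh (hh.not_isAtom_of_le hgat hgj) (fun h0 => ?_)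
        (fun h1 => hgf (hgj.trans h1)) (fun h1 => hkj (hk ▸ sup_le hgj h1))
      exact ha'.1 (le_bot_iff.1 (h0 ▸ le_inf haf (hag.trans hgj)))
    have hpow : X f * (cPoly h g ^ d - cPoly h k ^ d) ∈ J := by
      obtain ⟨q, hq⟩ := sub_dvd_pow_sub_pow (cPoly h g) (cPoly h k) d
      rw [hq, ← mul_assoc]
      exact J.mul_mem_right _ hX
    have hsup : (S ∪ insert f T).sup h = (S ∪ T).sup h ⊔ h f := by
      rw [Finset.union_insert, Finset.sup_insert, sup_comm]
    have hle : (S ∪ insert f T).sup h ≤ h k := by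
      rw [hsup]
      exact sup_le (hg.le.trans hgk) hfk
    have hlt : (S ∪ insert f T).sup h < h k := by
      refine lt_of_le_of_ne hle fun he => ?_
      have hkm := hcomp _ subset_rfl k hkat k.2 he
      rw [Finset.union_insert, Finset.mem_insert] at hkm
      rcases hkm with rfl | hkm
      · exact hgf hgk
      · exact (hgk.trans (Finset.le_sup (f := h) hkm)).not_gt hg
    -- Adding `a` costs one rank; adding `f`, which lies above `a`, to both ends does not increase
    -- the rest.
    have hrank : intervalRank ((S ∪ insert f T).sup h) (h k) ≤ d := by
      have h1 := intervalRank_sup_atom ha' hag hg.le haS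
      have h2 := intervalRank_sup_le (h f) (sup_le hg.le hag)
      rw [sup_assoc, sup_eq_right.2 haf, ← hsup, ← hk] at h2
      omega
    have hfin := J.add_mem (ih (insert f T) k hlt hrank) (J.mul_mem_left (∏ i ∈ T, X i) hpow)
    convert hfin using 1
    rw [← hprod]
    ring

end RelIdeal

end LerayModel

/-! ### One blowup step for the commutative relations -/

namespace LerayModel

universe u

set_option linter.unusedSectionVars false

/-- Modulo `K`, a polynomial of degree less than that of `P` is the multiple `qP` of a monic
polynomial, so it vanishes and `q` has coefficients in `K`. Then `F(0) = Q(0) + q(0)P(0)` lies in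
`J`. -/
lemma coeff_mem_of_eq_add_mul_monic {A : Type*} [CommRing A] {J K : Ideal A}
    {F Q q P : Polynomial A} (hF : F = Q + q * P) (hP : P.Monic) (hdeg : F.degree < P.degree)
    (hQ0 : Q.coeff 0 ∈ J) (hQ : ∀ j, Q.coeff j ∈ K) (hK : ∀ x ∈ K, x * P.coeff 0 ∈ J) :
    F.coeff 0 ∈ J ∧ ∀ j, F.coeff j ∈ K := by
  nontriviality A
  by_cases hK1 : K = ⊤
  · refine ⟨?_, fun j => hK1 ▸ Submodule.mem_top⟩
    rw [hF, Polynomial.coeff_add, Polynomial.mul_coeff_zero]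
    exact J.add_mem hQ0 (hK _ (hK1 ▸ Submodule.mem_top))
  have : Nontrivial (A ⧸ K) := Ideal.Quotient.nontrivial_iff.2 hK1
  set m := Ideal.Quotient.mk K
  have hmF : F.map m = q.map m * P.map m := by
    have : Q.map m = 0 := by
      ext j
      rw [Polynomial.coeff_map, Polynomial.coeff_zero, Ideal.Quotient.eq_zero_iff_mem]
      exact hQ j
    rw [hF, Polynomial.map_add, Polynomial.map_mul, this, zero_add]
  have hPm := hP.map m
  have hF0 : F.map m = 0 := by
    by_contra hne
    refine hPm.not_dvd_of_degree_lt hne ?_ ⟨q.map m, by rw [hmF, mul_comm]⟩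
    rw [hP.degree_map]
    exact Polynomial.degree_map_le.trans_lt hdeg
  have hq0 : q.map m = 0 := by
    rw [hF0] at hmF
    exact (hPm.mul_left_eq_zero_iff).1 hmF.symm
  constructor
  · rw [hF, Polynomial.coeff_add, Polynomial.mul_coeff_zero]
    refine J.add_mem hQ0 (hK _ ?_)
    rw [← Ideal.Quotient.eq_zero_iff_mem, ← Polynomial.coeff_map, hq0, Polynomial.coeff_zero]
  · intro j
    rw [← Ideal.Quotient.eq_zero_iff_mem, ← Polynomial.coeff_map, hF0, Polynomial.coeff_zero]

open MvPolynomial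

section Step

variable {L : Type u} [Lattice L] [BoundedOrder L] {n : ℕ} {h : Fin n → L} {k : Fin n}
  {S : Finset (Fin n)}

open Classical in
/-- The join of the elements of `S` strictly below the element with index `k`. -/
noncomputable def supBelow (h : Fin n → L) (S : Finset (Fin n)) (k : Fin n) : L :=
  (S.filter (fun f => h f < h k)).sup h

lemma supBelow_le : supBelow h S k ≤ h k := by
  classical
  exact Finset.sup_le fun i hi => (Finset.mem_filter.1 hi).2.le

lemma exists_of_not_compatible {l : ℕ} {T : Finset (Fin n)} (hT : ¬ Compatible h l T) :
    ∃ Y ⊆ T, ∃ i, ¬ IsAtom (h i) ∧ (i : ℕ) < l ∧ Y.sup h = h i ∧ i ∉ Y := by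
  unfold Compatible at hT
  push Not at hT
  exact hT

/-- Next to `k`, any further `f ≥ a` with `f ≱ k` has zero variable: either it has not been blown
up, or `f ∨ k` has index below `k` and makes `f` incompatible with `k`. Thus `c_a` reduces to `x_a +
c_k`. -/
lemma X_add_cPoly_mem (hh : IsBlowupOrder h) (hk : ¬ IsAtom (h k)) {a : Fin n}
    (ha : IsAtom (h a)) (hak : h a ≤ h k) :
    X a + cPoly h k ∈ relIdeal h k (insert k S) := by
  classical
  set K := relIdeal h k (insert k S)
  have hka : ¬ h k ≤ h a := fun hka => hh.not_isAtom_of_le hk hka ha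
  have h1 := cPoly_sub hak
  rw [← Finset.add_sum_erase _ _ (a := a) (by simp [hka])] at h1
  have h2 : X a + cPoly h k = cPoly h a -
      ∑ f ∈ (Finset.univ.filter (fun f => h a ≤ h f ∧ ¬ h k ≤ h f)).erase a, X f := by
    rw [eq_sub_iff_add_eq, add_right_comm, ← h1]
    ring
  rw [h2]
  refine K.sub_mem (cPoly_mem_relIdeal ha) (K.sum_mem fun f hf => ?_)
  simp only [Finset.mem_erase, Finset.mem_filter, Finset.mem_univ, true_and] at hf
  obtain ⟨hfa, haf, hkf⟩ := hf
  have hfat : ¬ IsAtom (h f) := fun hfat => hfa (hh.eq_of_atom hfat haf).symm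
  rcases le_or_gt k f with hkf' | hkf'
  · exact X_mem_relIdeal hfat hkf'
  · obtain ⟨l, hl⟩ := hh.exists_eq_sup f k hfat
      (fun h0 => ha.1 (le_bot_iff.1 (h0 ▸ le_inf haf hak)))
    have hfl : h f ≤ h l := hl ▸ le_sup_left
    have hlf : l < k := (hh.ord l f hfl).trans_lt hkf'
    have := prod_mem_relIdeal (T := {f}) (not_compatible_of_sup_eq (h := h) (k := k)
      (T := insert k S ∪ {f}) (Y := {f, k}) (i := l) ?_ (hh.not_isAtom_of_le hfat hfl) hlf ?_ ?_)
    · rwa [Finset.prod_singleton] at this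
    · intro x; simp only [Finset.mem_insert, Finset.mem_singleton, Finset.mem_union]; tauto
    · rw [Finset.sup_insert, Finset.sup_singleton, hl]
    · rw [Finset.mem_insert, Finset.mem_singleton]
      rintro (rfl | rfl)
      · exact hkf (hl ▸ le_sup_right)
      · exact lt_irrefl _ hlf

-- For `f` of index below `k`, the elements of `S` below `k`, `V` and `f` have join `k ∨ f`. This
-- belongs to `H`, has index below `k`, and differs from `f` because it lies above `b`.
open Classical in
lemma prod_mul_sum_mem (hh : IsBlowupOrder h) {V : Finset (Fin n)}
    (hV : ∀ i ∈ V, IsAtom (h i)) {a b : Fin n} (ha : IsAtom (h a)) (hbk : h b ≤ h k)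
    (hak : supBelow h S k ⊔ V.sup h ⊔ h a = h k) :
    (∏ i ∈ V, X i) * ∑ f ∈ (Finset.univ.filter (fun f => h a ≤ h f ∧ ¬ h b ≤ h f)).erase a, X f
      ∈ relIdeal h k S := by
  rw [Finset.mul_sum]
  refine Ideal.sum_mem _ fun f hf => ?_
  simp only [Finset.mem_erase, Finset.mem_filter, Finset.mem_univ, true_and] at hf
  obtain ⟨hfa, haf, hbf⟩ := hf
  have hfat : ¬ IsAtom (h f) := fun hfat => hfa (hh.eq_of_atom hfat haf).symm
  rcases le_or_gt k f with hkf' | hkf'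
  · exact Ideal.mul_mem_left _ _ (X_mem_relIdeal hfat hkf')
  have hak' : h a ≤ h k := hak ▸ le_sup_right
  obtain ⟨l, hl⟩ := hh.exists_eq_sup f k hfat
    (fun h0 => ha.1 (le_bot_iff.1 (h0 ▸ le_inf haf hak')))
  have hfl : h f ≤ h l := hl ▸ le_sup_left
  have hkl : h k ≤ h l := hl ▸ le_sup_right
  have hlf : l < k := (hh.ord l f hfl).trans_lt hkf'
  have hfV : f ∉ V := fun hfV => hfat (hV f hfV)
  rw [mul_comm, ← Finset.prod_insert hfV]
  refine prod_mem_relIdeal (not_compatible_of_sup_eq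
    (Y := S.filter (fun f => h f < h k) ∪ insert f V) (i := l)
    (Finset.union_subset_union_left (Finset.filter_subset _ _))
    (hh.not_isAtom_of_le hfat hfl) hlf ?_ ?_)
  · rw [Finset.sup_union, Finset.sup_insert, hl]
    change supBelow h S k ⊔ (h f ⊔ V.sup h) = _
    refine Eq.trans ?_ (congrArg (h f ⊔ ·) hak)
    rw [sup_comm (h f) (V.sup h), sup_comm (h f), sup_assoc _ (h a), sup_eq_right.2 haf,
      sup_assoc]
  · rw [Finset.mem_union, Finset.mem_filter, Finset.mem_insert]
    rintro (⟨-, h1⟩ | rfl | h1)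
    · exact h1.not_ge hkl
    · exact hbf (hbk.trans hkl)
    · exact hh.not_isAtom_of_le hfat hfl (hV l h1)

/-- In `c_a - c_b` the variables above both atoms cancel, and those above only one of them, apart
from `x_a` and `x_b`, are killed by the product over `V`. -/
lemma prod_mul_X_sub_X_mem (hh : IsBlowupOrder h) {V : Finset (Fin n)}
    (hV : ∀ i ∈ V, IsAtom (h i)) {a b : Fin n} (ha : IsAtom (h a)) (hb : IsAtom (h b))
    (hak : supBelow h S k ⊔ V.sup h ⊔ h a = h k) (hbk : supBelow h S k ⊔ V.sup h ⊔ h b = h k) :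
    (∏ i ∈ V, X i) * (X a - X b) ∈ relIdeal h k S := by
  classical
  rcases eq_or_ne a b with rfl | hne
  · simp
  set J := relIdeal h k S
  have h1 := prod_mul_sum_mem (b := b) hh hV ha (hbk ▸ le_sup_right) hak
  have h2 := prod_mul_sum_mem (b := a) hh hV hb (hak ▸ le_sup_right) hbk
  have split : ∀ x y : Fin n, IsAtom (h x) → IsAtom (h y) → x ≠ y → cPoly h x =
      ∑ f ∈ Finset.univ.filter (fun f => h x ≤ h f ∧ h y ≤ h f), X f + (X x +
      ∑ f ∈ (Finset.univ.filter (fun f => h x ≤ h f ∧ ¬ h y ≤ h f)).erase x, X f) := by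
    intro x y hx hy hxy
    have hyx : ¬ h y ≤ h x := fun hyx => hxy (hh.eq_of_atom hx hyx).symm
    rw [Finset.add_sum_erase _ _ (by simp [hyx]), cPoly,
      ← Finset.sum_filter_add_sum_filter_not _ (fun f => h y ≤ h f), Finset.filter_filter,
      Finset.filter_filter]
  have ea := split a b ha hb hne
  have eb := split b a hb ha hne.symm
  have hcomm : Finset.univ.filter (fun f => h b ≤ h f ∧ h a ≤ h f) =
      Finset.univ.filter (fun f => h a ≤ h f ∧ h b ≤ h f) := by
    ext; simp [and_comm]
  rw [hcomm] at eb
  have h3 := J.mul_mem_left (∏ i ∈ V, X i)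
    (J.sub_mem (cPoly_mem_relIdeal ha) (cPoly_mem_relIdeal hb))
  have h4 := J.sub_mem h3 (J.sub_mem h1 h2)
  rw [ea, eb] at h4
  convert h4 using 1
  ring

variable [Finite L] [IsUpperModularLattice L]

/-- Basis exchange: any two bases of the interval from `supBelow h S k` to `h k` are linked by
exchanges of one atom, and each exchange preserves the product modulo the relations. -/
lemma prod_sub_prod_mem (hh : IsBlowupOrder h) {U₀ : Finset (Fin n)}
    (hU₀ : ∀ i ∈ U₀, IsAtom (h i)) (hc₀ : U₀.card = intervalRank (supBelow h S k) (h k))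
    (hs₀ : supBelow h S k ⊔ U₀.sup h = h k) (U : Finset (Fin n))
    (hU : ∀ i ∈ U, IsAtom (h i)) (hc : U.card = intervalRank (supBelow h S k) (h k))
    (hs : supBelow h S k ⊔ U.sup h = h k) :
    ∏ i ∈ U, X i - ∏ i ∈ U₀, X i ∈ relIdeal h k S := by
  classical
  induction hN : (U \ U₀).card using Nat.strong_induction_on generalizing U with
  | _ N ih =>
  rcases (U \ U₀).eq_empty_or_nonempty with h0 | ⟨a, ha⟩
  · rw [Finset.eq_of_subset_of_card_le (Finset.sdiff_eq_empty_iff_subset.1 h0)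
      (hc₀.trans hc.symm).le, sub_self]
    exact Ideal.zero_mem _
  obtain ⟨haU, haU₀⟩ := Finset.mem_sdiff.1 ha
  set V := U.erase a with hVdef
  set w := supBelow h S k ⊔ V.sup h with hw
  have hV : ∀ i ∈ V, IsAtom (h i) := fun i hi => hU i (Finset.mem_of_mem_erase hi)
  have hUV : insert a V = U := Finset.insert_erase haU
  have haV : a ∉ V := Finset.notMem_erase a U
  have hwa : w ⊔ h a = h k := by
    rw [← hs, ← hUV, Finset.sup_insert, hw, sup_assoc, sup_comm (h a)]
  -- Otherwise `V` would span the interval with one atom fewer than its rank.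
  have hwk : w ≠ h k := fun he => by
    have h1 := intervalRank_le_card hV he
    rw [← hc, ← hUV, Finset.card_insert_of_notMem haV] at h1
    omega
  have haw : ¬ h a ≤ w := fun haw => hwk (by rw [← hwa, sup_eq_left.2 haw])
  obtain ⟨b, hbU₀, hbw⟩ : ∃ b ∈ U₀, ¬ h b ≤ w := by
    by_contra! hcon
    refine hwk (le_antisymm (hwa ▸ le_sup_left) ?_)
    rw [← hs₀]
    exact sup_le le_sup_left (Finset.sup_le hcon)
  have hbk : h b ≤ h k := hs₀ ▸ le_sup_of_le_right (Finset.le_sup hbU₀)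
  have hbV : b ∉ V := fun hbV => hbw (le_sup_of_le_right (Finset.le_sup hbV))
  have hwb : w ⊔ h b = h k := by
    have hcov : w ⋖ h k := hwa ▸ covBy_sup_atom (hU a haU) haw
    exact (hcov.eq_or_eq le_sup_left (sup_le hcov.le hbk)).resolve_left
      fun he => hbw (he ▸ le_sup_right)
  have hstep := prod_mul_X_sub_X_mem hh hV (hU a haU) (hU₀ b hbU₀) hwa hwb
  have hb' : ∀ i ∈ insert b V, IsAtom (h i) := by
    intro i hi
    rcases Finset.mem_insert.1 hi with rfl | hi
    · exact hU₀ i hbU₀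
    · exact hV i hi
  have hlt : (insert b V \ U₀).card < N := by
    rw [← hN]
    apply Finset.card_lt_card
    rw [Finset.ssubset_iff_of_subset]
    · refine ⟨a, ha, fun h' => ?_⟩
      rcases Finset.mem_insert.1 (Finset.mem_sdiff.1 h').1 with rfl | h'
      · exact haU₀ hbU₀
      · exact haV h'
    · intro i hi
      obtain ⟨h1, h2⟩ := Finset.mem_sdiff.1 hi
      rcases Finset.mem_insert.1 h1 with rfl | h1
      · exact absurd hbU₀ h2
      · exact Finset.mem_sdiff.2 ⟨Finset.mem_of_mem_erase h1, h2⟩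
  have hrec := ih _ hlt (insert b V) hb' (by
    rw [← hc, ← hUV, Finset.card_insert_of_notMem haV, Finset.card_insert_of_notMem hbV]) (by
    rw [Finset.sup_insert, sup_comm (h b), ← sup_assoc, hwb]) rfl
  convert Ideal.add_mem _ hstep hrec using 1
  rw [← hUV, Finset.prod_insert haV, Finset.prod_insert hbV]
  ring

/-- In an incompatibility that involves `k`, the element `h k` can be replaced by the part of `S`
below it and the atoms in `U₀`, whose join it is. -/
lemma mul_prod_mem {U₀ : Finset (Fin n)}
    (hU₀ : ∀ i ∈ U₀, IsAtom (h i)) (hs₀ : supBelow h S k ⊔ U₀.sup h = h k) :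
    ∀ x ∈ relIdeal h k (insert k S), x * ∏ i ∈ U₀, X i ∈ relIdeal h k S := by
  classical
  set J := relIdeal h k S
  suffices hle : relIdeal h k (insert k S) ≤
      Submodule.comap (LinearMap.mulRight (MvPolynomial (Fin n) ℚ) (∏ i ∈ U₀, X i)) J from
    fun x hx => hle hx
  refine relIdeal_le (fun i hi hki => ?_) (fun T hT => ?_) (fun a ha => ?_)
  · exact J.mul_mem_right _ (X_mem_relIdeal hi hki)
  swap
  · exact J.mul_mem_right _ (cPoly_mem_relIdeal ha)
  obtain ⟨Y, hY, i, hi, hik, hYi, hiY⟩ := exists_of_not_compatible hT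
  change (∏ i ∈ T, X i) * ∏ i ∈ U₀, X i ∈ J
  by_cases hkY : k ∈ Y
  swap
  · refine J.mul_mem_right _ (prod_mem_relIdeal
      (not_compatible_of_sup_eq (Y := Y) (i := i) (fun j hj => ?_) hi hik hYi hiY))
    have := hY hj
    rw [Finset.insert_union, Finset.mem_insert] at this
    exact this.resolve_left (by rintro rfl; exact hkY hj)
  have hki : h k ≤ h i := hYi ▸ Finset.le_sup hkY
  rw [← Finset.prod_union_inter]
  refine J.mul_mem_right _ (prod_mem_relIdeal (not_compatible_of_sup_eq
    (Y := Y.erase k ∪ (S.filter (fun f => h f < h k) ∪ U₀)) (i := i) ?_ hi hik ?_ ?_))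
  · intro j hj
    simp only [Finset.mem_union, Finset.mem_erase, Finset.mem_filter] at hj ⊢
    rcases hj with ⟨hjk, hj⟩ | ⟨hj, -⟩ | hj
    · have := hY hj
      simp only [Finset.mem_union, Finset.mem_insert] at this
      tauto
    · tauto
    · tauto
  · rw [Finset.sup_union, Finset.sup_union]
    change _ ⊔ (supBelow h S k ⊔ _) = _
    rw [hs₀, ← hYi]
    nth_rw 2 [← Finset.insert_erase hkY]
    rw [Finset.sup_insert, sup_comm]
  · simp only [Finset.mem_union, Finset.mem_erase, Finset.mem_filter]
    rintro (⟨-, h1⟩ | ⟨-, h1⟩ | h1)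
    · exact hiY h1
    · exact h1.not_ge hki
    · exact hi (hU₀ i h1)

open Classical in
/-- The substitution that describes the blowup at the element with index `k`. -/
noncomputable def blowupHom (h : Fin n → L) (k : Fin n) :
    MvPolynomial (Fin n) ℚ →ₐ[ℚ] Polynomial (MvPolynomial (Fin n) ℚ) :=
  aeval fun i => if i = k then Polynomial.X else
    if IsAtom (h i) ∧ h i ≤ h k then Polynomial.C (X i) - Polynomial.X else Polynomial.C (X i)

lemma blowupHom_X_self : blowupHom h k (X k) = Polynomial.X := by
  simp [blowupHom]

lemma blowupHom_X_atom (hk : ¬ IsAtom (h k)) {a : Fin n} (ha : IsAtom (h a)) (hak : h a ≤ h k) :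
    blowupHom h k (X a) = Polynomial.C (X a) - Polynomial.X := by
  have : a ≠ k := by rintro rfl; exact hk ha
  simp [blowupHom, ha, hak, this]

lemma blowupHom_X_of_not {i : Fin n} (hik : i ≠ k) (hi : ¬ (IsAtom (h i) ∧ h i ≤ h k)) :
    blowupHom h k (X i) = Polynomial.C (X i) := by
  simp [blowupHom, hik, hi]

lemma coeff_zero_blowupHom_X {i : Fin n} (hik : i ≠ k) :
    (blowupHom h k (X i)).coeff 0 = X i := by
  classical
  by_cases hi : IsAtom (h i) ∧ h i ≤ h k
  · simp [blowupHom, hik, hi]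
  · rw [blowupHom_X_of_not hik hi, Polynomial.coeff_C_zero]

/-- The polynomials with constant coefficient in `J` and all coefficients in `K`. -/
noncomputable def coeffIdeal {A : Type*} [CommRing A] (J K : Ideal A) : Ideal (Polynomial A) :=
  Ideal.comap Polynomial.constantCoeff J ⊓ Ideal.map Polynomial.C K

lemma mem_coeffIdeal {A : Type*} [CommRing A] {J K : Ideal A} {F : Polynomial A} :
    F ∈ coeffIdeal J K ↔ F.coeff 0 ∈ J ∧ ∀ j, F.coeff j ∈ K := by
  rw [coeffIdeal, Ideal.mem_inf, Ideal.mem_map_C_iff, Ideal.mem_comap,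
    Polynomial.constantCoeff_apply]

lemma mem_coeffIdeal_of_mem_map {A : Type*} [CommRing A] {J K : Ideal A} {F : Polynomial A}
    (h0 : F.coeff 0 ∈ J) (hF : F ∈ Ideal.map Polynomial.C K) : F ∈ coeffIdeal J K :=
  mem_coeffIdeal.2 ⟨h0, Ideal.mem_map_C_iff.1 hF⟩

lemma C_mem_coeffIdeal {A : Type*} [CommRing A] {J K : Ideal A} (hJK : J ≤ K) {x : A}
    (hx : x ∈ J) : Polynomial.C x ∈ coeffIdeal J K :=
  mem_coeffIdeal_of_mem_map (by simpa using hx) (Ideal.mem_map_of_mem _ (hJK hx))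

/-- The polynomial `∏ (y - x_a)` over the atoms with indices in `U`. -/
noncomputable def atomPoly (U : Finset (Fin n)) : Polynomial (MvPolynomial (Fin n) ℚ) :=
  ∏ a ∈ U, (Polynomial.X - Polynomial.C (X a))

lemma atomPoly_monic (U : Finset (Fin n)) : (atomPoly U).Monic :=
  Polynomial.monic_prod_of_monic _ _ fun _ _ => Polynomial.monic_X_sub_C _

lemma coeff_zero_atomPoly (U : Finset (Fin n)) :
    (atomPoly U).coeff 0 = (-1) ^ U.card * ∏ a ∈ U, X a := by
  rw [atomPoly, Polynomial.coeff_zero_prod, ← Finset.prod_const, ← Finset.prod_mul_distrib]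
  simp

/-- Makes the choice of a basis irrelevant. Modulo `K`, each `x_a` is `-c_k`, so both polynomials
become the same power of `y + c_k`; the constant coefficients agree modulo `J` by basis exchange. -/
lemma atomPoly_sub_mem (hh : IsBlowupOrder h) (hk : ¬ IsAtom (h k)) {U₀ : Finset (Fin n)}
    (hU₀ : ∀ i ∈ U₀, IsAtom (h i)) (hc₀ : U₀.card = intervalRank (supBelow h S k) (h k))
    (hs₀ : supBelow h S k ⊔ U₀.sup h = h k) {U : Finset (Fin n)}
    (hU : ∀ i ∈ U, IsAtom (h i)) (hc : U.card = intervalRank (supBelow h S k) (h k))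
    (hs : supBelow h S k ⊔ U.sup h = h k) :
    atomPoly U - atomPoly U₀ ∈ coeffIdeal (relIdeal h k S) (relIdeal h k (insert k S)) := by
  apply mem_coeffIdeal_of_mem_map
  · rw [Polynomial.coeff_sub,
      coeff_zero_atomPoly, coeff_zero_atomPoly, hc, hc₀, ← mul_sub]
    exact Ideal.mul_mem_left _ _ (prod_sub_prod_mem hh hU₀ hc₀ hs₀ U hU hc hs)
  · have key : ∀ V : Finset (Fin n), (∀ i ∈ V, IsAtom (h i)) → supBelow h S k ⊔ V.sup h = h k →
        Ideal.Quotient.mk (Ideal.map Polynomial.C (relIdeal h k (insert k S))) (atomPoly V) =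
        Ideal.Quotient.mk _ (Polynomial.X + Polynomial.C (cPoly h k)) ^ V.card := by
      intro V hV hVs
      rw [atomPoly, map_prod]
      refine (Finset.prod_congr rfl fun a ha => ?_).trans (Finset.prod_const _)
      rw [Ideal.Quotient.eq, ← neg_mem_iff]
      have h1 := X_add_cPoly_mem (S := S) hh hk (hV a ha)
        (hVs ▸ le_sup_of_le_right (Finset.le_sup ha))
      have h2 := Ideal.mem_map_of_mem Polynomial.C h1
      convert h2 using 1
      rw [map_add]
      ring
    rw [← Ideal.Quotient.eq, key U hU hs, key U₀ hU₀ hs₀, hc, hc₀]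

/-- The linear relations lose `y`, since `x_a - y` and `y` occur together. An incompatibility
already witnessed below index `k` gives an element of `coeffIdeal`. A new one, witnessed by `k`
itself, gives the monic polynomial unless it involves a variable that is zero before the blowup. -/
lemma blowupHom_mem (hh : IsBlowupOrder h) (hk : ¬ IsAtom (h k)) {U₀ : Finset (Fin n)}
    (hU₀ : ∀ i ∈ U₀, IsAtom (h i)) (hc₀ : U₀.card = intervalRank (supBelow h S k) (h k))
    (hs₀ : supBelow h S k ⊔ U₀.sup h = h k) :
    ∀ f ∈ relIdeal h (k + 1) S, blowupHom h k f ∈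
      coeffIdeal (relIdeal h k S) (relIdeal h k (insert k S)) ⊔ Ideal.span {atomPoly U₀} := by
  classical
  set J := relIdeal h k S with hJ
  set K := relIdeal h k (insert k S) with hK
  have hJK : J ≤ K := relIdeal_mono (Finset.subset_insert _ _)
  set Q := coeffIdeal J K with hQ
  suffices hle : relIdeal h (k + 1) S ≤
      Ideal.comap (blowupHom h k) (Q ⊔ Ideal.span {atomPoly U₀}) from fun f hf => hle hf
  refine relIdeal_le (fun i hi hki => ?_) (fun T hT => ?_) (fun a ha => ?_)
  · rw [Ideal.mem_comap, blowupHom_X_of_not (by rintro rfl; omega) (fun h' => hi h'.1)]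
    exact Ideal.mem_sup_left (C_mem_coeffIdeal hJK (X_mem_relIdeal hi (by omega)))
  swap
  · rw [Ideal.mem_comap]
    apply Ideal.mem_sup_left
    set F := Finset.univ.filter (fun f => h a ≤ h f) with hF
    have haF : a ∈ F := by simp [hF]
    have hak : a ≠ k := by rintro rfl; exact hk ha
    have hrest : ∀ f ∈ F, f ≠ k → f ≠ a → blowupHom h k (X f) = Polynomial.C (X f) := by
      intro f hf hfk hfa
      refine blowupHom_X_of_not hfk fun h' => hfa (hh.eq_of_atom h'.1 ?_).symm
      simpa [hF] using hf
    by_cases hle : h a ≤ h k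
    · have hkF : k ∈ F.erase a := Finset.mem_erase.2 ⟨hak.symm, by simp [hF, hle]⟩
      have e1 : cPoly h a = X a + (X k + ∑ f ∈ (F.erase a).erase k, X f) := by
        rw [Finset.add_sum_erase _ _ hkF, Finset.add_sum_erase _ _ haF, cPoly]
      have e2 : blowupHom h k (cPoly h a) = Polynomial.C (cPoly h a - X k) := by
        have e3 : ∑ f ∈ (F.erase a).erase k, blowupHom h k (X f) =
            ∑ f ∈ (F.erase a).erase k, Polynomial.C (X f) := by
          refine Finset.sum_congr rfl fun f hf => ?_
          simp only [Finset.mem_erase] at hf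
          exact hrest f hf.2.2 hf.1 hf.2.1
        rw [e1, map_add, map_add, map_sum, e3, blowupHom_X_atom hk ha hle, blowupHom_X_self]
        simp only [map_sub, map_add, map_sum]
        ring
      rw [e2]
      exact C_mem_coeffIdeal hJK (J.sub_mem (cPoly_mem_relIdeal ha) (X_mem_relIdeal hk le_rfl))
    · have e2 : blowupHom h k (cPoly h a) = Polynomial.C (cPoly h a) := by
        rw [cPoly, map_sum, map_sum]
        refine Finset.sum_congr rfl fun f hf => ?_
        have hfk : f ≠ k := by
          rintro rfl
          exact hle (Finset.mem_filter.1 hf).2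
        by_cases hfa : f = a
        · subst hfa
          exact blowupHom_X_of_not hfk fun h' => hle h'.2
        · exact hrest f hf hfk hfa
      rw [e2]
      exact C_mem_coeffIdeal hJK (cPoly_mem_relIdeal ha)
  obtain ⟨Y, hY, i, hi, hik, hYi, hiY⟩ := exists_of_not_compatible hT
  have hYlt : ∀ j ∈ Y, h j < h i := fun j hj =>
    lt_of_le_of_ne (hYi ▸ Finset.le_sup hj) fun e => hiY (hh.inj e ▸ hj)
  set T₀ := T.filter (· ∈ Y) with hT₀
  have hYS : Y ⊆ S ∪ T₀ := by
    intro j hj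
    have := hY hj
    simp only [hT₀, Finset.mem_union, Finset.mem_filter] at this ⊢
    tauto
  rw [Ideal.mem_comap, map_prod]
  suffices hsub : ∃ V ⊆ T, ∏ j ∈ V, blowupHom h k (X j) ∈ Q ⊔ Ideal.span {atomPoly U₀} by
    obtain ⟨V, hV, hVmem⟩ := hsub
    exact Ideal.mem_of_dvd _ (Finset.prod_dvd_prod_of_subset _ _ _ hV) hVmem
  have hT₀T : T₀ ⊆ T := Finset.filter_subset _ _
  have hT₀Y : ∀ j ∈ T₀, j ∈ Y := fun j hj => (Finset.mem_filter.1 hj).2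
  rcases (Nat.lt_succ_iff_lt_or_eq.1 hik) with hik' | hik'
  · refine ⟨T₀, hT₀T, Ideal.mem_sup_left (mem_coeffIdeal_of_mem_map ?_ ?_)⟩
    · rw [Polynomial.coeff_zero_prod]
      by_cases hkT : k ∈ T₀
      · rw [Finset.prod_eq_zero hkT (by rw [blowupHom_X_self, Polynomial.coeff_X_zero])]
        exact J.zero_mem
      · rw [Finset.prod_congr rfl fun j hj =>
          coeff_zero_blowupHom_X (by rintro rfl; exact hkT hj)]
        exact prod_mem_relIdeal (not_compatible_of_sup_eq hYS hi hik' hYi hiY)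
    · set T₁ := T₀.filter (fun j => ¬ h j ≤ h k) with hT₁
      suffices hmem : ∏ j ∈ T₁, X j ∈ K by
        refine Ideal.mem_of_dvd _
          (Finset.prod_dvd_prod_of_subset T₁ T₀ _ (Finset.filter_subset _ _)) ?_
        have hT₁C : ∀ j ∈ T₁, blowupHom h k (X j) = Polynomial.C (X j) := by
          intro j hj
          have hjk := (Finset.mem_filter.1 hj).2
          exact blowupHom_X_of_not (by rintro rfl; exact hjk le_rfl) fun h' => hjk h'.2
        rw [Finset.prod_congr rfl hT₁C, ← map_prod]
        exact Ideal.mem_map_of_mem _ hmem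
      by_cases hex : ∃ j ∈ T₀, h j ≤ h k
      · obtain ⟨j, hj, hjk⟩ := hex
        obtain ⟨l, hl⟩ := hh.exists_eq_sup i k hi fun h0 =>
          hh.ne_bot j (le_bot_iff.1 (h0 ▸ le_inf (hYlt j (hT₀Y j hj)).le hjk))
        have hil : h i ≤ h l := hl ▸ le_sup_left
        have hkl : h k ≤ h l := hl ▸ le_sup_right
        have hlk : l < k := (hh.ord l i hil).trans_lt hik'
        refine prod_mem_relIdeal (not_compatible_of_sup_eq
          (Y := insert k (Y.filter (fun j => ¬ h j ≤ h k))) (i := l) ?_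
          (hh.not_isAtom_of_le hi hil) hlk ?_ ?_)
        · intro x hx
          simp only [Finset.mem_insert, Finset.mem_filter, Finset.mem_union, hT₁] at hx ⊢
          rcases hx with rfl | ⟨hx, hxk⟩
          · simp
          · have := hYS hx
            simp only [Finset.mem_union] at this
            tauto
        · rw [Finset.sup_insert, hl, ← hYi]
          apply le_antisymm
          · exact sup_le le_sup_right (le_sup_of_le_left
              (Finset.sup_mono (Finset.filter_subset _ _)))
          · refine sup_le (Finset.sup_le fun x hx => ?_) le_sup_left
            by_cases hxk : h x ≤ h k
            · exact le_sup_of_le_left hxk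
            · exact le_sup_of_le_right
                (Finset.le_sup (f := h) (Finset.mem_filter.2 ⟨hx, hxk⟩))
        · rw [Finset.mem_insert, Finset.mem_filter]
          rintro (rfl | ⟨h1, -⟩)
          · exact lt_irrefl _ hlk
          · exact (hYlt l h1).not_ge hil
      · push Not at hex
        have : T₁ = T₀ := Finset.filter_true_of_mem fun j hj => hex j hj
        rw [this]
        exact hJK (prod_mem_relIdeal (not_compatible_of_sup_eq hYS hi hik' hYi hiY))
  · obtain rfl : i = k := Fin.ext hik'
    by_cases hin : ∃ j ∈ T₀, ¬ IsAtom (h j)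
    · obtain ⟨j, hj, hjat⟩ := hin
      -- Elements strictly below `h i` have larger index, so a non-atom among them has not been
      -- blown up and its variable is a relation.
      have hij := hh.lt_of_lt (hYlt j (hT₀Y j hj))
      refine ⟨{j}, by simpa using hT₀T hj, ?_⟩
      rw [Finset.prod_singleton, blowupHom_X_of_not hij.ne' fun h' => hjat h'.1]
      exact Ideal.mem_sup_left (C_mem_coeffIdeal hJK (X_mem_relIdeal hjat hij.le))
    push Not at hin
    have hT₀i : ∀ j ∈ T₀, h j ≤ h i := fun j hj => (hYlt j (hT₀Y j hj)).le
    have hsup : supBelow h S i ⊔ T₀.sup h = h i := by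
      apply le_antisymm (sup_le supBelow_le (Finset.sup_le hT₀i))
      nth_rw 1 [← hYi]
      refine Finset.sup_le fun j hj => ?_
      rcases Finset.mem_union.1 (hYS hj) with h1 | h1
      · exact le_sup_of_le_left
          (Finset.le_sup (f := h) (Finset.mem_filter.2 ⟨h1, hYlt j hj⟩))
      · exact le_sup_of_le_right (Finset.le_sup h1)
    obtain ⟨U, hUT, hc, hs⟩ := exists_subset_card_eq_intervalRank hin hsup
    have hU := fun j hj => hin j (hUT hj)
    refine ⟨U, hUT.trans hT₀T, ?_⟩
    have hprod : ∏ j ∈ U, blowupHom h i (X j) = (-1) ^ U.card * atomPoly U := by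
      rw [atomPoly, ← Finset.prod_const, ← Finset.prod_mul_distrib]
      refine Finset.prod_congr rfl fun j hj => ?_
      rw [blowupHom_X_atom hk (hU j hj) (hT₀i j (hUT hj))]
      ring
    rw [hprod, ← sub_add_cancel (atomPoly U) (atomPoly U₀)]
    exact Ideal.mul_mem_left _ _ (Ideal.add_mem _
      (Ideal.mem_sup_left (atomPoly_sub_mem hh hk hU₀ hc₀ hs₀ hU hc hs))
      (Ideal.mem_sup_right (Ideal.mem_span_singleton_self _)))

end Step

end LerayModel

namespace LerayModel

universe u

set_option linter.unusedSectionVars false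

open MvPolynomial

/-! ### Independence of the standard monomials in the even variables -/

section Standard

variable {L : Type u} [Lattice L] [BoundedOrder L] {n : ℕ} {h : Fin n → L}

/-- The exponents of the standard monomials modulo `relIdeal h k S`. -/
structure IsStandardExponent (h : Fin n → L) (k : ℕ) (S : Finset (Fin n)) (b : Fin n →₀ ℕ) :
    Prop where
  not_isAtom : ∀ i ∈ b.support, ¬ IsAtom (h i)
  lt : ∀ i ∈ b.support, (i : ℕ) < k
  compatible : Compatible h k (S ∪ b.support)
  lt_rank : ∀ i ∈ b.support, b i < intervalRank (supBelow h (S ∪ b.support) i) (h i)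

variable [Finite L] [IsUpperModularLattice L]

lemma blowupHom_monomial {k : Fin n} {b : Fin n →₀ ℕ} (hb : ∀ i ∈ b.support, ¬ IsAtom (h i))
    (c : ℚ) : blowupHom h k (monomial b c) =
      Polynomial.C (monomial (b.erase k) c) * Polynomial.X ^ b k := by
  have h1 : monomial b c = monomial (b.erase k) c * X k ^ b k := by
    rw [X_pow_eq_monomial, monomial_mul, mul_one, Finsupp.erase_add_single]
  have h2 : blowupHom h k (monomial (b.erase k) c) = Polynomial.C (monomial (b.erase k) c) := by
    rw [monomial_eq, map_mul, map_mul, Finsupp.prod, map_prod, map_prod]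
    congr 1
    · exact (blowupHom h k).commutes c
    · refine Finset.prod_congr rfl fun i hi => ?_
      rw [Finsupp.support_erase, Finset.mem_erase] at hi
      rw [map_pow, map_pow, blowupHom_X_of_not hi.1 fun h' => hb i hi.2 h'.1]
  rw [h1, map_mul, map_pow, h2, blowupHom_X_self]

lemma coeff_blowupHom {k : Fin n} {f : MvPolynomial (Fin n) ℚ}
    (hf : ∀ b ∈ f.support, ∀ i ∈ b.support, ¬ IsAtom (h i)) (j : ℕ) :
    (blowupHom h k f).coeff j =
      ∑ b ∈ f.support, if j = b k then monomial (b.erase k) (f.coeff b) else 0 := by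
  conv_lhs => rw [f.as_sum]
  rw [map_sum, Polynomial.finsetSum_coeff]
  refine Finset.sum_congr rfl fun b hb => ?_
  rw [blowupHom_monomial (hf b hb), Polynomial.coeff_C_mul_X_pow]

lemma coeff_coeff_blowupHom {k : Fin n} {f : MvPolynomial (Fin n) ℚ}
    (hf : ∀ b ∈ f.support, ∀ i ∈ b.support, ¬ IsAtom (h i)) {b : Fin n →₀ ℕ}
    (hb : b ∈ f.support) :
    coeff (b.erase k) ((blowupHom h k f).coeff (b k)) = coeff b f := by
  rw [coeff_blowupHom hf, coeff_sum, Finset.sum_eq_single b]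
  · rw [if_pos rfl, coeff_monomial, if_pos rfl]
  · intro b' _ hne
    split_ifs with hk
    · rw [coeff_monomial, if_neg]
      intro he
      exact hne (by rw [← Finsupp.erase_add_single k b', he, ← hk, Finsupp.erase_add_single])
    · exact coeff_zero _
  · exact fun h' => absurd hb h'

lemma exists_of_mem_support_coeff_blowupHom {k : Fin n} {f : MvPolynomial (Fin n) ℚ}
    (hf : ∀ b ∈ f.support, ∀ i ∈ b.support, ¬ IsAtom (h i)) {j : ℕ} {b' : Fin n →₀ ℕ}
    (hb' : b' ∈ ((blowupHom h k f).coeff j).support) :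
    ∃ b ∈ f.support, b k = j ∧ b.erase k = b' := by
  rw [mem_support_iff, coeff_blowupHom hf, coeff_sum] at hb'
  obtain ⟨b, hb, hne⟩ := Finset.exists_ne_zero_of_sum_ne_zero hb'
  split_ifs at hne with hj
  · rw [coeff_monomial] at hne
    split_ifs at hne with he
    · exact ⟨b, hb, hj.symm, he⟩
    · exact absurd rfl hne
  · exact absurd (coeff_zero _) hne

variable [IsAtomistic L]

lemma exists_atoms_sup_eq (hh : IsBlowupOrder h) {y : L} {k : Fin n} (hy : y ≤ h k) :
    ∃ U : Finset (Fin n), (∀ i ∈ U, IsAtom (h i)) ∧ U.card = intervalRank y (h k) ∧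
      y ⊔ U.sup h = h k := by
  classical
  have hT : ∀ i ∈ Finset.univ.filter (fun i => IsAtom (h i) ∧ h i ≤ h k), IsAtom (h i) :=
    fun i hi => (Finset.mem_filter.1 hi).2.1
  obtain ⟨U, hU, hc, hs⟩ := exists_subset_card_eq_intervalRank hT (y := y) (p := h k) (by
    apply le_antisymm
    · exact sup_le hy (Finset.sup_le fun i hi => (Finset.mem_filter.1 hi).2.2)
    · rw [le_iff_atom_le_imp]
      intro a ha hak
      obtain ⟨i, rfl⟩ := hh.exists_eq_atom a ha
      exact le_sup_of_le_right (Finset.le_sup (f := h) (by simp [ha, hak])))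
  exact ⟨U, fun i hi => hT i (hU hi), hc, hs⟩

/-- The standard monomials are linearly independent modulo `relIdeal h k S`. -/
lemma eq_zero_of_mem_relIdeal (hh : IsBlowupOrder h) (k : ℕ) (hk : k ≤ n) :
    ∀ (S : Finset (Fin n)) (f : MvPolynomial (Fin n) ℚ),
      (∀ b ∈ f.support, IsStandardExponent h k S b) → f ∈ relIdeal h k S → f = 0 := by
  classical
  induction k with
  | zero =>
    intro S f hf hfI
    have h1 : f = C (f.coeff 0) := by
      ext b
      rw [coeff_C]
      split_ifs with hb
      · rw [hb]
      · by_contra hne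
        refine hb (Eq.symm ?_)
        rw [← Finsupp.support_eq_empty, Finset.eq_empty_iff_forall_notMem]
        exact fun i hi => absurd ((hf b (mem_support_iff.2 hne)).lt i hi) (Nat.not_lt_zero _)
    have h2 : relIdeal h 0 S ≤ RingHom.ker (constantCoeff (R := ℚ) (σ := Fin n)) := by
      refine relIdeal_le (fun i _ _ => ?_) (fun T hT => ?_) (fun a _ => ?_)
      · simp [RingHom.mem_ker]
      · exact absurd (fun _ _ _ _ h0 => absurd h0 (Nat.not_lt_zero _)) hT
      · simp [RingHom.mem_ker, cPoly]
    have h3 := h2 hfI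
    rw [RingHom.mem_ker, constantCoeff_eq] at h3
    rw [h1, h3, C_0]
  | succ k ih =>
    intro S f hf hfI
    replace ih := ih (by omega)
    set p : Fin n := ⟨k, hk⟩ with hp
    by_cases hat : IsAtom (h p)
    · have hcomp : ∀ T, Compatible h k T → Compatible h (k + 1) T := by
        intro T hT Y hY i hi hik hYi
        refine hT Y hY i hi (lt_of_le_of_ne (Nat.lt_succ_iff.1 hik) fun e => hi ?_) hYi
        rwa [show i = p from Fin.ext e]
      refine ih S f (fun b hb => ?_) (relIdeal_le (fun i hi hki => ?_) (fun T hT => ?_)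
        (fun a ha => cPoly_mem_relIdeal ha) hfI)
      · have := hf b hb
        refine ⟨this.not_isAtom, fun i hi => lt_of_le_of_ne (Nat.lt_succ_iff.1 (this.lt i hi))
          fun e => this.not_isAtom i hi ?_, this.compatible.mono_left (Nat.le_succ k),
          this.lt_rank⟩
        rwa [show i = p from Fin.ext e]
      · exact X_mem_relIdeal hi (by omega)
      · exact prod_mem_relIdeal fun hT' => hT (hcomp _ hT')
    have hf' : ∀ b ∈ f.support, ∀ i ∈ b.support, ¬ IsAtom (h i) := fun b hb =>
      (hf b hb).not_isAtom
    obtain ⟨U, hU, hc, hs⟩ := exists_atoms_sup_eq hh (supBelow_le (h := h) (S := S) (k := p))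
    have hmem := blowupHom_mem (k := p) hh hat hU hc hs f hfI
    obtain ⟨Q, hQ, q', hq', hFQ⟩ := Submodule.mem_sup.1 hmem
    obtain ⟨q, rfl⟩ := Ideal.mem_span_singleton'.1 hq'
    rw [mem_coeffIdeal] at hQ
    -- The support of `b` has indices at most `k`, whereas elements strictly below `h p` have larger
    -- index. Hence the degree bound at `p` depends on `S` alone.
    have hunion : ∀ b ∈ f.support,
        S.filter (fun i => h i < h p) = (S ∪ b.support).filter (fun i => h i < h p) := by
      intro b hb
      rw [Finset.filter_union, Finset.filter_false_of_mem (s := b.support), Finset.union_empty]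
      intro i hi hip
      have h1 := hh.lt_of_lt hip
      have h2 := (hf b hb).lt i hi
      have h3 : k < (i : ℕ) := h1
      omega
    have hdeg : ∀ b ∈ f.support, b p < U.card := by
      intro b hb
      have hS := (hf b hb)
      have hbelow : supBelow h S p = supBelow h (S ∪ b.support) p := by
        unfold supBelow
        rw [hunion b hb]
      by_cases hpb : p ∈ b.support
      · rw [hc, hbelow]
        exact hS.lt_rank p hpb
      · rw [Finsupp.notMem_support_iff.1 hpb, hc]
        -- Even for exponent 0 the degree must be positive: compatibility excludes that elements of
        -- `S` strictly below `h p` have join `h p`.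
        refine intervalRank_pos (lt_of_le_of_ne supBelow_le fun he => ?_)
        have := hS.compatible (S.filter (fun i => h i < h p))
          ((Finset.filter_subset _ _).trans Finset.subset_union_left) p hat (Nat.lt_succ_self k) he
        exact lt_irrefl _ (Finset.mem_filter.1 this).2
    have hdegF : (blowupHom h p f).degree < (atomPoly U).degree := by
      have h1 : (atomPoly U).degree = U.card := by
        rw [atomPoly, Polynomial.degree_prod]
        simp
      rw [h1, Polynomial.degree_lt_iff_coeff_zero]
      intro m hm
      rw [coeff_blowupHom hf']
      refine Finset.sum_eq_zero fun b hb => if_neg fun e => ?_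
      have := hdeg b hb
      omega
    have hcoef := coeff_mem_of_eq_add_mul_monic hFQ.symm (atomPoly_monic U) hdegF hQ.1 hQ.2
      (fun x hx => by
        rw [coeff_zero_atomPoly, mul_left_comm]
        exact Ideal.mul_mem_left _ _ (mul_prod_mem hU hs x hx))
    -- The constant coefficient keeps `S`, while for a positive power of `y` the element `p` moves
    -- from the support to `S`. The union, and with it every rank bound, is unchanged.
    have hstd : ∀ b ∈ f.support, ∀ T, T ∪ (b.erase p).support = S ∪ b.support →
        IsStandardExponent h k T (b.erase p) := by
      intro b hb T hT
      have hS := hf b hb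
      have hsupp : ∀ i ∈ (b.erase p).support, i ≠ p ∧ i ∈ b.support := by
        intro i hi
        rwa [Finsupp.support_erase, Finset.mem_erase] at hi
      refine ⟨fun i hi => hS.not_isAtom i (hsupp i hi).2, fun i hi => ?_, ?_, fun i hi => ?_⟩
      · exact lt_of_le_of_ne (Nat.lt_succ_iff.1 (hS.lt i (hsupp i hi).2))
          fun e => (hsupp i hi).1 (Fin.ext e)
      · rw [hT]
        exact hS.compatible.mono_left (Nat.le_succ k)
      · rw [hT, Finsupp.erase_ne (hsupp i hi).1]
        exact hS.lt_rank i (hsupp i hi).2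
    have hzero : ∀ j, (blowupHom h p f).coeff j = 0 := by
      intro j
      rcases Nat.eq_zero_or_pos j with rfl | hj
      · refine ih S _ (fun b' hb' => ?_) hcoef.1
        obtain ⟨b, hb, hbp, rfl⟩ := exists_of_mem_support_coeff_blowupHom hf' hb'
        refine hstd b hb S ?_
        rw [Finsupp.support_erase, Finset.erase_eq_of_notMem]
        exact Finsupp.notMem_support_iff.2 hbp
      · refine ih (insert p S) _ (fun b' hb' => ?_) (hcoef.2 j)
        obtain ⟨b, hb, hbp, rfl⟩ := exists_of_mem_support_coeff_blowupHom hf' hb'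
        have hpb : p ∈ b.support := Finsupp.mem_support_iff.2 (by omega)
        refine hstd b hb _ ?_
        rw [Finsupp.support_erase, Finset.insert_union, ← Finset.union_insert,
          Finset.insert_erase hpb]
    ext b
    by_cases hb : b ∈ f.support
    · rw [← coeff_coeff_blowupHom hf' (k := p) hb, hzero, coeff_zero, coeff_zero]
    · rw [notMem_support_iff.1 hb, coeff_zero]

end Standard

end LerayModel

namespace LerayModel

universe u

set_option linter.unusedSectionVars false

/-! ### Products and span of monomials in `R(H)` -/

section Monomials

variable {n : ℕ}

lemma eVar_mul_self (i : Fin n) : eVar i * eVar i = 0 := ExteriorAlgebra.ι_sq_zero _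

lemma eVar_mul_eVar (i j : Fin n) : eVar i * eVar j = -(eVar j * eVar i) :=
  eq_neg_of_add_eq_zero_left (ExteriorAlgebra.ι_add_mul_swap _ _)

lemma prod_map_eVar_perm {l l' : List (Fin n)} (hl : l.Perm l') :
    ∃ ε : ℚ, ε ≠ 0 ∧ (l.map eVar).prod = ε • (l'.map eVar).prod := by
  induction hl with
  | nil => exact ⟨1, one_ne_zero, by simp⟩
  | cons x _ ih =>
    obtain ⟨ε, hε, h⟩ := ih
    exact ⟨ε, hε, by rw [List.map_cons, List.prod_cons, h, List.map_cons, List.prod_cons,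
      mul_smul_comm]⟩
  | swap x y l =>
    refine ⟨-1, by norm_num, ?_⟩
    simp only [List.map_cons, List.prod_cons]
    rw [← mul_assoc, eVar_mul_eVar, ← mul_assoc, neg_mul, neg_smul, one_smul]
  | trans _ _ ih1 ih2 =>
    obtain ⟨ε, hε, h⟩ := ih1
    obtain ⟨ε', hε', h'⟩ := ih2
    exact ⟨ε * ε', mul_ne_zero hε hε', by rw [h, h', smul_smul]⟩

lemma exists_eProd_eq {l : List (Fin n)} (hl : l.Nodup) :
    ∃ ε : ℚ, ε ≠ 0 ∧ (l.map eVar).prod = ε • eProd l.toFinset := by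
  refine prod_map_eVar_perm ?_
  rw [List.perm_ext_iff_of_nodup hl (Finset.sort_nodup _ _)]
  intro a
  simp

lemma exists_eProd_mul_eProd {S T : Finset (Fin n)} (hST : Disjoint S T) :
    ∃ ε : ℚ, ε ≠ 0 ∧ eProd S * eProd T = ε • eProd (S ∪ T) := by
  have hnd : (S.sort ++ T.sort).Nodup := by
    rw [List.nodup_append']
    refine ⟨Finset.sort_nodup _ _, Finset.sort_nodup _ _, fun a ha hb => ?_⟩
    exact Finset.disjoint_left.1 hST ((Finset.mem_sort _).1 ha) ((Finset.mem_sort _).1 hb)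
  obtain ⟨ε, hε, h⟩ := exists_eProd_eq hnd
  refine ⟨ε, hε, ?_⟩
  rw [List.map_append, List.prod_append] at h
  rw [eProd, eProd, h]
  congr 2
  ext a
  simp

lemma eProd_singleton (i : Fin n) : eProd {i} = eVar i := by
  simp [eProd]

lemma eProd_empty : eProd (∅ : Finset (Fin n)) = 1 := by
  simp [eProd]

lemma eProd_insert_of_lt {a : Fin n} {S : Finset (Fin n)} (ha : ∀ i ∈ S, a < i) :
    eProd (insert a S) = eVar a * eProd S := by
  have haS : a ∉ S := fun h => lt_irrefl _ (ha a h)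
  rw [eProd, Finset.sort_insert _ (fun b hb => (ha b hb).le) haS, List.map_cons, List.prod_cons,
    eProd]

lemma eProd_mul_eProd_eq_zero {S T : Finset (Fin n)} (hST : ¬ Disjoint S T) :
    eProd S * eProd T = 0 := by
  rw [Finset.not_disjoint_iff] at hST
  obtain ⟨a, haS, haT⟩ := hST
  have hS : Disjoint (S.erase a) {a} := by simp
  have hT : Disjoint {a} (T.erase a) := by simp
  obtain ⟨ε, hε, h1⟩ := exists_eProd_mul_eProd hS
  obtain ⟨ε', hε', h2⟩ := exists_eProd_mul_eProd hT
  have e1 : S.erase a ∪ {a} = S := by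
    rw [Finset.union_comm, ← Finset.insert_eq, Finset.insert_erase haS]
  have e2 : {a} ∪ T.erase a = T := by
    rw [← Finset.insert_eq, Finset.insert_erase haT]
  rw [e1, eProd_singleton] at h1
  rw [e2, eProd_singleton] at h2
  have h3 : (ε * ε') • (eProd S * eProd T) = 0 := by
    rw [← smul_mul_smul_comm, ← h1, ← h2, mul_assoc, ← mul_assoc (eVar a), eVar_mul_self,
      zero_mul, mul_zero]
  exact (smul_eq_zero.1 h3).resolve_left (mul_ne_zero hε hε')

/-- The exponents of the product of monomials. -/
noncomputable def expoMul (m m' : Expo n) : Expo n := (m.1 ∪ m'.1, m.2 + m'.2)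

lemma mono_mul_mono_eq (m m' : Expo n) :
    mono m * mono m' = eProd m.1 * eProd m'.1 * xPow (m.2 + m'.2) := by
  have : (xPow (m.2 + m'.2) : R n) = xPow m.2 * xPow m'.2 := by
    rw [xPow, xPow, xPow, ← map_mul, MvPolynomial.monomial_mul, mul_one]
  rw [mono, mono, this, mul_assoc, ← mul_assoc (xPow m.2)]
  have h2 : xPow m.2 * eProd m'.1 = eProd m'.1 * xPow m.2 := Algebra.commutes _ _
  rw [h2]
  simp only [mul_assoc]

lemma exists_mono_mul_mono {m m' : Expo n} (h : Disjoint m.1 m'.1) :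
    ∃ ε : ℚ, ε ≠ 0 ∧ mono m * mono m' = ε • mono (expoMul m m') := by
  obtain ⟨ε, hε, h1⟩ := exists_eProd_mul_eProd h
  exact ⟨ε, hε, by rw [mono_mul_mono_eq, h1, smul_mul_assoc]; rfl⟩

lemma mono_mul_mono_eq_zero {m m' : Expo n} (h : ¬ Disjoint m.1 m'.1) :
    mono m * mono m' = 0 := by
  rw [mono_mul_mono_eq, eProd_mul_eProd_eq_zero h, zero_mul]

lemma mul_mem_span_mono {A B : Set (Expo n)} {r r' : R n}
    (hr : r ∈ Submodule.span ℚ (mono '' A)) (hr' : r' ∈ Submodule.span ℚ (mono '' B)) :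
    r * r' ∈ Submodule.span ℚ
      (mono '' {m | ∃ a ∈ A, ∃ b ∈ B, Disjoint a.1 b.1 ∧ m = expoMul a b}) := by
  have h1 := Submodule.mul_mem_mul hr hr'
  rw [Submodule.span_mul_span] at h1
  refine Submodule.span_le.2 ?_ h1
  rintro _ ⟨_, ⟨a, ha, rfl⟩, _, ⟨b, hb, rfl⟩, rfl⟩
  change mono a * mono b ∈ _
  by_cases hd : Disjoint a.1 b.1
  · obtain ⟨ε, -, h⟩ := exists_mono_mul_mono hd
    rw [h]
    exact Submodule.smul_mem _ _ (Submodule.subset_span ⟨_, ⟨a, ha, b, hb, hd, rfl⟩, rfl⟩)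
  · rw [mono_mul_mono_eq_zero hd]
    exact Submodule.zero_mem _

lemma algebraMap_eq_sum (p : MvPolynomial (Fin n) ℚ) :
    algebraMap (MvPolynomial (Fin n) ℚ) (R n) p =
      ∑ b ∈ p.support, p.coeff b • xPow b := by
  conv_lhs => rw [p.as_sum]
  rw [map_sum]
  refine Finset.sum_congr rfl fun b _ => ?_
  rw [xPow, Algebra.algebraMap_eq_smul_one (A := R n), Algebra.algebraMap_eq_smul_one (A := R n),
    ← smul_assoc, MvPolynomial.smul_monomial, smul_eq_mul, mul_one]

lemma mono_empty (b : Fin n →₀ ℕ) : mono (∅, b) = xPow b := by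
  rw [mono, eProd_empty, one_mul]

lemma mono_zero (S : Finset (Fin n)) : mono (S, 0) = eProd S := by
  rw [mono, xPow]
  simp

lemma span_range_mono : Submodule.span ℚ (Set.range (mono (n := n))) = ⊤ := by
  have hmul : ∀ x ∈ Submodule.span ℚ (Set.range (mono (n := n))),
      ∀ y ∈ Submodule.span ℚ (Set.range (mono (n := n))),
      x * y ∈ Submodule.span ℚ (Set.range (mono (n := n))) := by
    intro x hx y hy
    rw [← Set.image_univ] at hx hy
    refine Submodule.span_mono ?_ (mul_mem_span_mono hx hy)
    rintro _ ⟨m, -, rfl⟩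
    exact ⟨m, rfl⟩
  have halg : ∀ p, algebraMap (MvPolynomial (Fin n) ℚ) (R n) p ∈
      Submodule.span ℚ (Set.range (mono (n := n))) := by
    intro p
    rw [algebraMap_eq_sum]
    exact Submodule.sum_mem _ fun b _ => Submodule.smul_mem _ _
      (Submodule.subset_span ⟨(∅, b), mono_empty b⟩)
  rw [eq_top_iff]
  rintro x -
  induction x using ExteriorAlgebra.induction with
  | algebraMap p => exact halg p
  | ι v =>
    have : v = ∑ i, v i • Pi.single i (1 : MvPolynomial (Fin n) ℚ) := by
      ext1 j
      simp [Finset.sum_apply, Pi.single_apply]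
    rw [this, map_sum]
    refine Submodule.sum_mem _ fun i _ => ?_
    rw [map_smul, Algebra.smul_def]
    refine hmul _ (halg _) _ (Submodule.subset_span ⟨({i}, 0), ?_⟩)
    rw [mono_zero, eProd_singleton]
    rfl
  | mul x y hx hy => exact hmul x hx y hy
  | add x y hx hy => exact Submodule.add_mem _ hx hy

end Monomials

/-! ### A criterion for Gröbner bases -/

section Groebner

variable {n : ℕ}

/-- `φ` embeds the exponents into a well-ordered monoid, compatibly with products. -/
structure IsExpoOrder {M : Type*} [AddCommMonoid M] [LinearOrder M] (φ : Expo n → M) : Prop where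
  inj : Function.Injective φ
  map_mul : ∀ m m' : Expo n, Disjoint m.1 m'.1 → φ (expoMul m m') = φ m + φ m'

variable {M : Type*} [AddCommMonoid M] [LinearOrder M] [IsOrderedCancelAddMonoid M]
  [WellFoundedLT M] {φ : Expo n → M}

/-- The order on exponents that is induced by `φ`. -/
abbrev ltOf (φ : Expo n → M) (m m' : Expo n) : Prop := φ m < φ m'

lemma isInitial_mono (lt : Expo n → Expo n → Prop) (m : Expo n) : IsInitial lt (mono m) m :=
  ⟨1, one_ne_zero, by rw [one_smul, sub_self]; exact Submodule.zero_mem _⟩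

lemma IsInitial.mul (hφ : IsExpoOrder φ) {f f' : R n} {m m' : Expo n}
    (hf : IsInitial (ltOf φ) f m) (hf' : IsInitial (ltOf φ) f' m') (hd : Disjoint m.1 m'.1) :
    IsInitial (ltOf φ) (f * f') (expoMul m m') := by
  obtain ⟨c, hc, hr⟩ := hf
  obtain ⟨c', hc', hr'⟩ := hf'
  obtain ⟨ε, hε, h⟩ := exists_mono_mul_mono hd
  refine ⟨c * c' * ε, mul_ne_zero (mul_ne_zero hc hc') hε, ?_⟩
  set r := f - c • mono m
  set r' := f' - c' • mono m'
  have e : f * f' - (c * c' * ε) • mono (expoMul m m') =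
      (c • mono m) * r' + r * (c' • mono m') + r * r' := by
    rw [mul_smul, ← h, ← smul_mul_smul_comm]
    simp only [r, r']
    noncomm_ring
  have hm : c • mono m ∈ Submodule.span ℚ (mono '' {m}) :=
    Submodule.smul_mem _ _ (Submodule.subset_span ⟨m, rfl, rfl⟩)
  have hm' : c' • mono m' ∈ Submodule.span ℚ (mono '' {m'}) :=
    Submodule.smul_mem _ _ (Submodule.subset_span ⟨m', rfl, rfl⟩)
  rw [e]
  refine Submodule.add_mem _ (Submodule.add_mem _ ?_ ?_) ?_
  · refine Submodule.span_mono (Set.image_mono ?_) (mul_mem_span_mono hm hr')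
    rintro _ ⟨a, rfl, b, hb, hab, rfl⟩
    change φ _ < φ _
    rw [hφ.map_mul _ _ hab, hφ.map_mul _ _ hd]
    exact add_lt_add_of_le_of_lt le_rfl hb
  · refine Submodule.span_mono (Set.image_mono ?_) (mul_mem_span_mono hr hm')
    rintro _ ⟨a, ha, b, rfl, hab, rfl⟩
    change φ _ < φ _
    rw [hφ.map_mul _ _ hab, hφ.map_mul _ _ hd]
    exact add_lt_add_of_lt_of_le ha le_rfl
  · refine Submodule.span_mono (Set.image_mono ?_) (mul_mem_span_mono hr hr')
    rintro _ ⟨a, ha, b, hb, hab, rfl⟩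
    change φ _ < φ _
    rw [hφ.map_mul _ _ hab, hφ.map_mul _ _ hd]
    exact add_lt_add ha hb

/-- The subspace underlying a two-sided ideal. -/
noncomputable def idealSubmodule (I : TwoSidedIdeal (R n)) : Submodule ℚ (R n) :=
  (TwoSidedIdeal.asIdeal I).restrictScalars ℚ

lemma mem_idealSubmodule {I : TwoSidedIdeal (R n)} {f : R n} : f ∈ idealSubmodule I ↔ f ∈ I :=
  TwoSidedIdeal.mem_asIdeal

lemma exists_expoMul_eq {m' m : Expo n} (h : ExpoDvd m' m) :
    ∃ k : Expo n, Disjoint k.1 m'.1 ∧ expoMul k m' = m :=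
  ⟨(m.1 \ m'.1, m.2 - m'.2), Finset.sdiff_disjoint,
    Prod.ext (Finset.sdiff_union_of_subset h.1) (tsub_add_cancel_of_le h.2)⟩

variable {I : TwoSidedIdeal (R n)} {B : Set (R n)} {P : Expo n → Prop}

/-- Reduction: a multiple of a suitable element of `B` has initial monomial `m`, so `m` is congruent
to a combination of smaller monomials. Keeping the bound by `φ m` is what allows leading terms to be
compared later. -/
lemma mono_mem_sup_span (hφ : IsExpoOrder φ) (hB : ∀ g ∈ B, g ∈ I)
    (hP : ∀ m, ¬ P m → ∃ g ∈ B, ∃ m', IsInitial (ltOf φ) g m' ∧ ExpoDvd m' m) (m : Expo n) :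
    mono m ∈ idealSubmodule I ⊔ Submodule.span ℚ (mono '' {m' | P m' ∧ φ m' ≤ φ m}) := by
  induction hm : φ m using WellFoundedLT.induction generalizing m with
  | ind x ih =>
    subst hm
    by_cases hPm : P m
    · exact Submodule.mem_sup_right (Submodule.subset_span ⟨m, ⟨hPm, le_rfl⟩, rfl⟩)
    obtain ⟨g, hg, m', hgm, hdvd⟩ := hP m hPm
    obtain ⟨k, hk, hkm⟩ := exists_expoMul_eq hdvd
    obtain ⟨c, hc, hr⟩ := (isInitial_mono _ k).mul hφ hgm hk
    rw [hkm] at hr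
    set W := idealSubmodule I ⊔ Submodule.span ℚ (mono '' {m' | P m' ∧ φ m' ≤ φ m})
    have h1 : mono k * g ∈ W :=
      Submodule.mem_sup_left (mem_idealSubmodule.2 (I.mul_mem_left _ _ (hB g hg)))
    have h2 : mono k * g - c • mono m ∈ W := by
      refine Submodule.span_le.2 ?_ hr
      rintro _ ⟨m₁, hm₁, rfl⟩
      have hle : idealSubmodule I ⊔ Submodule.span ℚ (mono '' {m' | P m' ∧ φ m' ≤ φ m₁}) ≤ W :=
        sup_le_sup le_rfl (Submodule.span_mono (Set.image_mono
          fun m₂ hm₂ => ⟨hm₂.1, hm₂.2.trans (le_of_lt hm₁)⟩))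
      exact hle (ih _ hm₁ m₁ rfl)
    have h3 : c • mono m ∈ W := by
      have := W.sub_mem h1 h2
      rwa [sub_sub_cancel] at this
    have := W.smul_mem c⁻¹ h3
    rwa [smul_smul, inv_mul_cancel₀ hc, one_smul] at this

/-- If the initial monomial of an element of `I` satisfied `P`, reducing the lower terms would give
a relation between monomials with `P` in which that monomial keeps its nonzero coefficient. -/
lemma isGroebnerBasis_of_linearIndependent (hφ : IsExpoOrder φ) (hB : ∀ g ∈ B, g ∈ I)
    (hP : ∀ m, ¬ P m → ∃ g ∈ B, ∃ m', IsInitial (ltOf φ) g m' ∧ ExpoDvd m' m)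
    (hI : ∀ l : Expo n →₀ ℚ, (∀ m ∈ l.support, P m) →
      Finsupp.linearCombination ℚ mono l ∈ I → l = 0) :
    IsGroebnerBasis (ltOf φ) B I := by
  refine ⟨hB, fun f hf hf0 => ?_⟩
  have hspan : f ∈ Submodule.span ℚ (Set.range (mono (n := n))) := by
    rw [span_range_mono]; trivial
  obtain ⟨l, hl⟩ := (Finsupp.mem_span_range_iff_exists_finsupp).1 hspan
  have hl0 : l.support.Nonempty := by
    rw [Finsupp.support_nonempty_iff]
    rintro rfl
    exact hf0 (by rw [← hl, Finsupp.sum_zero_index])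
  obtain ⟨m, hm, hmax⟩ := l.support.exists_max_image φ hl0
  have hlm := Finsupp.mem_support_iff.1 hm
  have hr : f - l m • mono m ∈ Submodule.span ℚ (mono '' {m' | φ m' < φ m}) := by
    have : f - l m • mono m = ∑ m' ∈ l.support.erase m, l m' • mono m' := by
      rw [← hl, Finsupp.sum, ← Finset.add_sum_erase _ _ hm, add_sub_cancel_left]
    rw [this]
    refine Submodule.sum_mem _ fun m' hm' => Submodule.smul_mem _ _
      (Submodule.subset_span ⟨m', ?_, rfl⟩)
    rw [Finset.mem_erase] at hm'
    exact lt_of_le_of_ne (hmax m' hm'.2) fun e => hm'.1 (hφ.inj e)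
  have hinit : IsInitial (ltOf φ) f m := ⟨l m, hlm, hr⟩
  by_cases hPm : P m
  swap
  · obtain ⟨g, hg, m', h1, h2⟩ := hP m hPm
    exact ⟨m, hinit, g, hg, m', h1, h2⟩
  exfalso
  have hr' : f - l m • mono m ∈ idealSubmodule I ⊔
      Submodule.span ℚ (mono '' {m' | P m' ∧ φ m' < φ m}) := by
    refine Submodule.span_le.2 ?_ hr
    rintro _ ⟨m₁, hm₁, rfl⟩
    have hle : idealSubmodule I ⊔ Submodule.span ℚ (mono '' {m' | P m' ∧ φ m' ≤ φ m₁}) ≤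
        idealSubmodule I ⊔ Submodule.span ℚ (mono '' {m' | P m' ∧ φ m' < φ m}) :=
      sup_le_sup le_rfl (Submodule.span_mono (Set.image_mono
        fun m₂ hm₂ => ⟨hm₂.1, hm₂.2.trans_lt hm₁⟩))
    exact hle (mono_mem_sup_span hφ hB hP m₁)
  obtain ⟨i, hi, s, hs, his⟩ := Submodule.mem_sup.1 hr'
  obtain ⟨l', hl', hls⟩ := (Finsupp.mem_span_image_iff_linearCombination ℚ).1 hs
  rw [Finsupp.mem_supported] at hl'
  -- The reduced tail contains only monomials strictly smaller than `m`, so it cannot cancel the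
  -- leading term.
  have hl'm : l' m = 0 := by
    by_contra hne
    exact lt_irrefl _ (hl' (Finsupp.mem_support_iff.2 hne)).2
  have hzero := hI (Finsupp.single m (l m) + l') (fun m' hm' => ?_) ?_
  · have := DFunLike.congr_fun hzero m
    rw [Finsupp.add_apply, Finsupp.single_eq_same, hl'm, add_zero] at this
    exact hlm this
  · rcases Finset.mem_union.1 (Finsupp.support_add hm') with h1 | h1
    · rw [Finset.mem_singleton.1 (Finsupp.support_single_subset h1)]
      exact hPm
    · exact (hl' h1).1
  · rw [map_add, Finsupp.linearCombination_single, hls]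
    have : l m • mono m + s = f - i := by
      rw [eq_sub_iff_add_eq, add_assoc, add_comm s i, his, add_sub_cancel]
    rw [this]
    exact I.sub_mem hf (mem_idealSubmodule.1 hi)

end Groebner

end LerayModel

namespace LerayModel

universe u

set_option linter.unusedSectionVars false

/-! ### The two monomial orders as orders induced from well-ordered monoids -/

section Orders

variable {n : ℕ}

/-- The embedding of the exponents that defines the lexicographic order. -/
noncomputable def lexKey (m : Expo n) : Lex ((Fin n)ᵒᵈ → ℕ) ×ₗ Lex ((Fin n)ᵒᵈ → ℕ) :=
  toLex (toLex fun i => if OrderDual.ofDual i ∈ m.1 then 1 else 0,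
    toLex fun i => m.2 (OrderDual.ofDual i))

/-- The embedding of the exponents that defines the graded lexicographic order. -/
noncomputable def grlexKey (m : Expo n) :
    ℕ ×ₗ (Lex ((Fin n)ᵒᵈ → ℕ) ×ₗ Lex ((Fin n)ᵒᵈ → ℕ)) :=
  toLex (expoDegree m, lexKey m)

lemma toLex_indicator_lt {S T : Finset (Fin n)} :
    toLex (fun i : (Fin n)ᵒᵈ => if OrderDual.ofDual i ∈ S then 1 else 0) <
      toLex (fun i : (Fin n)ᵒᵈ => if OrderDual.ofDual i ∈ T then (1 : ℕ) else 0) ↔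
      ∃ i, i ∉ S ∧ i ∈ T ∧ ∀ j, i < j → (j ∈ S ↔ j ∈ T) := by
  have key : ∀ j : Fin n, ((if j ∈ S then 1 else 0) = (if j ∈ T then (1 : ℕ) else 0)) ↔
      (j ∈ S ↔ j ∈ T) := by
    intro j
    by_cases h1 : j ∈ S <;> by_cases h2 : j ∈ T <;> simp [h1, h2]
  have key' : ∀ j : Fin n, ((if j ∈ S then 1 else 0) < (if j ∈ T then (1 : ℕ) else 0)) ↔
      (j ∉ S ∧ j ∈ T) := by
    intro j
    by_cases h1 : j ∈ S <;> by_cases h2 : j ∈ T <;> simp [h1, h2]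
  constructor
  · rintro ⟨i, h1, h2⟩
    exact ⟨OrderDual.ofDual i, ((key' _).1 h2).1, ((key' _).1 h2).2,
      fun j hj => (key j).1 (h1 (OrderDual.toDual j) hj)⟩
  · rintro ⟨i, h1, h2, h3⟩
    exact ⟨OrderDual.toDual i, fun j hj => (key _).2 (h3 (OrderDual.ofDual j) hj),
      (key' i).2 ⟨h1, h2⟩⟩

lemma toLex_exponent_lt {b b' : Fin n →₀ ℕ} :
    toLex (fun i : (Fin n)ᵒᵈ => b (OrderDual.ofDual i)) <
      toLex (fun i : (Fin n)ᵒᵈ => b' (OrderDual.ofDual i)) ↔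
      ∃ i, b i < b' i ∧ ∀ j, i < j → b j = b' j := by
  constructor
  · rintro ⟨i, h1, h2⟩
    exact ⟨OrderDual.ofDual i, h2, fun j hj => h1 (OrderDual.toDual j) hj⟩
  · rintro ⟨i, h1, h2⟩
    exact ⟨OrderDual.toDual i, fun j hj => h2 (OrderDual.ofDual j) hj, h1⟩

lemma toLex_indicator_injective {S T : Finset (Fin n)}
    (h : toLex (fun i : (Fin n)ᵒᵈ => if OrderDual.ofDual i ∈ S then (1 : ℕ) else 0) =
      toLex (fun i : (Fin n)ᵒᵈ => if OrderDual.ofDual i ∈ T then (1 : ℕ) else 0)) : S = T := by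
  ext j
  have := congrFun (toLex.injective h) (OrderDual.toDual j)
  by_cases h1 : j ∈ S <;> by_cases h2 : j ∈ T <;> simp_all

lemma lexLT_iff {m m' : Expo n} : lexLT m m' ↔ lexKey m < lexKey m' := by
  rw [lexKey, lexKey, Prod.Lex.toLex_lt_toLex, toLex_indicator_lt, toLex_exponent_lt, lexLT]
  refine or_congr Iff.rfl (and_congr ⟨fun h => by rw [h], toLex_indicator_injective⟩ Iff.rfl)

lemma isExpoOrder_lexKey : IsExpoOrder (lexKey (n := n)) where
  inj m m' h := by
    have h' := toLex.injective h
    rw [Prod.mk.injEq] at h'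
    refine Prod.ext (toLex_indicator_injective h'.1) (Finsupp.ext fun i => ?_)
    exact congrFun (toLex.injective h'.2) (OrderDual.toDual i)
  map_mul m m' hd := by
    change toLex (_, _) = toLex (_, _)
    congr 2
    funext i
    change (if OrderDual.ofDual i ∈ m.1 ∪ m'.1 then 1 else 0) =
      (if OrderDual.ofDual i ∈ m.1 then 1 else 0) + (if OrderDual.ofDual i ∈ m'.1 then 1 else 0)
    have := @Finset.disjoint_left _ m.1 m'.1
    by_cases h1 : OrderDual.ofDual i ∈ m.1 <;> by_cases h2 : OrderDual.ofDual i ∈ m'.1 <;>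
      simp_all

lemma expoDegree_expoMul {m m' : Expo n} (hd : Disjoint m.1 m'.1) :
    expoDegree (expoMul m m') = expoDegree m + expoDegree m' := by
  simp only [expoDegree, expoMul, Finset.card_union_of_disjoint hd, Finsupp.add_apply,
    Finset.sum_add_distrib]
  omega

lemma isExpoOrder_grlexKey : IsExpoOrder (grlexKey (n := n)) where
  inj m m' h := isExpoOrder_lexKey.inj (Prod.mk.inj (toLex.injective h)).2
  map_mul m m' hd := by
    change toLex (_, _) = toLex (_, _)
    rw [expoDegree_expoMul hd, isExpoOrder_lexKey.map_mul m m' hd]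
    rfl

lemma grlexLT_iff {m m' : Expo n} : grlexLT m m' ↔ grlexKey m < grlexKey m' := by
  rw [grlexKey, grlexKey, Prod.Lex.toLex_lt_toLex, grlexLT, lexLT_iff]

end Orders

/-! ### Initial monomials of the relations, and their membership in the ideal -/

section InitialTerms

variable {n : ℕ} {M : Type*} [AddCommMonoid M] [LinearOrder M] [IsOrderedCancelAddMonoid M]
  {φ : Expo n → M}

/-- Among exponents of the same degree, the order of `φ` is the lexicographic one. -/
def RefinesLex (φ : Expo n → M) : Prop :=
  ∀ m m', expoDegree m = expoDegree m' → lexLT m m' → φ m < φ m'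

lemma refinesLex_lexKey : RefinesLex (lexKey (n := n)) := fun _ _ _ h => lexLT_iff.1 h

lemma refinesLex_grlexKey : RefinesLex (grlexKey (n := n)) :=
  fun _ _ h h' => grlexLT_iff.1 (Or.inr ⟨h, h'⟩)

/-- All terms but `e_T` miss some `i` in `T` and contain the smaller `g` instead. The sign of `e_T`
is `+1` because `g` comes first. -/
lemma isInitial_delE (href : RefinesLex φ) {g : Fin n} {T : Finset (Fin n)}
    (hg : ∀ i ∈ T, g < i) : IsInitial (ltOf φ) (delE (insert g T)) (T, 0) := by
  have hgT : g ∉ T := fun h => lt_irrefl _ (hg g h)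
  refine ⟨1, one_ne_zero, ?_⟩
  have h1 : (insert g T).filter (· < g) = ∅ := by
    refine Finset.filter_eq_empty_iff.2 fun i hi => ?_
    rcases Finset.mem_insert.1 hi with rfl | hi
    · exact lt_irrefl _
    · exact (hg i hi).not_gt
  rw [delE, Finset.sum_insert hgT, h1, Finset.card_empty, pow_zero, one_mul,
    Finset.erase_insert hgT, one_smul, mono_zero, add_sub_cancel_left]
  refine Submodule.sum_mem _ fun i hi => ?_
  have hmem : eProd ((insert g T).erase i) ∈
      Submodule.span ℚ (mono '' {m' | ltOf φ m' (T, 0)}) := by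
    refine Submodule.subset_span ⟨((insert g T).erase i, 0), href _ _ ?_ ?_, mono_zero _⟩
    · simp only [expoDegree]
      rw [Finset.card_erase_of_mem (Finset.mem_insert_of_mem hi), Finset.card_insert_of_notMem hgT]
      simp
    · refine Or.inl ⟨i, Finset.notMem_erase _ _, hi, fun j hij => ?_⟩
      have hjg : j ≠ g := ((hg i hi).trans hij).ne'
      simp [hij.ne', hjg]
  rcases neg_one_pow_eq_or (R n) ((insert g T).filter (· < i)).card with h2 | h2
  · rwa [h2, one_mul]
  · rw [h2, neg_one_mul]
    exact Submodule.neg_mem _ hmem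

lemma xVar_eq_mono (i : Fin n) : xVar i = mono (∅, Finsupp.single i 1) := by
  rw [mono_empty]; rfl

lemma expoDegree_single (i : Fin n) : expoDegree (∅, Finsupp.single i 1) = 1 := by
  simp [expoDegree, Finsupp.single_apply]

lemma eProd_mul_xProd (S T : Finset (Fin n)) :
    eProd S * xProd T = mono (S, ∑ i ∈ T, Finsupp.single i 1) := by
  rw [mono, xProd, xPow, MvPolynomial.monomial_sum_one]
  rfl

lemma sum_single_apply (T : Finset (Fin n)) (j : Fin n) :
    (∑ i ∈ T, Finsupp.single i 1 : Fin n →₀ ℕ) j = if j ∈ T then 1 else 0 := by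
  rw [Finsupp.finsetSum_apply]
  simp [Finsupp.single_apply]

variable {L : Type u} [Lattice L] [BoundedOrder L] {h : Fin n → L}

lemma cElt_eq (g : Fin n) :
    cElt h g = algebraMap (MvPolynomial (Fin n) ℚ) (R n) (cPoly h g) := by
  rw [cElt, cPoly, map_sum]
  rfl

lemma isInitial_cElt (hh : IsBlowupOrder h) (href : RefinesLex φ) (g : Fin n) :
    IsInitial (ltOf φ) (cElt h g) (∅, Finsupp.single g 1) := by
  classical
  refine ⟨1, one_ne_zero, ?_⟩
  rw [one_smul, cElt, ← Finset.add_sum_erase _ _ (a := g) (by simp), ← xVar_eq_mono,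
    add_sub_cancel_left]
  refine Submodule.sum_mem _ fun f hf => ?_
  rw [Finset.mem_erase, Finset.mem_filter] at hf
  have hfg : f < g := lt_of_le_of_ne (hh.ord f g hf.2.2) hf.1
  refine Submodule.subset_span ⟨_, href _ _ ?_ ?_, (xVar_eq_mono f).symm⟩
  · rw [expoDegree_single, expoDegree_single]
  · refine Or.inr ⟨rfl, g, ?_, fun j hj => ?_⟩
    · simp [hfg.ne]
    · simp [hj.ne, (hfg.trans hj).ne]

lemma isInitial_cElt_pow [WellFoundedLT M] (hh : IsBlowupOrder h) (hφ : IsExpoOrder φ)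
    (href : RefinesLex φ) (g : Fin n) (d : ℕ) :
    IsInitial (ltOf φ) (cElt h g ^ d) (∅, Finsupp.single g d) := by
  induction d with
  | zero =>
    have : (1 : R n) = mono (∅, 0) := by rw [mono_zero, eProd_empty]
    rw [pow_zero, Finsupp.single_zero, this]
    exact isInitial_mono _ _
  | succ d ih =>
    have := ih.mul hφ (isInitial_cElt hh href g) (Finset.disjoint_empty_left _)
    rwa [← pow_succ, expoMul, Finset.empty_union, ← Finsupp.single_add] at this

variable [Finite L] [IsUpperModularLattice L]

open Classical in
/-- The monomials that are not standard are divisible by an initial monomial. -/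
lemma exists_initial_dvd [WellFoundedLT M] (hh : IsBlowupOrder h) (hφ : IsExpoOrder φ)
    (href : RefinesLex φ) (m : Expo n) (hm : ¬ IsStandard h m) :
    ∃ g ∈ relNotNested h ∪ relCircuit h ∪ relPower h, ∃ m',
      IsInitial (ltOf φ) g m' ∧ ExpoDvd m' m := by
  have hind : ∀ T ⊆ m.2.support, (∑ i ∈ T, Finsupp.single i 1 : Fin n →₀ ℕ) ≤ m.2 := by
    intro T hT j
    rw [sum_single_apply]
    split_ifs with hj
    · exact Nat.one_le_iff_ne_zero.2 (Finsupp.mem_support_iff.1 (hT hj))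
    · exact Nat.zero_le _
  by_cases h1 : IsNestedIdx h (m.1 ∪ m.2.support)
  swap
  · refine ⟨_, Or.inl (Or.inl ⟨m.1, m.2.support, h1, rfl⟩),
      (m.1, ∑ i ∈ m.2.support, Finsupp.single i 1), ?_, subset_rfl, hind _ subset_rfl⟩
    rw [eProd_mul_xProd]
    exact isInitial_mono _ _
  have h1' := (hh.isNestedIdx_iff _).1 h1
  by_cases h2 : IsNBC h m.1
  swap
  · obtain ⟨T, hT, g, hg, hC⟩ := exists_isBrokenCircuit_of_not_isNBC hh
      (h1'.mono Finset.subset_union_left) h2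
    exact ⟨_, Or.inl (Or.inr ⟨insert g T, (hh.isNestedIdx_iff _).2 ((isSimplex_iff hh).1 hC.1),
      hC, rfl⟩), (T, 0), isInitial_delE href hg, hT, zero_le⟩
  obtain ⟨g, hg, hrank⟩ : ∃ g ∈ m.2.support,
      intervalRank (supBelow h (m.1 ∪ m.2.support) g) (h g) ≤ m.2 g := by
    by_contra! hc
    exact hm ⟨h1, h2, fun g hg =>
      ⟨Nat.pos_of_ne_zero (Finsupp.mem_support_iff.1 hg), hc g hg⟩⟩
  set V := (m.1 ∪ m.2.support).filter (fun f => h f < h g) with hV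
  -- The power relation requires an antichain. Passing to maximal elements keeps the join, hence the
  -- exponent, and leaves a smaller monomial.
  set U := V.filter (fun f => ∀ f' ∈ V, h f ≤ h f' → f = f') with hU
  have hVU : V.sup h = U.sup h := by
    apply le_antisymm
    · refine Finset.sup_le fun f hf => ?_
      obtain ⟨y, hfy, hy⟩ := (V.image h).exists_le_maximal (Finset.mem_image_of_mem h hf)
      obtain ⟨f', hf', rfl⟩ := Finset.mem_image.1 hy.1
      refine hfy.trans (Finset.le_sup (f := h) (Finset.mem_filter.2 ⟨hf', fun f'' hf'' hle => ?_⟩))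
      exact hh.inj (le_antisymm hle (hy.2 (Finset.mem_image_of_mem h hf'') hle))
    · exact Finset.sup_mono (Finset.filter_subset _ _)
  have hUm : U ⊆ m.1 ∪ m.2.support := (Finset.filter_subset _ _).trans (Finset.filter_subset _ _)
  have hunion : U ∩ m.1 ∪ U \ m.1 = U := by
    rw [Finset.union_comm]; exact Finset.sdiff_union_inter U m.1
  -- The inequality is strict because `V` is nested and does not contain `g`.
  have hlt : U.sup h < h g := by
    rw [← hVU]
    refine lt_of_le_of_ne (Finset.sup_le fun f hf => (Finset.mem_filter.1 hf).2.le) fun he => ?_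
    by_cases hga : IsAtom (h g)
    · have hV0 : V = ∅ := by
        refine Finset.filter_eq_empty_iff.2 fun f _ hfg => ?_
        exact hh.ne_bot f (hga.2 _ hfg)
      rw [hV0, Finset.sup_empty] at he
      exact hga.1 he.symm
    · exact lt_irrefl _ (Finset.mem_filter.1
        (h1' V (Finset.filter_subset _ _) g hga g.2 he)).2
  have hanti : IsAntichain (· ≤ ·) (h '' (U : Set (Fin n))) := by
    rintro _ ⟨f, hf, rfl⟩ _ ⟨f', hf', rfl⟩ hne hle
    exact hne (congrArg h ((Finset.mem_filter.1 hf).2 f' (Finset.mem_filter.1 hf').1 hle))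
  refine ⟨eProd (U ∩ m.1) * xProd (U \ m.1) *
      cElt h g ^ intervalRank ((U ∩ m.1 ∪ U \ m.1).sup h) (h g),
    Or.inr ⟨U ∩ m.1, U \ m.1, g, ?_, ?_, ?_, ?_, rfl⟩, expoMul
    (U ∩ m.1, ∑ i ∈ U \ m.1, Finsupp.single i 1)
    (∅, Finsupp.single g (intervalRank ((U ∩ m.1 ∪ U \ m.1).sup h) (h g))), ?_, ?_, ?_⟩
  · rw [hunion]
    exact (hh.isNestedIdx_iff _).2 (h1'.mono hUm)
  · exact (Finset.disjoint_sdiff_inter U m.1).symm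
  · rw [hunion]
    exact hanti
  · rw [hunion]
    exact hlt
  · rw [eProd_mul_xProd]
    exact (isInitial_mono _ _).mul hφ (isInitial_cElt_pow hh hφ href g _)
      (Finset.disjoint_empty_right _)
  · rw [expoMul, Finset.union_empty]
    exact Finset.inter_subset_right
  · rw [hunion, ← hVU]
    intro j
    rw [expoMul, Finsupp.add_apply, sum_single_apply, Finsupp.single_apply]
    by_cases hjg : g = j
    · subst hjg
      have : g ∉ U \ m.1 := fun hgU => lt_irrefl _
        (Finset.mem_filter.1 (Finset.mem_filter.1 (Finset.mem_sdiff.1 hgU).1).1).2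
      rw [if_neg this, if_pos rfl, zero_add]
      exact hrank
    · rw [if_neg hjg, add_zero]
      split_ifs with hj
      · obtain ⟨hjU, hjm⟩ := Finset.mem_sdiff.1 hj
        exact Nat.one_le_iff_ne_zero.2 (Finsupp.mem_support_iff.1
          ((Finset.mem_union.1 (hUm hjU)).resolve_left hjm))
      · exact Nat.zero_le _

/-- Links the commutative ideal to `I(L, H)`: at the final stage each of its generators becomes an
element of the ideal when multiplied by `e_S`. -/
lemma eProd_mul_algebraMap_mem (hh : IsBlowupOrder h) {S : Finset (Fin n)}
    {p : MvPolynomial (Fin n) ℚ} (hp : p ∈ relIdeal h n S) :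
    eProd S * algebraMap (MvPolynomial (Fin n) ℚ) (R n) p ∈ lerayIdeal h := by
  have hspan : ∀ r ∈ relNotNested h ∪ relCircuit h ∪ relLinear h, r ∈ lerayIdeal h :=
    fun r hr => TwoSidedIdeal.subset_span hr
  refine Submodule.span_induction (p := fun p _ =>
    eProd S * algebraMap (MvPolynomial (Fin n) ℚ) (R n) p ∈ lerayIdeal h) ?_ ?_ ?_ ?_ hp
  · rintro _ ((⟨i, -, hi, rfl⟩ | ⟨T, hT, rfl⟩) | ⟨a, ha, rfl⟩)
    · exact absurd i.2 (not_lt.2 hi)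
    · exact hspan _ (Or.inl (Or.inl ⟨S, T, fun hST => hT ((hh.isNestedIdx_iff _).1 hST), rfl⟩))
    · rw [← cElt_eq]
      exact TwoSidedIdeal.mul_mem_left _ _ _ (hspan _ (Or.inr ⟨a, ha, rfl⟩))
  · rw [map_zero, mul_zero]
    exact TwoSidedIdeal.zero_mem _
  · intro p q _ _ hp hq
    rw [map_add, mul_add]
    exact TwoSidedIdeal.add_mem _ hp hq
  · intro p q _ hq
    rw [smul_eq_mul, map_mul, ← mul_assoc,
      ← Algebra.commutes (R := MvPolynomial (Fin n) ℚ) p (eProd S), mul_assoc]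
    exact TwoSidedIdeal.mul_mem_left _ _ _ hq

lemma relations_subset_lerayIdeal [IsAtomistic L] (hh : IsBlowupOrder h) :
    ∀ r ∈ relNotNested h ∪ relCircuit h ∪ relPower h, r ∈ lerayIdeal h := by
  rintro r (hr | ⟨S, T, g, -, -, -, hlt, rfl⟩)
  · exact TwoSidedIdeal.subset_span (Or.inl hr)
  · rw [cElt_eq, mul_assoc, xProd, ← map_pow, ← map_mul]
    exact eProd_mul_algebraMap_mem hh (prod_mul_cPoly_pow_mem hh _ T g hlt le_rfl)

end InitialTerms

end LerayModel

namespace LerayModel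

universe u

set_option linter.unusedSectionVars false

/-! ### Maps from `R(H)` to exterior algebras -/

section ExteriorMap

variable {n r : ℕ}

/-- The contraction with the functional that takes every `e_g` to `1`. -/
noncomputable def contraction (n : ℕ) : R n →ₗ[MvPolynomial (Fin n) ℚ] R n :=
  CliffordAlgebra.contractLeft (∑ i, LinearMap.proj i)

lemma contraction_eVar_mul (i : Fin n) (r : R n) :
    contraction n (eVar i * r) = r - eVar i * contraction n r := by
  have h1 : (∑ j, LinearMap.proj j : (Fin n → MvPolynomial (Fin n) ℚ) →ₗ[MvPolynomial (Fin n) ℚ]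
      MvPolynomial (Fin n) ℚ) (Pi.single i 1) = 1 := by
    rw [LinearMap.sum_apply]
    simp [Pi.single_apply]
  rw [contraction, eVar, ExteriorAlgebra.ι, CliffordAlgebra.contractLeft_ι_mul, h1, one_smul]

/-- Makes the Leibniz rule available for `∂`, so that factors of `e_S` may be reordered before `∂`
is applied. -/
lemma contraction_eProd (S : Finset (Fin n)) : contraction n (eProd S) = delE S := by
  induction S using Finset.induction_on_min with
  | empty =>
    rw [eProd_empty, delE, Finset.sum_empty, contraction, CliffordAlgebra.contractLeft_one]
  | insert a S ha ih =>
    have haS : a ∉ S := fun h => lt_irrefl _ (ha a h)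
    have h1 : (insert a S).filter (· < a) = ∅ := by
      refine Finset.filter_eq_empty_iff.2 fun i hi => ?_
      rcases Finset.mem_insert.1 hi with rfl | hi
      · exact lt_irrefl _
      · exact (ha i hi).not_gt
    rw [eProd_insert_of_lt ha, contraction_eVar_mul, ih, delE, delE, Finset.sum_insert haS, h1,
      Finset.card_empty, pow_zero, one_mul, Finset.erase_insert haS, sub_eq_add_neg,
      Finset.mul_sum, ← Finset.sum_neg_distrib]
    congr 1
    refine Finset.sum_congr rfl fun i hi => ?_
    have h2 : (insert a S).filter (· < i) = insert a (S.filter (· < i)) := by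
      rw [Finset.filter_insert, if_pos (ha i hi)]
    have h3 : (insert a S).erase i = insert a (S.erase i) :=
      Finset.erase_insert_of_ne (ha i hi).ne
    rw [h2, h3, Finset.card_insert_of_notMem (fun h => haS (Finset.mem_filter.1 h).1),
      eProd_insert_of_lt (fun j hj => ha j (Finset.mem_of_mem_erase hj)), pow_succ, mul_neg_one,
      neg_mul, ← mul_assoc, ← mul_assoc]
    rcases neg_one_pow_eq_or (R n) (S.filter (· < i)).card with h | h <;> simp [h]

variable {D : Type*} [CommRing D] [Algebra (MvPolynomial (Fin n) ℚ) D] (v : Fin n → Fin r → D)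

/-- The homomorphism from `R(H)` to an exterior algebra that takes `e_g` to the vector `v g`. -/
noncomputable def exteriorHom :
    R n →ₐ[MvPolynomial (Fin n) ℚ] ExteriorAlgebra D (Fin r → D) :=
  ExteriorAlgebra.lift (MvPolynomial (Fin n) ℚ)
    ⟨((ExteriorAlgebra.ι D).restrictScalars (MvPolynomial (Fin n) ℚ)) ∘ₗ
      Fintype.linearCombination (MvPolynomial (Fin n) ℚ) v,
      fun _ => ExteriorAlgebra.ι_sq_zero _⟩

lemma exteriorHom_eVar (i : Fin n) : exteriorHom v (eVar i) = ExteriorAlgebra.ι D (v i) := by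
  refine (ExteriorAlgebra.lift_ι_apply _ _ _ _).trans ?_
  simp [Fintype.linearCombination_apply_single]

lemma exteriorHom_eProd_eq_zero {S : Finset (Fin n)} {g : Fin n} (hg : g ∈ S) (hv : v g = 0) :
    exteriorHom v (eProd S) = 0 := by
  rw [eProd, map_list_prod, List.map_map]
  refine List.prod_eq_zero (List.mem_map.2 ⟨g, (Finset.mem_sort _).2 hg, ?_⟩)
  rw [Function.comp_apply, exteriorHom_eVar, hv, map_zero]

/-- Up to a scalar, `∂ e_C` is `e_b w - e_a w + e_a e_b ∂w`. If `e_a` and `e_b` have the same image,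
the first two terms cancel and the third contains a square. -/
lemma exteriorHom_delE_eq_zero {C : Finset (Fin n)} {a b : Fin n} (ha : a ∈ C) (hb : b ∈ C)
    (hab : a ≠ b) (hv : v a = v b) : exteriorHom v (delE C) = 0 := by
  have hnd : (a :: b :: ((C.erase a).erase b).sort).Nodup := by
    simp [hab, Finset.sort_nodup]
  obtain ⟨ε, hε, h1⟩ := exists_eProd_eq hnd
  have h2 : (a :: b :: ((C.erase a).erase b).sort).toFinset = C := by
    ext i
    by_cases h3 : i = a
    · simp [h3, ha]
    · by_cases h4 : i = b
      · simp [h4, hb]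
      · simp [h3, h4]
  rw [h2, List.map_cons, List.map_cons, List.prod_cons, List.prod_cons] at h1
  set w := (((C.erase a).erase b).sort.map eVar).prod
  have h3 : eProd C = algebraMap ℚ (MvPolynomial (Fin n) ℚ) ε⁻¹ • (eVar a * (eVar b * w)) := by
    rw [algebraMap_smul, h1, smul_smul, inv_mul_cancel₀ hε, one_smul]
  have h4 : exteriorHom v (eVar a) = exteriorHom v (eVar b) := by
    rw [exteriorHom_eVar, exteriorHom_eVar, hv]
  rw [← contraction_eProd, h3, map_smul, map_smul, contraction_eVar_mul, contraction_eVar_mul,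
    map_sub, map_mul, map_mul, h4, map_sub, map_mul, mul_sub, ← mul_assoc,
    exteriorHom_eVar, ExteriorAlgebra.ι_sq_zero, zero_mul, sub_zero, sub_self, smul_zero]

/-- The coefficient of the volume form in the image under `exteriorHom`. -/
noncomputable def detFunctional : R n →ₗ[MvPolynomial (Fin n) ℚ] D :=
  ((ExteriorAlgebra.liftAlternating
    (Function.update (0 : ∀ i : ℕ, (Fin r → D) [⋀^Fin i]→ₗ[D] D) r
      Matrix.detRowAlternating)).restrictScalars (MvPolynomial (Fin n) ℚ)) ∘ₗ
    (exteriorHom v).toLinearMap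

lemma exteriorHom_eProd {S : Finset (Fin n)} {k : ℕ} (hS : S.card = k) :
    exteriorHom v (eProd S) =
      ExteriorAlgebra.ιMulti D k (fun i => v (S.orderEmbOfFin hS i)) := by
  rw [ExteriorAlgebra.ιMulti_apply, List.ofFn_eq_map, eProd, map_list_prod, List.map_map,
    ← Finset.listMap_orderEmbOfFin_finRange S hS, List.map_map]
  congr 1
  refine List.map_congr_left fun i _ => ?_
  rw [Function.comp_apply, Function.comp_apply, exteriorHom_eVar]

lemma detFunctional_eProd {S : Finset (Fin n)} (hS : S.card = r) :
    detFunctional v (eProd S) = Matrix.det (Matrix.of fun i => v (S.orderEmbOfFin hS i)) := by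
  rw [detFunctional, LinearMap.comp_apply, AlgHom.toLinearMap_apply, exteriorHom_eProd v hS,
    LinearMap.restrictScalars_apply, ExteriorAlgebra.liftAlternating_apply_ιMulti,
    Function.update_self]
  rfl

lemma detFunctional_eProd_of_card_ne {S : Finset (Fin n)} (hS : S.card ≠ r) :
    detFunctional v (eProd S) = 0 := by
  rw [detFunctional, LinearMap.comp_apply, AlgHom.toLinearMap_apply, exteriorHom_eProd v rfl,
    LinearMap.restrictScalars_apply, ExteriorAlgebra.liftAlternating_apply_ιMulti,
    Function.update_of_ne hS]
  rfl

lemma detFunctional_eq_zero {f : R n} (hf : exteriorHom v f = 0) : detFunctional v f = 0 := by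
  rw [detFunctional, LinearMap.comp_apply, AlgHom.toLinearMap_apply, hf, map_zero]

end ExteriorMap

/-! ### The flag of an nbc set and independence modulo `I(L, H)` -/

section Flag

variable {L : Type u} [Lattice L] [BoundedOrder L] {n : ℕ} (h : Fin n → L)

/-- The element `g` enters the flag of the closures of the final segments of `S` at `s`. -/
def Enters (S : Finset (Fin n)) (s g : Fin n) : Prop :=
  InClosure h (S.filter (s ≤ ·)) g ∧ ¬ InClosure h (S.filter (s < ·)) g

open Classical in
/-- The coordinates of `e_g` with respect to the flag of `S`. -/
noncomputable def flagVec (S : Finset (Fin n)) (g : Fin n) (j : Fin S.card) :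
    MvPolynomial (Fin n) ℚ ⧸ relIdeal h n S :=
  if Enters h S (S.orderEmbOfFin rfl j) g then 1 else 0

variable {h} [Finite L] [IsUpperModularLattice L] {S : Finset (Fin n)}

lemma flagVec_eq_zero {g : Fin n} (hg : ¬ InClosure h S g) : flagVec h S g = 0 := by
  funext j
  exact if_neg fun he => hg (he.1.mono (Finset.filter_subset _ _))

lemma enters_iff_of_enters {s s' g : Fin n} (hs : Enters h S s g) :
    Enters h S s' g ↔ s' = s := by
  constructor
  · intro he
    rcases lt_trichotomy s' s with hlt | rfl | hlt
    · exact absurd (hs.1.mono fun i hi => by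
        rw [Finset.mem_filter] at hi ⊢
        exact ⟨hi.1, hlt.trans_le hi.2⟩) he.2
    · rfl
    · exact absurd (he.1.mono fun i hi => by
        rw [Finset.mem_filter] at hi ⊢
        exact ⟨hi.1, hlt.trans_le hi.2⟩) hs.2
  · rintro rfl
    exact hs

lemma flagVec_eq_of_enters {s a b : Fin n} (ha : Enters h S s a)
    (hb : Enters h S s b) : flagVec h S a = flagVec h S b := by
  funext j
  simp only [flagVec]
  rw [enters_iff_of_enters ha, enters_iff_of_enters hb]

/-- A circuit never has exactly one element outside a closed set. At the last closed set of the flag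
to fail to contain it, going up from the empty one, two elements are missing: they enter together,
or both lie outside the closure of `S` and have vector zero. -/
lemma IsCircuit.exists_flagVec_eq (hh : IsBlowupOrder h) {C : Finset (Fin n)}
    (hC : IsCircuit h C) : ∃ a ∈ C, ∃ b ∈ C, a ≠ b ∧ flagVec h S a = flagVec h S b := by
  classical
  have hCne : C.Nonempty := by
    rw [Finset.nonempty_iff_ne_empty]
    rintro rfl
    apply hC.2.1
    rw [isIndependent_iff hh]
    refine ⟨(isSimplex_iff hh).1 hC.1, ?_⟩
    simp [atomPart, intervalRank_self]
  by_cases hCS : ∀ c ∈ C, InClosure h S c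
  swap
  · push Not at hCS
    obtain ⟨c, hc, hcS⟩ := hCS
    obtain ⟨b, hb, hbc, hbS⟩ := hC.exists_ne_not_inClosure hh hc hcS
    exact ⟨b, hb, c, hc, hbc, by rw [flagVec_eq_zero hbS, flagVec_eq_zero hcS]⟩
  obtain ⟨c₀, hc₀⟩ := hCne
  have hSne : S.Nonempty := by
    rw [Finset.nonempty_iff_ne_empty]
    rintro rfl
    exact not_inClosure_empty c₀ (hCS c₀ hc₀)
  -- The maximum `s` of this set gives the smallest closure in the flag that contains all of `C`.
  set J := S.filter (fun s => ∀ c ∈ C, InClosure h (S.filter (s ≤ ·)) c) with hJ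
  have hJne : J.Nonempty := by
    refine ⟨S.min' hSne, Finset.mem_filter.2 ⟨Finset.min'_mem _ _, fun c hc => ?_⟩⟩
    rw [Finset.filter_true_of_mem fun i hi => Finset.min'_le _ _ hi]
    exact hCS c hc
  set s := J.max' hJne with hs
  have hsJ := Finset.mem_filter.1 (J.max'_mem hJne)
  have hex : ∃ c ∈ C, ¬ InClosure h (S.filter (s < ·)) c := by
    by_contra! hall
    have hne : (S.filter (s < ·)).Nonempty := by
      rw [Finset.nonempty_iff_ne_empty]
      intro he
      rw [he] at hall
      exact not_inClosure_empty c₀ (hall c₀ hc₀)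
    have hmem := Finset.mem_filter.1 (Finset.min'_mem _ hne)
    refine (J.le_max' ((S.filter (s < ·)).min' hne) ?_).not_gt hmem.2
    refine Finset.mem_filter.2 ⟨hmem.1, fun c hc => (hall c hc).mono fun i hi => ?_⟩
    exact Finset.mem_filter.2 ⟨(Finset.mem_filter.1 hi).1, Finset.min'_le _ _ hi⟩
  obtain ⟨c, hc, hcs⟩ := hex
  obtain ⟨b, hb, hbc, hbs⟩ := hC.exists_ne_not_inClosure hh hc hcs
  exact ⟨b, hb, c, hc, hbc, flagVec_eq_of_enters ⟨hsJ.2 b hb, hbs⟩ ⟨hsJ.2 c hc, hcs⟩⟩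

/-- For a non-nested product `e_{S'} x_T`, either `S'` leaves the closure of `S` and some factor
maps to zero, or `S'` could be added to any compatible `S ∪ T`, so `x_T` is already zero next to
`S`. -/
lemma exteriorHom_flagVec_eq_zero (hh : IsBlowupOrder h) {f : R n} (hf : f ∈ lerayIdeal h) :
    exteriorHom (flagVec h S) f = 0 := by
  have hle : lerayIdeal h ≤ TwoSidedIdeal.ker (exteriorHom (flagVec h S)) := by
    refine TwoSidedIdeal.span_le.2 ?_
    have hmap : ∀ p ∈ relIdeal h n S, exteriorHom (flagVec h S)
        (algebraMap (MvPolynomial (Fin n) ℚ) (R n) p) = 0 := by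
      intro p hp
      rw [AlgHom.commutes, IsScalarTower.algebraMap_apply (MvPolynomial (Fin n) ℚ)
        (MvPolynomial (Fin n) ℚ ⧸ relIdeal h n S), Ideal.Quotient.algebraMap_eq,
        Ideal.Quotient.eq_zero_iff_mem.2 hp, map_zero]
    rintro _ ((⟨S', T, hST, rfl⟩ | ⟨C, -, hC, rfl⟩) | ⟨a, ha, rfl⟩)
    · refine (TwoSidedIdeal.mem_ker _).2 ?_
      rw [map_mul]
      by_cases hS' : ∀ g ∈ S', InClosure h S g
      · rw [xProd, hmap _ (prod_mem_relIdeal fun hc => hST ((hh.isNestedIdx_iff _).2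
          ((hc.union_of_inClosure hh hS').mono ?_))), mul_zero]
        intro i hi
        rcases Finset.mem_union.1 hi with h1 | h1 <;> simp [h1]
      · push Not at hS'
        obtain ⟨g, hg, hgS⟩ := hS'
        rw [exteriorHom_eProd_eq_zero _ hg (flagVec_eq_zero hgS), zero_mul]
    · obtain ⟨a, ha, b, hb, hab, hv⟩ := hC.exists_flagVec_eq (S := S) hh
      exact (TwoSidedIdeal.mem_ker _).2 (exteriorHom_delE_eq_zero _ ha hb hab hv)
    · refine (TwoSidedIdeal.mem_ker _).2 ?_
      rw [cElt_eq]
      exact hmap _ (cPoly_mem_relIdeal ha)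
  exact (TwoSidedIdeal.mem_ker _).1 (hle hf)

/-- This is where nbc is used: an element smaller than a whole subset of `S` is not in its closure.
-/
lemma Enters.le (hh : IsBlowupOrder h) (hS : IsNBC h S) {s g : Fin n} (hg : Enters h S s g) :
    s ≤ g := by
  by_contra! hlt
  exact hS.not_inClosure hh (Finset.filter_subset _ _)
    (fun u hu => hlt.trans_le (Finset.mem_filter.1 hu).2) hg.1

lemma enters_self (hh : IsBlowupOrder h) (hS : IsNBC h S) {s : Fin n} (hs : s ∈ S) :
    Enters h S s s :=
  ⟨inClosure_of_mem (Finset.mem_filter.2 ⟨hs, le_rfl⟩),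
    hS.not_inClosure hh (Finset.filter_subset _ _) fun _ hu => (Finset.mem_filter.1 hu).2⟩

lemma detFunctional_flagVec_self (hh : IsBlowupOrder h) (hS : IsNBC h S) :
    detFunctional (flagVec h S) (eProd S) = 1 := by
  classical
  have h1 : (Matrix.of fun i => flagVec h S (S.orderEmbOfFin rfl i)) = 1 := by
    ext i j
    have hi := Finset.orderEmbOfFin_mem S rfl i
    rw [Matrix.of_apply, flagVec, Matrix.one_apply]
    refine if_congr ?_ rfl rfl
    rw [enters_iff_of_enters (enters_self hh hS hi), (S.orderEmbOfFin rfl).injective.eq_iff,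
      eq_comm]
  rw [detFunctional_eProd _ rfl, h1, Matrix.det_one]

/-- A nonzero term of the determinant matches each `s` in `S` with an element of `S'` that is at
least `s`. The bound on the sums forces equality everywhere, so `S' = S`. -/
lemma detFunctional_flagVec_eq_zero (hh : IsBlowupOrder h) (hS : IsNBC h S)
    {S' : Finset (Fin n)} (hne : S' ≠ S) (hle : ∑ i ∈ S', (i : ℕ) ≤ ∑ i ∈ S, (i : ℕ)) :
    detFunctional (flagVec h S) (eProd S') = 0 := by
  classical
  by_cases hc : S'.card = S.card
  swap
  · exact detFunctional_eProd_of_card_ne _ hc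
  rw [detFunctional_eProd _ hc, Matrix.det_apply]
  refine Finset.sum_eq_zero fun σ _ => ?_
  by_cases hall : ∀ i, Enters h S (S.orderEmbOfFin rfl i) (S'.orderEmbOfFin hc (σ i))
  · exfalso
    have h1 : ∀ i, (S.orderEmbOfFin rfl i : ℕ) ≤ S'.orderEmbOfFin hc (σ i) :=
      fun i => (hall i).le hh hS
    have hsum : ∀ {T : Finset (Fin n)} (hT : T.card = S.card),
        ∑ i ∈ T, (i : ℕ) = ∑ i, (T.orderEmbOfFin hT i : ℕ) := by
      intro T hT
      conv_lhs => rw [← Finset.map_orderEmbOfFin_univ T hT, Finset.sum_map]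
      rfl
    have h2 : ∑ i, (S.orderEmbOfFin rfl i : ℕ) = ∑ i, (S'.orderEmbOfFin hc (σ i) : ℕ) := by
      refine le_antisymm (Finset.sum_le_sum fun i _ => h1 i) ?_
      rw [Equiv.sum_comp σ (fun i => (S'.orderEmbOfFin hc i : ℕ)), ← hsum, ← hsum]
      exact hle
    have h3 := (Finset.sum_eq_sum_iff_of_le fun i _ => h1 i).1 h2
    refine hne (Finset.eq_of_subset_of_card_le (fun x hx => ?_) hc.le).symm
    rw [← Finset.mem_coe, ← Finset.range_orderEmbOfFin S rfl] at hx
    obtain ⟨i, rfl⟩ := hx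
    rw [Fin.ext (h3 i (Finset.mem_univ i))]
    exact Finset.orderEmbOfFin_mem _ _ _
  · push Not at hall
    obtain ⟨i, hi⟩ := hall
    rw [Finset.prod_eq_zero (Finset.mem_univ i), smul_zero]
    exact if_neg hi

/-- Atoms do not occur in `b`, since the bound for an atom is the rank 1 and the exponent would be
positive and less than 1. -/
lemma IsStandard.isStandardExponent (hh : IsBlowupOrder h) {m : Expo n} (hm : IsStandard h m) :
    IsStandardExponent h n m.1 m.2 where
  not_isAtom i hi ha := by
    classical
    have h1 := hm.2.2 i hi
    have h2 : (m.1 ∪ m.2.support).filter (fun f => h f < h i) = ∅ :=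
      Finset.filter_eq_empty_iff.2 fun f _ hf => hh.ne_bot f (ha.2 _ hf)
    rw [h2, Finset.sup_empty, intervalRank_bot_atom ha] at h1
    omega
  lt i _ := i.2
  compatible := (hh.isNestedIdx_iff _).1 hm.1
  lt_rank i hi := (hm.2.2 i hi).2

/-- The standard monomials are linearly independent modulo the ideal `I(L, H)`. -/
lemma eq_zero_of_linearCombination_mem [IsAtomistic L] (hh : IsBlowupOrder h) (l : Expo n →₀ ℚ)
    (hl : ∀ m ∈ l.support, IsStandard h m)
    (hI : Finsupp.linearCombination ℚ mono l ∈ lerayIdeal h) : l = 0 := by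
  classical
  by_contra hne
  -- Maximality of the sum of indices makes the functional of `S` vanish on all odd parts other than
  -- `e_S`.
  obtain ⟨m₀, hm₀, hmax⟩ := l.support.exists_max_image (fun m => ∑ i ∈ m.1, (i : ℕ))
    (Finsupp.support_nonempty_iff.2 hne)
  set S := m₀.1
  have hS : IsNBC h S := (hl m₀ hm₀).2.1
  set f : MvPolynomial (Fin n) ℚ :=
    ∑ m ∈ l.support.filter (fun m => m.1 = S), MvPolynomial.monomial m.2 (l m) with hf
  have hmono : ∀ m : Expo n, l m • mono m = MvPolynomial.monomial m.2 (l m) • eProd m.1 := by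
    intro m
    rw [mono, xPow, ← Algebra.commutes (R := MvPolynomial (Fin n) ℚ), ← Algebra.smul_def,
      ← smul_assoc, MvPolynomial.smul_monomial, smul_eq_mul, mul_one]
  have hfI : f ∈ relIdeal h n S := by
    have h1 := detFunctional_eq_zero _ (exteriorHom_flagVec_eq_zero (S := S) hh hI)
    rw [Finsupp.linearCombination_apply, Finsupp.sum, map_sum] at h1
    rw [← Ideal.Quotient.eq_zero_iff_mem, hf, map_sum, Finset.sum_filter]
    refine Eq.trans ?_ h1
    refine Finset.sum_congr rfl fun m hm => ?_
    rw [hmono, map_smul]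
    split_ifs with hmS
    · rw [hmS, detFunctional_flagVec_self hh hS]
      exact Algebra.algebraMap_eq_smul_one _
    · rw [detFunctional_flagVec_eq_zero hh hS hmS (hmax m hm), smul_zero]
  have hcoeff : ∀ b, f.coeff b = l (S, b) := by
    intro b
    rw [hf, MvPolynomial.coeff_sum, Finset.sum_eq_single (S, b)]
    · rw [MvPolynomial.coeff_monomial, if_pos rfl]
    · intro m hm hne'
      rw [MvPolynomial.coeff_monomial, if_neg]
      intro hb
      exact hne' (Prod.ext (Finset.mem_filter.1 hm).2 hb)
    · intro hm
      rw [Finset.mem_filter, not_and_or] at hm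
      rw [MvPolynomial.coeff_monomial, if_pos rfl]
      exact Finsupp.notMem_support_iff.1 (hm.resolve_right fun h' => h' rfl)
  have h0 := eq_zero_of_mem_relIdeal hh n le_rfl S f (fun b hb => ?_) hfI
  · have := hcoeff m₀.2
    rw [h0, MvPolynomial.coeff_zero] at this
    exact Finsupp.mem_support_iff.1 hm₀ this.symm
  · rw [MvPolynomial.mem_support_iff, hcoeff] at hb
    exact (hl (S, b) (Finsupp.mem_support_iff.2 hb)).isStandardExponent hh

end Flag

end LerayModel

namespace LerayModel

universe u

set_option linter.unusedSectionVars false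

/-! ### Bases of quotients by two-sided ideals -/

section Quotients

variable {A : Type*} [Ring A] [Module ℚ A]

lemma isAdditiveBasis_mk' (I : TwoSidedIdeal A) [Module ℚ I.ringCon.Quotient] {ι : Type*}
    {v : ι → A} (hI : ∀ l : ι →₀ ℚ, Finsupp.linearCombination ℚ v l ∈ I → l = 0)
    (hspan : Submodule.span ℚ (Set.range v ∪ {a | a ∈ I}) = ⊤) :
    IsAdditiveBasis fun i => I.ringCon.mk' (v i) := by
  have hmk : ∀ a, I.ringCon.mk' a = 0 ↔ a ∈ I := fun a => by
    rw [TwoSidedIdeal.mem_iff, ← RingCon.eq]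
    rfl
  let π : A →ₗ[ℚ] I.ringCon.Quotient := (I.ringCon.mk' : A →+ _).toRatLinearMap
  constructor
  · rw [linearIndependent_iff]
    intro l hl
    refine hI l ((hmk _).1 ?_)
    change π (Finsupp.linearCombination ℚ v l) = 0
    rw [Finsupp.apply_linearCombination]
    exact hl
  · rw [eq_top_iff]
    rintro a -
    obtain ⟨a, rfl⟩ := RingCon.mk'_surjective _ a
    change π a ∈ _
    have ha : a ∈ Submodule.span ℚ (Set.range v ∪ {a | a ∈ I}) := by rw [hspan]; trivial
    refine (Submodule.span_le (p := (Submodule.span ℚ _).comap π)).2 ?_ ha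
    rintro _ (⟨i, rfl⟩ | hb)
    · exact Submodule.subset_span ⟨i, rfl⟩
    · have : π _ = 0 := (hmk _).2 hb
      rw [SetLike.mem_coe, Submodule.mem_comap, this]
      exact Submodule.zero_mem _

/-- The stronger statement `e * a * r = 0` for all `a` is what passes through left multiplication of
`r`. -/
lemma mul_eq_zero_of_mem_span_singleton {A : Type*} [Ring A] {e : A} (he : ∀ a, e * a * e = 0)
    {r : A} (hr : r ∈ TwoSidedIdeal.span {e}) : e * r = 0 := by
  have key : ∀ a, e * a * r = 0 := by
    induction hr using TwoSidedIdeal.span_induction with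
    | mem x hx =>
      rw [Set.mem_singleton_iff.1 hx]
      exact he
    | zero => simp
    | add x y _ _ hx hy =>
      intro a
      rw [mul_add, hx, hy, add_zero]
    | neg x _ hx =>
      intro a
      rw [mul_neg, hx, neg_zero]
    | left_absorb b x _ hx =>
      intro a
      rw [← mul_assoc, mul_assoc e, hx]
    | right_absorb b x _ hx =>
      intro a
      rw [← mul_assoc, hx, zero_mul]
  simpa using key 1

end Quotients

/-! ### The bases of `B̂(L, H)` and `B(L, H)`, and the Gröbner basis -/

section Bases

variable {L : Type u} [Lattice L] [BoundedOrder L] {n : ℕ} {h : Fin n → L}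

lemma eVar_mul_mul_eVar (t : Fin n) (a : R n) : eVar t * a * eVar t = 0 := by
  have ha : a ∈ Submodule.span ℚ (Set.range (mono (n := n))) := by
    rw [span_range_mono]; trivial
  induction ha using Submodule.span_induction with
  | mem x hx =>
    obtain ⟨m, rfl⟩ := hx
    have ht : eVar t = mono (({t}, 0) : Expo n) := by rw [mono_zero, eProd_singleton]
    rw [ht]
    by_cases hd : Disjoint ({t} : Finset (Fin n)) m.1
    · obtain ⟨ε, -, h1⟩ := exists_mono_mul_mono (m := (({t}, 0) : Expo n)) hd
      rw [h1, smul_mul_assoc, mono_mul_mono_eq_zero, smul_zero]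
      rw [Finset.disjoint_singleton_right]
      simp [expoMul]
    · rw [mono_mul_mono_eq_zero (m := (({t}, 0) : Expo n)) hd, zero_mul]
  | zero => simp
  | add x y _ _ hx hy => rw [mul_add, add_mul, hx, hy, add_zero]
  | smul c x _ hx => rw [mul_smul_comm, smul_mul_assoc, hx, smul_zero]

variable [Finite L] [IsUpperModularLattice L]

/-- The maximum has the least index, so it lies in no broken circuit. It is below no other element,
so the rank bounds stay the same, and any join involving it is the maximum itself. -/
lemma IsStandard.insert_top (hh : IsBlowupOrder h) {t : Fin n} (ht : h t = ⊤) {m : Expo n}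
    (hm : IsStandard h m) : IsStandard h (insert t m.1, m.2) := by
  classical
  have hle : ∀ i, t ≤ i := fun i => hh.ord t i (ht ▸ le_top)
  have hins : ∀ {S : Finset (Fin n)}, Compatible h n S → Compatible h n (insert t S) := by
    intro S hS Y hY i hi hin hYi
    by_cases htY : t ∈ Y
    · have : h i = h t := by
        rw [← hYi, ht]
        exact top_le_iff.1 (ht ▸ Finset.le_sup (f := h) htY)
      rwa [hh.inj this]
    · exact hS Y ((Finset.subset_insert_iff_of_notMem htY).1 hY) i hi hin hYi
  refine ⟨?_, ⟨?_, ?_⟩, fun g hg => ⟨(hm.2.2 g hg).1, ?_⟩⟩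
  · rw [hh.isNestedIdx_iff, Finset.insert_union]
    exact hins ((hh.isNestedIdx_iff _).1 hm.1)
  · exact (isSimplex_iff hh).2 (hins ((isSimplex_iff hh).1 hm.2.1.1))
  · rintro T hT ⟨g, hg, hC⟩
    have htT : t ∉ T := fun htT => (hg t htT).not_ge (hle g)
    exact hm.2.1.2 T ((Finset.subset_insert_iff_of_notMem htT).1 hT) ⟨g, hg, hC⟩
  · have h1 := (hm.2.2 g hg).2
    rw [Finset.insert_union, Finset.filter_insert, if_neg (by rw [ht]; exact not_top_lt)]
    exact h1

lemma span_standard_union [IsAtomistic L] (hh : IsBlowupOrder h) :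
    Submodule.span ℚ (Set.range (fun m : {m : Expo n // IsStandard h m} => mono m.1) ∪
      {a | a ∈ lerayIdeal h}) = ⊤ := by
  rw [eq_top_iff, ← span_range_mono, Submodule.span_le]
  rintro _ ⟨m, rfl⟩
  have h1 := mono_mem_sup_span isExpoOrder_lexKey (relations_subset_lerayIdeal hh)
    (exists_initial_dvd hh isExpoOrder_lexKey refinesLex_lexKey) m
  have h2 : idealSubmodule (lerayIdeal h) ≤ Submodule.span ℚ (Set.range
      (fun m : {m : Expo n // IsStandard h m} => mono m.1) ∪ {a | a ∈ lerayIdeal h}) :=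
    fun a ha => Submodule.subset_span (Or.inr (mem_idealSubmodule.1 ha))
  refine sup_le h2 (Submodule.span_mono ?_) h1
  · rintro _ ⟨m', hm', rfl⟩
    exact Or.inl ⟨⟨m', hm'.1⟩, rfl⟩

/-- The standard monomials form a basis of `B̂(L, H)`. -/
lemma isAdditiveBasis_bHat [IsAtomistic L] (hh : IsBlowupOrder h) :
    IsAdditiveBasis (fun m : {m : Expo n // IsStandard h m} =>
      (lerayIdeal h).ringCon.mk' (mono m.1)) := by
  classical
  refine isAdditiveBasis_mk' _ (fun l hl => ?_) (span_standard_union hh)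
  refine Finsupp.mapDomain_injective Subtype.val_injective ?_
  rw [Finsupp.mapDomain_zero]
  refine eq_zero_of_linearCombination_mem hh _ (fun m hm => ?_) ?_
  · obtain ⟨m', -, rfl⟩ := Finset.mem_image.1 (Finsupp.mapDomain_support hm)
    exact m'.2
  · rw [Finsupp.linearCombination_mapDomain]
    exact hl

lemma eVar_mul_mono {t : Fin n} (hle : ∀ i, t ≤ i) {m : Expo n} (hm : t ∉ m.1) :
    eVar t * mono m = mono (insert t m.1, m.2) := by
  rw [mono, mono, eProd_insert_of_lt fun i hi => lt_of_le_of_ne (hle i) fun e => hm (e ▸ hi),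
    mul_assoc]

/-- The standard monomials without `e_⊤` form a basis of `B(L, H)`. -/
lemma isAdditiveBasis_b [IsAtomistic L] (hh : IsBlowupOrder h) {t : Fin n} (ht : h t = ⊤) :
    IsAdditiveBasis (fun m : {m : Expo n // IsStandard h m ∧ t ∉ m.1} =>
      (eIdeal h t).ringCon.mk' ((lerayIdeal h).ringCon.mk' (mono m.1))) := by
  have hle : ∀ i, t ≤ i := fun i => hh.ord t i (ht ▸ le_top)
  obtain ⟨hind, hspan⟩ := isAdditiveBasis_bHat hh
  set π := (lerayIdeal h).ringCon.mk'
  refine isAdditiveBasis_mk' (eIdeal h t) (v := fun m : {m : Expo n // IsStandard h m ∧ t ∉ m.1} =>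
    π (mono m.1)) (fun l hl => ?_) ?_
  · have h1 : π (eVar t) * Finsupp.linearCombination ℚ
        (fun m : {m : Expo n // IsStandard h m ∧ t ∉ m.1} => π (mono m.1)) l = 0 := by
      refine mul_eq_zero_of_mem_span_singleton (fun a => ?_) hl
      obtain ⟨a, rfl⟩ := RingCon.mk'_surjective _ a
      change π (eVar t) * π a * π (eVar t) = 0
      rw [← map_mul, ← map_mul, eVar_mul_mul_eVar, map_zero]
    -- Multiplication by `e_t` acts on these monomials as an injection into the basis; as `t` is the
    -- least index, no sign appears.
    let f : {m : Expo n // IsStandard h m ∧ t ∉ m.1} → {m : Expo n // IsStandard h m} :=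
      fun m => ⟨(insert t m.1.1, m.1.2), m.2.1.insert_top hh ht⟩
    have hf : Function.Injective f := by
      intro m m' hmm
      have h2 := Prod.mk.inj (Subtype.mk.inj hmm)
      refine Subtype.ext (Prod.ext ?_ h2.2)
      rw [← Finset.erase_insert m.2.2, ← Finset.erase_insert m'.2.2, h2.1]
    refine linearIndependent_iff.1 (hind.comp f hf) l ?_
    rw [← h1, Finsupp.linearCombination_apply, Finsupp.linearCombination_apply, Finsupp.sum,
      Finsupp.sum, Finset.mul_sum]
    refine Finset.sum_congr rfl fun m _ => ?_
    have h3 := map_rat_smul (AddMonoidHom.mulLeft (π (eVar t))) (l m) (π (mono m.1))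
    rw [AddMonoidHom.coe_mulLeft, ← map_mul, eVar_mul_mono hle m.2.2] at h3
    exact h3.symm
  · rw [eq_top_iff, ← hspan, Submodule.span_le]
    rintro _ ⟨⟨m, hm⟩, rfl⟩
    refine Submodule.subset_span ?_
    by_cases htm : t ∈ m.1
    · right
      have h1 : mono m = eVar t * mono (m.1.erase t, m.2) := by
        rw [eVar_mul_mono hle (Finset.notMem_erase _ _), Finset.insert_erase htm]
      change π (mono m) ∈ eIdeal h t
      rw [h1, map_mul]
      exact TwoSidedIdeal.mul_mem_right _ _ _ (TwoSidedIdeal.subset_span rfl)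
    · exact Or.inl ⟨⟨m, hm, htm⟩, rfl⟩

/-- The relations form a Gröbner basis for every order that refines the lexicographic one. -/
lemma isGroebnerBasis_relations [IsAtomistic L] (hh : IsBlowupOrder h) {M : Type*}
    [AddCommMonoid M] [LinearOrder M] [IsOrderedCancelAddMonoid M] [WellFoundedLT M]
    {φ : Expo n → M} (hφ : IsExpoOrder φ) (href : RefinesLex φ) :
    IsGroebnerBasis (ltOf φ) (relNotNested h ∪ relCircuit h ∪ relPower h) (lerayIdeal h) :=
  isGroebnerBasis_of_linearIndependent hφ (relations_subset_lerayIdeal hh)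
    (exists_initial_dvd hh hφ href) (eq_zero_of_linearCombination_mem hh)

end Bases

end LerayModel

theorem mainTheorem4 {L : Type*} [Lattice L] [BoundedOrder L] [Finite L]
    [IsUpperModularLattice L] [IsAtomistic L]
    (G : Set L) (hG : LerayModel.IsBuildingSet G) (hG_top : (⊤ : L) ∈ G)
    {n : ℕ} (h : Fin n → L) (h_inj : Function.Injective h)
    (hH : LerayModel.IsPartialBuildingSet G (Set.range h))
    (h_ord : ∀ i j : Fin n, h j ≤ h i → i ≤ j) :
    (∀ lt ∈ ({LerayModel.lexLT, LerayModel.grlexLT} :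
        Set (LerayModel.Expo n → LerayModel.Expo n → Prop)),
      LerayModel.IsGroebnerBasis lt
        (LerayModel.relNotNested h ∪ LerayModel.relCircuit h ∪ LerayModel.relPower h)
        (LerayModel.lerayIdeal h)) ∧
    LerayModel.IsAdditiveBasis
      (fun m : {m : LerayModel.Expo n // LerayModel.IsStandard h m} =>
        (LerayModel.lerayIdeal h).ringCon.mk' (LerayModel.mono m.1)) ∧
    (∀ t : Fin n, h t = ⊤ →
      LerayModel.IsAdditiveBasis
        (fun m : {m : LerayModel.Expo n // LerayModel.IsStandard h m ∧ t ∉ m.1} =>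
          (LerayModel.eIdeal h t).ringCon.mk'
            ((LerayModel.lerayIdeal h).ringCon.mk' (LerayModel.mono m.1)))) := by
  have hh := hH.isBlowupOrder hG h_inj h_ord
  refine ⟨?_, LerayModel.isAdditiveBasis_bHat hh, fun t ht => LerayModel.isAdditiveBasis_b hh ht⟩
  rintro lt (rfl | rfl)
  · have hlt : LerayModel.lexLT (n := n) = LerayModel.ltOf LerayModel.lexKey :=
      funext fun _ => funext fun _ => propext LerayModel.lexLT_iff
    rw [hlt]
    exact LerayModel.isGroebnerBasis_relations hh LerayModel.isExpoOrder_lexKey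
      LerayModel.refinesLex_lexKey
  · have hlt : LerayModel.grlexLT (n := n) = LerayModel.ltOf LerayModel.grlexKey :=
      funext fun _ => funext fun _ => propext LerayModel.grlexLT_iff
    rw [hlt]
    exact LerayModel.isGroebnerBasis_relations hh LerayModel.isExpoOrder_grlexKey
      LerayModel.refinesLex_grlexKey
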